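/- **Curves.** A curve is a differentiable $f:[a,b]\to\mathbb C$ ($a<b$) whose derivative is absolutely continuous and never zero. Write $ds=|f'(t)|\,dt$ for arclength. A direction angle is an absolutely continuous $\tau$ with $f'=|f'|e^{i\tau}$; the signed curvature is $\kappa=d\tau/ds$, the turning angle is $\Delta(f)=\int\kappa\,ds$, and the bending energy is $\|f\|^2=\frac14\int\kappa^2\,ds\in[0,\infty]$. Curves $f,g$ are equivalent, $f\equiv g$, if their unit speed reparametrisations coincide. The concatenation of curves is denoted $\sqcup$ (segments of length $0$ are omitted), and $[A,B]$ is the line segment from $A$ to $B$. A left (right) c-curve is a curve with $\kappa\ge0$ a.e. ($\kappa\le0$ a.e.) and $|\Delta(f)|\le\pi$; a u-turn is a c-curve with $|\Delta(f)|=\pi$. Elongating a u-turn contained in a curve means inserting a line segment before the u-turn, in its initial direction, and a congruent one after it. A right-left (left-right) s-curve is a right (left) c-curve followed by a left (right) one; an s-curve is a c-curve or one of these, and it is non-degenerate if it is not a c-curve. **Elastica.** Let $E(t)=\sin t+i\xi(t)$, $\xi(t)=\int_0^t\frac{\sin^2 r}{\sqrt{1+\sin^2 r}}\,dr$, and let $E_{[a,b]}$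 be its restriction to $[a,b]$. A curve is similar to $f$ if it is equivalent to $T\circ f$ with $T(z)=c_1z+c_2$ or $T(z)=c_1\bar z+c_2$, $c_1\ne0$; directly similar if $T(z)=c_1z+c_2$. A curve is of first form with parameters $t_0,t$, where $-\pi<t_0<t<\pi$, if it is directly similar to $E_{[t_0,t]}$; it is of second form with parameters $c\ge0$, $t\in[0,\pi]$, if it is directly similar to $E_{[-\pi,0]}\sqcup[0,c]\sqcup(c+E_{[0,t]})$. **Data.** Let $\alpha\in(0,\pi)$, $|\beta|\le\alpha$, $\beta>\alpha-\pi$, and let $u=(0,e^{i\alpha})$, $v=(1,e^{i\beta})$ be the unit tangent vectors with base points $0,1$ and the directions shown. Let $S(u,v)$ be the set of s-curves with initial unit tangent vector $u$ and terminal unit tangent vector $v$, $C_r(u,v)\subset S(u,v)$ the set of right c-curves among them, and $S'_{lr}(u,v)\subset S(u,v)$ the set of non-degenerate left-right s-curves among them. Put $\beta_0=\min\{\beta,0\}$, $\Gamma=[\alpha-\pi,\beta]$ if $\beta<0$ and $\Gamma=[\alpha-\pi,0)$ if $\beta\ge0$. For $\gamma\in\Gamma$ put $$y_1=\tfrac12\int_0^{\alpha-\gamma}\sqrt{\sin\tau}\,d\tau,\quad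 y_2=\tfrac12\int_0^{\beta-\gamma}\sqrt{\sin\tau}\,d\tau,\quad G(\gamma)=\frac{(y_1+y_2)^2}{-\sin\gamma},\quad \lambda(\gamma)=\frac{-\sin\gamma}{y_1+y_2},$$ $$\sigma(\gamma)=\cos\gamma+\frac{\sin\gamma}{y_1+y_2}\left(\sqrt{\sin(\alpha-\gamma)}+\sqrt{\sin(\beta-\gamma)}\right),$$ and let $t_1,t_2\in[0,\pi]$ be given by $\Delta(E_{[0,t_1]})=\alpha-\gamma$, $\Delta(E_{[0,t_2]})=\beta-\gamma$ (with $t_2=0$ if $\gamma=\beta$). Let $s_\gamma(u,v)=C_r(u,v)$ if $\gamma=\beta<0$; otherwise let $s_\gamma(u,v)$ be the set of non-degenerate right-left s-curves in $S(u,v)$ which have direction $e^{i\gamma}$ at an inflection point (a point where the right c-curve ends and the left one begins). Let $\ell_\gamma$ be the line of direction $e^{i\gamma}$ at distance $-\sin\gamma\,\frac{y_1}{y_1+y_2}$ from $0$, on the same side of $0$ as the point $1$ (for $\gamma=\beta<0$ this is the line through $1$ of direction $e^{i\beta}$). Let $r(u,\ell_\gamma)$ be the right c-curve that starts at $u$,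 ends tangentially on $\ell_\gamma$ and is similar to the segment $E_{[t,\pi]}$, $t\in[0,\pi)$, whose turning angle has the same magnitude. For $\gamma<\beta$ let $l(\ell_\gamma,v)$ be the left c-curve that starts tangentially on $\ell_\gamma$, ends at $v$ and is similar to the segment $E_{[0,t]}$, $t\in(0,\pi]$, of the same turning angle. Let $P_1$ be the end point of $r(u,\ell_\gamma)$ and $P_2$ the initial point of $l(\ell_\gamma,v)$. **Corollary 5.12.** Assume in addition that $\sigma(\beta)\ge0$ in case $\beta<0$. Then $G$ has a minimum value $G_{min}$ on $\Gamma$, and the following hold. (i) If $\beta<0$, then $\|f\|^2>G_{min}$ for all $f\in S'_{lr}(u,v)$. (ii) If $\gamma\in\Gamma$ and $G(\gamma)>G_{min}$, then $\|f\|^2>G_{min}$ for all $f\in s_\gamma(u,v)$. (iii) If $G(\alpha-\pi)=G_{min}$, then $\sigma(\alpha-\pi)\ge0$, and, with $\gamma=\alpha-\pi$, the curve $f_\gamma=r(u,\ell_\gamma)\sqcup[P_1,P_2]\sqcup l(\ell_\gamma,v)$ exists, is of second form with parameters $c=\sigma(\gamma)/\lambda(\gamma)$ and $t=t_2$, belongs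 to $s_\gamma(u,v)$ and has bending energy $G_{min}$; every curve in $s_\gamma(u,v)$ with bending energy $G_{min}$ is obtained from $f_\gamma$, up to equivalence, by finitely many (possibly no) elongations of u-turns. (iv) If $\gamma\in(\alpha-\pi,\beta_0)$ and $G(\gamma)=G_{min}$, then $\sigma(\gamma)=0$, and the curve $f_\gamma=r(u,\ell_\gamma)\sqcup l(\ell_\gamma,v)$ exists, is of first form with parameters $t_0=-t_1$ and $t=t_2$, belongs to $s_\gamma(u,v)$ and has bending energy $G_{min}$; every curve in $s_\gamma(u,v)$ with bending energy $G_{min}$ is equivalent to $f_\gamma$. (v) If $\beta<0$ and $G(\beta)=G_{min}$, then $\sigma(\beta)=0$, and the curve $f_\beta=r(u,\ell_\beta)$ is of first form with parameters $t_0=-t_1$ and $t=0$, belongs to $s_\beta(u,v)$ and has bending energy $G_{min}$; every curve in $s_\beta(u,v)$ with bending energy $G_{min}$ is equivalent to $f_\beta$. (vi) The minimum bending energy in $S(u,v)$ is $G_{min}$ (and it is attained). -/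

import Mathlib

open Set MeasureTheory
open scoped ENNReal

noncomputable section

namespace ElasticSpline

/-! ### Curves in the plane -/

/-- A parametrised path `toFun : [a, b] → ℂ` (only the values on `[a, b]` matter). -/
structure PlanePath where
  a : ℝ
  b : ℝ
  toFun : ℝ → ℂ

namespace PlanePath

/-- The derivative `f'` on `[a, b]` (one-sided at the end points). -/
def vel (f : PlanePath) (t : ℝ) : ℂ := derivWithin f.toFun (Icc f.a f.b) t

/-- A curve: a differentiable function on `[a, b]`, `a < b`, whose derivative is absolutely
continuous and never zero. -/
def IsCurve (f : PlanePath) : Prop :=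
  f.a < f.b ∧ DifferentiableOn ℝ f.toFun (Icc f.a f.b) ∧
    AbsolutelyContinuousOnInterval f.vel f.a f.b ∧ ∀ t ∈ Icc f.a f.b, f.vel t ≠ 0

/-- Arclength `s = ∫_a^t |f'|`. -/
def arcLength (f : PlanePath) (t : ℝ) : ℝ := ∫ r in f.a..t, ‖f.vel r‖

def len (f : PlanePath) : ℝ := f.arcLength f.b

/-- Two curves are equivalent when their unit speed curves `[f]`, `[g]` coincide: they have the same
length and they are at the same place whenever they have travelled the same arclength. -/
def Equiv (f g : PlanePath) : Prop :=
  f.len = g.len ∧ ∀ s ∈ Icc f.a f.b, ∀ t ∈ Icc g.a g.b,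
    f.arcLength s = g.arcLength t → f.toFun s = g.toFun t

/-- The sub-path of `f` with parameters in `[c, d]`. -/
def restrict (f : PlanePath) (c d : ℝ) : PlanePath := ⟨c, d, f.toFun⟩

/-- `T ∘ f`. -/
def map (T : ℂ → ℂ) (f : PlanePath) : PlanePath := ⟨f.a, f.b, fun t => T (f.toFun t)⟩

/-- The directed line segment `[A, B]`; it is a trivial path of length `0` if `A = B`. -/
def lineSeg (A B : ℂ) : PlanePath := ⟨0, 1, fun t => A + (t : ℂ) * (B - A)⟩

def start (f : PlanePath) : ℂ := f.toFun f.a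

def finish (f : PlanePath) : ℂ := f.toFun f.b

/-- The unit direction `f'(t) / |f'(t)|`. -/
def dir (f : PlanePath) (t : ℝ) : ℂ := f.vel t / (‖f.vel t‖ : ℂ)

/-- `τ` is a direction angle of `f`: it is absolutely continuous and `f' = |f'| e^{iτ}`. -/
def IsDirectionAngle (f : PlanePath) (τ : ℝ → ℝ) : Prop :=
  AbsolutelyContinuousOnInterval τ f.a f.b ∧
    ∀ t ∈ Icc f.a f.b, f.vel t = (‖f.vel t‖ : ℂ) * Complex.exp (τ t * Complex.I)

/-- A direction angle of `f`. On `[a, b]` it is unique up to a constant in `2πℤ`. -/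
def angle (f : PlanePath) : ℝ → ℝ := Classical.epsilon f.IsDirectionAngle

/-- The signed curvature `κ = dτ/ds`, at the point with parameter `t`. -/
def curvature (f : PlanePath) (t : ℝ) : ℝ := deriv f.angle t / ‖f.vel t‖

/-- The turning angle `Δ(f) = ∫ κ ds`, where `ds = |f'(t)| dt`. -/
def turning (f : PlanePath) : ℝ := ∫ t in f.a..f.b, f.curvature t * ‖f.vel t‖

/-- The bending energy `‖f‖² = (1/4) ∫ κ² ds`, possibly infinite. -/
def energy (f : PlanePath) : ℝ≥0∞ :=
  (1 / 4) * ∫⁻ t in Icc f.a f.b, ENNReal.ofReal (f.curvature t ^ 2 * ‖f.vel t‖)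

def IsLeftCurve (f : PlanePath) : Prop :=
  f.IsCurve ∧ ∀ᵐ t ∂(volume.restrict (Icc f.a f.b)), 0 ≤ f.curvature t

def IsRightCurve (f : PlanePath) : Prop :=
  f.IsCurve ∧ ∀ᵐ t ∂(volume.restrict (Icc f.a f.b)), f.curvature t ≤ 0

def IsLeftCCurve (f : PlanePath) : Prop := f.IsLeftCurve ∧ |f.turning| ≤ Real.pi

def IsRightCCurve (f : PlanePath) : Prop := f.IsRightCurve ∧ |f.turning| ≤ Real.pi

def IsCCurve (f : PlanePath) : Prop := f.IsLeftCCurve ∨ f.IsRightCCurve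

def IsUTurn (f : PlanePath) : Prop := f.IsCCurve ∧ |f.turning| = Real.pi

/-- `f` splits at the parameter `c` into a right c-curve followed by a left c-curve. -/
def SplitsRightLeft (f : PlanePath) (c : ℝ) : Prop :=
  c ∈ Ioo f.a f.b ∧ (f.restrict f.a c).IsRightCCurve ∧ (f.restrict c f.b).IsLeftCCurve

/-- `f` splits at the parameter `c` into a left c-curve followed by a right c-curve. -/
def SplitsLeftRight (f : PlanePath) (c : ℝ) : Prop :=
  c ∈ Ioo f.a f.b ∧ (f.restrict f.a c).IsLeftCCurve ∧ (f.restrict c f.b).IsRightCCurve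

/-- An s-curve: a c-curve, or two c-curves with opposite turning directions, one after the other. -/
def IsSCurve (f : PlanePath) : Prop :=
  f.IsCurve ∧ (f.IsCCurve ∨ ∃ c, f.SplitsRightLeft c ∨ f.SplitsLeftRight c)

/-- `h` is cut by finitely many parameters into consecutive pieces equivalent to the members of the
list (a member of length `0` is a single point). -/
def HasPieces : PlanePath → List PlanePath → Prop
  | h, [] => h.a = h.b
  | h, f :: fs => ∃ c ∈ Icc h.a h.b,
      (h.restrict h.a c).Equiv f ∧ HasPieces (h.restrict c h.b) fs

/-- `h ≡ f₁ ⊔ f₂ ⊔ ⋯`, the concatenation of the members of the list; in particular the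
concatenation is again a curve. -/
def IsJoin (h : PlanePath) (fs : List PlanePath) : Prop := h.IsCurve ∧ h.HasPieces fs

/-- `g` is similar to `f`: `g ≡ T ∘ f` with `T z = c₁ z + c₂` or `T z = c₁ z̄ + c₂`, `c₁ ≠ 0`. -/
def Similar (g f : PlanePath) : Prop :=
  ∃ c₁ c₂ : ℂ, c₁ ≠ 0 ∧ (g.Equiv (f.map fun z => c₁ * z + c₂) ∨
    g.Equiv (f.map fun z => c₁ * (starRingEnd ℂ) z + c₂))

/-- `g` is directly similar to `f`: `g ≡ T ∘ f` with `T z = c₁ z + c₂`, `c₁ ≠ 0`. -/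
def DirectlySimilar (g f : PlanePath) : Prop :=
  ∃ c₁ c₂ : ℂ, c₁ ≠ 0 ∧ g.Equiv (f.map fun z => c₁ * z + c₂)

/-- `g` arises from `f` by elongating a u-turn `f|[p, q]`: a segment of length `c` in the direction
of `f'(p)` is inserted before the u-turn, and a congruent one, in the opposite direction, after it. -/
def IsElongation (f g : PlanePath) : Prop :=
  ∃ p q c : ℝ, f.a ≤ p ∧ p < q ∧ q ≤ f.b ∧ 0 < c ∧ (f.restrict p q).IsUTurn ∧
    g.IsJoin
      [f.restrict f.a p,
       lineSeg (f.toFun p) (f.toFun p + c * f.dir p),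
       (f.restrict p q).map (fun z => z + c * f.dir p),
       lineSeg (f.toFun q + c * f.dir p) (f.toFun q),
       f.restrict q f.b]

/-- `g` is, up to equivalence, obtained from `f` by finitely many (possibly no) elongations of
u-turns. -/
def ElongatesTo (f g : PlanePath) : Prop :=
  Relation.ReflTransGen
    (fun x y : PlanePath => x.IsCurve ∧ y.IsCurve ∧ (x.Equiv y ∨ x.IsElongation y)) f g

end PlanePath

open ElasticSpline.PlanePath

/-! ### Unit tangent vectors, lines and the sets of curves connecting them -/

/-- A unit tangent vector `(position, direction)`; the direction has modulus `1` in all uses. -/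
abbrev UnitTangent := ℂ × ℂ

def PlanePath.tangentAt (f : PlanePath) (t : ℝ) : UnitTangent := (f.toFun t, f.dir t)

/-- The line through `f(t)` which is parallel to `f'(t)`. -/
def PlanePath.tangentLineAt (f : PlanePath) (t : ℝ) : Set ℂ :=
  {z | ∃ r : ℝ, z = f.toFun t + (r : ℂ) * f.dir t}

def PlanePath.Connects (f : PlanePath) (u v : UnitTangent) : Prop :=
  f.tangentAt f.a = u ∧ f.tangentAt f.b = v

/-- `S(u, v)`: the s-curves which connect `u` to `v`. -/
def sCurves (u v : UnitTangent) : Set PlanePath := {f | f.IsSCurve ∧ f.Connects u v}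

/-- `C_r(u, v)`: the right c-curves which connect `u` to `v`. -/
def rightCCurves (u v : UnitTangent) : Set PlanePath := {f | f.IsRightCCurve ∧ f.Connects u v}

/-- `C_r(u, ℓ)`: the right c-curves which start at `u` and end tangentially on the line `ℓ`. -/
def rightCCurvesToLine (u : UnitTangent) (l : Set ℂ) : Set PlanePath :=
  {f | f.IsRightCCurve ∧ f.tangentAt f.a = u ∧ f.tangentLineAt f.b = l}

/-- `C_l(ℓ, v)`: the left c-curves which start tangentially on the line `ℓ` and end at `v`. -/
def leftCCurvesFromLine (l : Set ℂ) (v : UnitTangent) : Set PlanePath :=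
  {f | f.IsLeftCCurve ∧ f.tangentLineAt f.a = l ∧ f.tangentAt f.b = v}

/-- `S'_lr(u, v)`: the non-degenerate left-right s-curves in `S(u, v)`. -/
def sCurvesLR (u v : UnitTangent) : Set PlanePath :=
  {f | f ∈ sCurves u v ∧ ¬ f.IsCCurve ∧ ∃ c, f.SplitsLeftRight c}

/-! ### Rectangular elastica -/

def xi (t : ℝ) : ℝ := ∫ r in (0 : ℝ)..t, Real.sin r ^ 2 / Real.sqrt (1 + Real.sin r ^ 2)

/-- The rectangular elastica `E(t) = sin t + i ξ(t)`. -/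
def elastica (t : ℝ) : ℂ := (Real.sin t : ℂ) + Complex.I * (xi t : ℂ)

/-- `E_{[a, b]}`. -/
def elasticaSeg (a b : ℝ) : PlanePath := ⟨a, b, elastica⟩

/-- `f` is the curve `r(u, ℓ)` up to parametrisation: the curve in `C_r(u, ℓ)` which is similar to
`E_{[t₁, π]}`, where `E_{[t₁, π]}` has the same magnitude of turning angle. -/
def IsOptimalRight (u : UnitTangent) (l : Set ℂ) (f : PlanePath) : Prop :=
  f ∈ rightCCurvesToLine u l ∧ ∃ t₁ ∈ Ico 0 Real.pi,
    (elasticaSeg t₁ Real.pi).turning = |f.turning| ∧ f.Similar (elasticaSeg t₁ Real.pi)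

/-- `f` is the curve `l(ℓ, v)` up to parametrisation: the curve in `C_l(ℓ, v)` which is similar to
`E_{[0, t₂]}`, where `E_{[0, t₂]}` has the same magnitude of turning angle. -/
def IsOptimalLeft (l : Set ℂ) (v : UnitTangent) (f : PlanePath) : Prop :=
  f ∈ leftCCurvesFromLine l v ∧ ∃ t₂ ∈ Ioc 0 Real.pi,
    (elasticaSeg 0 t₂).turning = |f.turning| ∧ f.Similar (elasticaSeg 0 t₂)

/-- `f` is of first form with parameters `t₀ < t`. -/
def IsFirstForm (t₀ t : ℝ) (f : PlanePath) : Prop :=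
  -Real.pi < t₀ ∧ t₀ < t ∧ t < Real.pi ∧ f.DirectlySimilar (elasticaSeg t₀ t)

/-- `f` is of second form with parameters `c, t`: it is directly similar to
`E_{[-π, 0]} ⊔ [0, c] ⊔ (c + E_{[0, t]})`. -/
def IsSecondForm (c t : ℝ) (f : PlanePath) : Prop :=
  0 ≤ c ∧ t ∈ Icc 0 Real.pi ∧ ∃ h : PlanePath,
    h.IsJoin [elasticaSeg (-Real.pi) 0, lineSeg 0 (c : ℂ),
      (elasticaSeg 0 t).map (fun z => (c : ℂ) + z)] ∧
    f.DirectlySimilar h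

/-! ### The data attached to the angles `α`, `β` -/

/-- `u = (0, e^{iα})`. -/
def uVec (α : ℝ) : UnitTangent := (0, Complex.exp (α * Complex.I))

/-- `v = (1, e^{iβ})`. -/
def vVec (β : ℝ) : UnitTangent := (1, Complex.exp (β * Complex.I))

open Classical in
/-- The set `Γ` of admissible inflection directions. -/
def GammaSet (α β : ℝ) : Set ℝ := if β < 0 then Icc (α - Real.pi) β else Ico (α - Real.pi) 0

def y₁ (α γ : ℝ) : ℝ := (1 / 2) * ∫ τ in (0 : ℝ)..(α - γ), Real.sqrt (Real.sin τ)

def y₂ (β γ : ℝ) : ℝ := (1 / 2) * ∫ τ in (0 : ℝ)..(β - γ), Real.sqrt (Real.sin τ)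

def G (α β γ : ℝ) : ℝ := 1 / (-Real.sin γ) * (y₁ α γ + y₂ β γ) ^ 2

def sigma (α β γ : ℝ) : ℝ :=
  Real.cos γ + Real.sin γ / (y₁ α γ + y₂ β γ) *
    (Real.sqrt (Real.sin (α - γ)) + Real.sqrt (Real.sin (β - γ)))

def lam (α β γ : ℝ) : ℝ := -Real.sin γ / (y₁ α γ + y₂ β γ)

/-- The line `ℓ_γ` with direction `e^{iγ}`, at distance `a_γ = -sin γ · y₁ / (y₁ + y₂)` from `0`, on
the same side of `0` as the point `1` (whose signed distance in these terms is `-sin γ`). For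
`γ = β < 0` one has `y₂ = 0` and this is the line through `1` with direction `e^{iβ}`. -/
def inflectionLine (α β γ : ℝ) : Set ℂ :=
  {z | (z * Complex.exp (-(γ * Complex.I))).im =
    -Real.sin γ * (y₁ α γ / (y₁ α γ + y₂ β γ))}

open Classical in
/-- The class `s_γ(u, v)`: the set `C_r(u, v)` if `γ = β < 0`; otherwise the set of non-degenerate
right-left s-curves in `S(u, v)` whose direction at an inflection point is `e^{iγ}`. -/
def sClass (α β γ : ℝ) : Set PlanePath :=
  if β < 0 ∧ γ = β then rightCCurves (uVec α) (vVec β)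
  else {f | f ∈ sCurves (uVec α) (vVec β) ∧ ¬ f.IsCCurve ∧
    ∃ c, f.SplitsRightLeft c ∧ f.dir c = Complex.exp (γ * Complex.I)}

end ElasticSpline

end

open ElasticSpline

/-!
Let `f` be a right c-curve from direction `α` down to `γ` followed by a left one up to `β`, with
direction angle `τ`. By the inequality `κ² ≥ 2 m |κ| √(sin (τ - γ)) - m² sin (τ - γ)`, the bending
energy dominates a multiple of the variation `∫ √(sin (τ - γ)) |dτ|`, whose value is `2 (y₁ + y₂)`,
minus a multiple of the displacement `-sin γ` across the direction `γ`; the optimal `m` gives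
`‖f‖² ≥ G γ`. Equality forces `|κ|` to be proportional to `√(sin (τ - γ))`, the equation of the
elastica, wherever `sin (τ - γ) ≠ 0`, and `τ` can rest only at the directions `γ` and `γ + π`: `f`
is an elastica with line segments inserted, and the condition on its displacement along `γ` reads
`λ (b - a - d) = σ`, where `λ b` is the length of the segment at the inflection point and `λ a` and
`λ d` are those of the segments before a right and after a left u-turn. Since `G'` is a positive
multiple of `σ`, the sign of `σ` at a minimum of `G` decides which segments occur. For a left-right
s-curve the same inequality at `γ = β` gives `‖f‖² > G β`, as its direction angle exceeds `α`.
-/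

namespace ElasticSpline

open scoped Real
open Complex (I)
open PlanePath

/-! ### Absolutely continuous functions -/

section AbsolutelyContinuous

variable {a b : ℝ}

theorem absolutelyContinuousOnInterval_of_dist_le {X Y : Type*} [PseudoMetricSpace X]
    [PseudoMetricSpace Y] {f : ℝ → X} {g : ℝ → Y} {K : ℝ}
    (hf : AbsolutelyContinuousOnInterval f a b)
    (h : ∀ x ∈ uIcc a b, ∀ y ∈ uIcc a b, dist (g x) (g y) ≤ K * dist (f x) (f y)) :
    AbsolutelyContinuousOnInterval g a b := by
  refine squeeze_zero' (Filter.Eventually.of_forall fun _ => Finset.sum_nonneg fun _ _ =>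
    dist_nonneg) ?_ (by simpa using Filter.Tendsto.const_mul K hf)
  filter_upwards [Filter.mem_inf_of_right (Filter.mem_principal_self _)] with E hE
  rw [Finset.mul_sum]
  exact Finset.sum_le_sum fun i hi => h _ (hE.1 i hi).1 _ (hE.1 i hi).2

theorem absolutelyContinuousOnInterval_congr {X : Type*} [PseudoMetricSpace X] {f g : ℝ → X}
    (hf : AbsolutelyContinuousOnInterval f a b) (h : EqOn f g (uIcc a b)) :
    AbsolutelyContinuousOnInterval g a b :=
  absolutelyContinuousOnInterval_of_dist_le (K := 1) hf fun x hx y hy => by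
    rw [h hx, h hy, one_mul]

theorem absolutelyContinuousOnInterval_contDiff_comp {E F : Type*} [NormedAddCommGroup E]
    [NormedSpace ℝ E] [ProperSpace E] [NormedAddCommGroup F] [NormedSpace ℝ F] {f : ℝ → E}
    {g : E → F} (hg : ContDiff ℝ 1 g) (hf : AbsolutelyContinuousOnInterval f a b) :
    AbsolutelyContinuousOnInterval (fun x => g (f x)) a b := by
  obtain ⟨C, hC⟩ := hf.exists_bound
  obtain ⟨K, hK⟩ := hg.contDiffOn.exists_lipschitzOnWith (s := Metric.closedBall (0 : E) C)
    (by decide) (convex_closedBall 0 C) (isCompact_closedBall _ _)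
  exact absolutelyContinuousOnInterval_of_dist_le hf fun x hx y hy =>
    hK.dist_le_mul _ (by simpa using hC x hx) _ (by simpa using hC y hy)

theorem absolutelyContinuousOnInterval_integral {E : Type*} [NormedAddCommGroup E]
    [NormedSpace ℝ E] {g : ℝ → E} (hg : IntervalIntegrable g volume a b) :
    AbsolutelyContinuousOnInterval (fun x => ∫ t in a..x, g t) a b := by
  have hga : ∀ x ∈ uIcc a b, IntervalIntegrable g volume a x := fun x hx =>
    hg.mono_set (uIcc_subset_uIcc_left hx)
  refine absolutelyContinuousOnInterval_of_dist_le (K := 1)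
    (hg.norm.absolutelyContinuousOnInterval_intervalIntegral left_mem_uIcc) fun x hx y hy => ?_
  rw [one_mul, dist_eq_norm, dist_eq_norm,
    intervalIntegral.integral_interval_sub_left (hga x hx) (hga y hy),
    intervalIntegral.integral_interval_sub_left (hga x hx).norm (hga y hy).norm, Real.norm_eq_abs]
  exact intervalIntegral.norm_integral_le_abs_integral_norm

theorem ae_differentiableAt_of_absolutelyContinuousOnInterval {V : Type*} [NormedAddCommGroup V]
    [NormedSpace ℝ V] [FiniteDimensional ℝ V] {f : ℝ → V}
    (hf : AbsolutelyContinuousOnInterval f a b) :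
    ∀ᵐ x, x ∈ uIcc a b → DifferentiableAt ℝ f x :=
  hf.boundedVariationOn.ae_differentiableAt_of_mem_uIcc

theorem intervalIntegrable_deriv_complex {w : ℝ → ℂ} (hw : AbsolutelyContinuousOnInterval w a b) :
    IntervalIntegrable (deriv w) volume a b := by
  have hre := (absolutelyContinuousOnInterval_contDiff_comp
    Complex.reCLM.contDiff hw).intervalIntegrable_deriv
  have him := (absolutelyContinuousOnInterval_contDiff_comp
    Complex.imCLM.contDiff hw).intervalIntegrable_deriv
  have hsum : IntervalIntegrable (fun x => ((deriv (fun t => Complex.reCLM (w t)) x : ℝ) : ℂ) +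
      ((deriv (fun t => Complex.imCLM (w t)) x : ℝ) : ℂ) * I) volume a b :=
    .add ⟨hre.1.ofReal, hre.2.ofReal⟩ (.mul_const ⟨him.1.ofReal, him.2.ofReal⟩ I)
  refine hsum.congr_ae ?_
  rw [Filter.EventuallyEq, ae_restrict_iff' measurableSet_uIoc]
  filter_upwards [ae_differentiableAt_of_absolutelyContinuousOnInterval hw] with x hx hxab
  have h := (hx (uIoc_subset_uIcc hxab)).hasDerivAt
  have hderiv (L : ℂ →L[ℝ] ℝ) : deriv (fun t => L (w t)) x = L (deriv w x) :=
    (L.hasFDerivAt.comp_hasDerivAt x h).deriv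
  simp only [hderiv]
  exact Complex.re_add_im _

theorem exists_absolutelyContinuousOnInterval_log {w : ℝ → ℂ}
    (hw : AbsolutelyContinuousOnInterval w a b) (h0 : ∀ t ∈ uIcc a b, w t ≠ 0) :
    ∃ L : ℝ → ℂ, AbsolutelyContinuousOnInterval L a b ∧
      ∀ t ∈ uIcc a b, w t = Complex.exp (L t) := by
  have hint : IntervalIntegrable (fun t => deriv w t * (w t)⁻¹) volume a b :=
    (intervalIntegrable_deriv_complex hw).mul_continuousOn (hw.continuousOn.inv₀ h0)
  set L : ℝ → ℂ := fun x => Complex.log (w a) + ∫ t in a..x, deriv w t * (w t)⁻¹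
  have hL : AbsolutelyContinuousOnInterval L a b :=
    absolutelyContinuousOnInterval_contDiff_comp (contDiff_const.add contDiff_id)
      (absolutelyContinuousOnInterval_integral hint)
  refine ⟨L, hL, fun t ht => ?_⟩
  have hexp : AbsolutelyContinuousOnInterval (fun x => Complex.exp (-L x)) a b :=
    absolutelyContinuousOnInterval_contDiff_comp
      (g := fun z => Complex.exp (-z)) contDiff_neg.cexp hL
  obtain ⟨C, hC⟩ := (hexp.smul hw).const_of_ae_hasDerivAt_zero (by
    filter_upwards [ae_differentiableAt_of_absolutelyContinuousOnInterval hw,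
      hint.ae_hasDerivAt_integral] with x hdw hdL hx
    have hdL' := (hdL hx a left_mem_uIcc).const_add (Complex.log (w a))
    refine (hdL'.neg.cexp.mul (hdw hx).hasDerivAt).congr_deriv ?_
    field_simp [h0 x hx]
    ring)
  have hconst : Complex.exp (-L t) * w t = Complex.exp (-L a) * w a :=
    (hC t ht).trans (hC a left_mem_uIcc).symm
  have hwa : w a = Complex.exp (L a) := by simp [L, Complex.exp_log (h0 a left_mem_uIcc)]
  rw [hwa, ← Complex.exp_add, neg_add_cancel, Complex.exp_zero, Complex.exp_neg,
    inv_mul_eq_one₀ (Complex.exp_ne_zero _)] at hconst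
  exact hconst.symm

theorem exists_absolutelyContinuousOnInterval_arg {w : ℝ → ℂ}
    (hw : AbsolutelyContinuousOnInterval w a b) (h0 : ∀ t ∈ uIcc a b, w t ≠ 0) :
    ∃ τ : ℝ → ℝ, AbsolutelyContinuousOnInterval τ a b ∧
      ∀ t ∈ uIcc a b, w t = (‖w t‖ : ℂ) * Complex.exp (τ t * I) := by
  obtain ⟨L, hL, hwL⟩ := exists_absolutelyContinuousOnInterval_log hw h0
  refine ⟨fun t => (L t).im,
    absolutelyContinuousOnInterval_contDiff_comp Complex.imCLM.contDiff hL, fun t ht => ?_⟩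
  rw [hwL t ht, Complex.norm_exp, Complex.ofReal_exp, ← Complex.exp_add, Complex.re_add_im]

theorem ae_restrict_Icc_iff {p : ℝ → Prop} :
    (∀ᵐ t ∂volume.restrict (Icc a b), p t) ↔ ∀ᵐ t, t ∈ Ioo a b → p t := by
  rw [← restrict_Ioo_eq_restrict_Icc, ae_restrict_iff' measurableSet_Ioo]

theorem monotoneOn_iff_ae_deriv_nonneg {σ : ℝ → ℝ} (hσ : AbsolutelyContinuousOnInterval σ a b) :
    MonotoneOn σ (Icc a b) ↔ ∀ᵐ t, t ∈ Ioo a b → 0 ≤ deriv σ t := by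
  refine ⟨fun h => .of_forall fun t ht => ?_, fun h x hx y hy hxy => ?_⟩
  · rw [← derivWithin_of_mem_nhds (Icc_mem_nhds ht.1 ht.2)]
    exact h.derivWithin_nonneg
  · have hsub : uIcc x y ⊆ uIcc a b := by
      rw [uIcc_of_le hxy, uIcc_of_le (hx.1.trans hx.2)]; exact Icc_subset_Icc hx.1 hy.2
    rw [← sub_nonneg, ← (hσ.mono hsub).integral_deriv_eq_sub]
    refine intervalIntegral.integral_nonneg_of_ae_restrict hxy (ae_restrict_Icc_iff.2 ?_)
    filter_upwards [h] with t ht ht'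
    exact ht ⟨hx.1.trans_lt ht'.1, ht'.2.trans_le hy.2⟩

theorem antitoneOn_iff_ae_deriv_nonpos {σ : ℝ → ℝ} (hσ : AbsolutelyContinuousOnInterval σ a b) :
    AntitoneOn σ (Icc a b) ↔ ∀ᵐ t, t ∈ Ioo a b → deriv σ t ≤ 0 := by
  have h := monotoneOn_iff_ae_deriv_nonneg hσ.neg
  simpa only [deriv.neg, Left.nonneg_neg_iff, MonotoneOn, AntitoneOn, Pi.neg_apply,
    neg_le_neg_iff] using h

end AbsolutelyContinuous

/-! ### Direction angles -/

theorem exp_mul_I_eq_iff {x y : ℝ} :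
    Complex.exp (x * I) = Complex.exp (y * I) ↔ ∃ n : ℤ, x = y + n * (2 * π) := by
  rw [← Circle.exp_eq_exp, Circle.ext_iff, Circle.coe_exp, Circle.coe_exp]

theorem eq_of_exp_mul_I_eq {x y : ℝ} (h : Complex.exp (x * I) = Complex.exp (y * I))
    (hxy : x - y < 2 * π) (hyx : y - x < 2 * π) : x = y := by
  refine Circle.exp_injOn_Icc (a := min x y) (b := max x y) ?_ ⟨min_le_left .., le_max_left ..⟩
    ⟨min_le_right .., le_max_right ..⟩ (Circle.ext (by simpa only [Circle.coe_exp] using h))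
  rw [max_sub_min_eq_abs, abs_lt]
  constructor <;> linarith

namespace PlanePath

variable {f : PlanePath} {τ : ℝ → ℝ} {c d t : ℝ}

theorem vel_eq_of_hasDerivWithinAt (hab : f.a < f.b) (ht : t ∈ Icc f.a f.b) {w : ℂ}
    (h : HasDerivWithinAt f.toFun w (Icc f.a f.b) t) : f.vel t = w :=
  h.derivWithin (uniqueDiffOn_Icc hab t ht)

theorem vel_eq_of_hasDerivAt (hab : f.a < f.b) (ht : t ∈ Icc f.a f.b) {w : ℂ}
    (h : HasDerivAt f.toFun w t) : f.vel t = w :=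
  vel_eq_of_hasDerivWithinAt hab ht h.hasDerivWithinAt

namespace IsCurve

theorem hasDerivWithinAt (hf : f.IsCurve) (ht : t ∈ Icc f.a f.b) :
    HasDerivWithinAt f.toFun (f.vel t) (Icc f.a f.b) t :=
  (hf.2.1 t ht).hasDerivWithinAt

theorem hasDerivAt (hf : f.IsCurve) (ht : t ∈ Ioo f.a f.b) :
    HasDerivAt f.toFun (f.vel t) t :=
  (hf.hasDerivWithinAt (Ioo_subset_Icc_self ht)).hasDerivAt (Icc_mem_nhds ht.1 ht.2)

theorem continuousOn_toFun (hf : f.IsCurve) : ContinuousOn f.toFun (Icc f.a f.b) :=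
  hf.2.1.continuousOn

theorem continuousOn_vel (hf : f.IsCurve) : ContinuousOn f.vel (Icc f.a f.b) := by
  simpa only [uIcc_of_le hf.1.le] using hf.2.2.1.continuousOn

theorem norm_vel_pos (hf : f.IsCurve) (ht : t ∈ Icc f.a f.b) : 0 < ‖f.vel t‖ :=
  norm_pos_iff.2 (hf.2.2.2 t ht)

theorem exists_isDirectionAngle (hf : f.IsCurve) : ∃ τ, f.IsDirectionAngle τ := by
  simpa only [IsDirectionAngle, uIcc_of_le hf.1.le] using
    exists_absolutelyContinuousOnInterval_arg hf.2.2.1 (by rw [uIcc_of_le hf.1.le]; exact hf.2.2.2)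

theorem isDirectionAngle_angle (hf : f.IsCurve) : f.IsDirectionAngle f.angle :=
  Classical.epsilon_spec hf.exists_isDirectionAngle

end IsCurve

namespace IsDirectionAngle

theorem continuousOn (hτ : f.IsDirectionAngle τ) (hab : f.a ≤ f.b) :
    ContinuousOn τ (Icc f.a f.b) := by
  simpa only [uIcc_of_le hab] using hτ.1.continuousOn

theorem dir_eq (hτ : f.IsDirectionAngle τ) (hf : f.IsCurve) (ht : t ∈ Icc f.a f.b) :
    f.dir t = Complex.exp (τ t * I) := by
  rw [dir, div_eq_iff (by exact_mod_cast (hf.norm_vel_pos ht).ne'), mul_comm]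
  exact hτ.2 t ht

theorem eq_add_int {σ : ℝ → ℝ} (hτ : f.IsDirectionAngle τ) (hσ : f.IsDirectionAngle σ)
    (hf : f.IsCurve) : ∃ n : ℤ, ∀ t ∈ Icc f.a f.b, τ t = σ t + n * (2 * π) := by
  have hcont : ContinuousOn (fun t => τ t - σ t) (Icc f.a f.b) :=
    (hτ.continuousOn hf.1.le).sub (hσ.continuousOn hf.1.le)
  have hmaps : MapsTo (fun t => τ t - σ t) (Icc f.a f.b) (AddSubgroup.zmultiples (2 * π)) := by
    intro t ht
    obtain ⟨n, hn⟩ := exp_mul_I_eq_iff.1 ((hτ.dir_eq hf ht).symm.trans (hσ.dir_eq hf ht))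
    exact ⟨n, by simp only [zsmul_eq_mul, hn, add_sub_cancel_left]⟩
  obtain ⟨y, ⟨n, rfl⟩, hy⟩ := isPreconnected_Icc.eqOn_const_of_mapsTo
    ⟨inferInstanceAs (DiscreteTopology (AddSubgroup.zmultiples (2 * π)))⟩ hcont hmaps
    ⟨0, zero_mem _⟩
  refine ⟨n, fun t ht => ?_⟩
  simpa only [zsmul_eq_mul, Function.const_apply, sub_eq_iff_eq_add'] using hy ht

theorem add_int (hτ : f.IsDirectionAngle τ) (n : ℤ) :
    f.IsDirectionAngle fun t => τ t + n * (2 * π) := by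
  refine ⟨absolutelyContinuousOnInterval_contDiff_comp (g := fun x => x + n * (2 * π))
    (contDiff_id.add contDiff_const) hτ.1, fun t ht => ?_⟩
  rw [exp_mul_I_eq_iff.2 ⟨n, rfl⟩]
  exact hτ.2 t ht

theorem curvature_eq (hτ : f.IsDirectionAngle τ) (hf : f.IsCurve) (ht : t ∈ Ioo f.a f.b) :
    f.curvature t = deriv τ t / ‖f.vel t‖ := by
  obtain ⟨n, hn⟩ := hf.isDirectionAngle_angle.eq_add_int hτ hf
  have h : f.angle =ᶠ[nhds t] fun t => τ t + n * (2 * π) := by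
    filter_upwards [Icc_mem_nhds ht.1 ht.2] with s hs using hn s hs
  rw [curvature, h.deriv_eq, deriv_add_const]

theorem turning_eq (hτ : f.IsDirectionAngle τ) (hf : f.IsCurve) :
    f.turning = τ f.b - τ f.a := by
  rw [turning, ← hτ.1.integral_deriv_eq_sub,
    intervalIntegral.integral_of_le hf.1.le, intervalIntegral.integral_of_le hf.1.le,
    integral_Ioc_eq_integral_Ioo, integral_Ioc_eq_integral_Ioo]
  refine setIntegral_congr_fun measurableSet_Ioo fun t ht => ?_
  simp only [hτ.curvature_eq hf ht]
  exact div_mul_cancel₀ _ (hf.norm_vel_pos (Ioo_subset_Icc_self ht)).ne'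

theorem energy_eq (hτ : f.IsDirectionAngle τ) (hf : f.IsCurve) :
    f.energy = (1 / 4) * ∫⁻ t in Icc f.a f.b, ENNReal.ofReal (deriv τ t ^ 2 / ‖f.vel t‖) := by
  rw [energy]
  congr 1
  refine lintegral_congr_ae (ae_restrict_Icc_iff.2 (.of_forall fun t ht => ?_))
  have := (hf.norm_vel_pos (Ioo_subset_Icc_self ht)).ne'
  simp only [hτ.curvature_eq hf ht]
  congr 1
  field_simp

theorem isLeftCurve_iff (hτ : f.IsDirectionAngle τ) (hf : f.IsCurve) :
    f.IsLeftCurve ↔ MonotoneOn τ (Icc f.a f.b) := by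
  rw [IsLeftCurve, and_iff_right hf, ae_restrict_Icc_iff, monotoneOn_iff_ae_deriv_nonneg hτ.1]
  refine Filter.eventually_congr (.of_forall fun t => forall_congr' fun ht => ?_)
  rw [hτ.curvature_eq hf ht, le_div_iff₀ (hf.norm_vel_pos (Ioo_subset_Icc_self ht)), zero_mul]

theorem isRightCurve_iff (hτ : f.IsDirectionAngle τ) (hf : f.IsCurve) :
    f.IsRightCurve ↔ AntitoneOn τ (Icc f.a f.b) := by
  rw [IsRightCurve, and_iff_right hf, ae_restrict_Icc_iff, antitoneOn_iff_ae_deriv_nonpos hτ.1]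
  refine Filter.eventually_congr (.of_forall fun t => forall_congr' fun ht => ?_)
  rw [hτ.curvature_eq hf ht, div_le_iff₀ (hf.norm_vel_pos (Ioo_subset_Icc_self ht)), zero_mul]

theorem isLeftCCurve_iff (hτ : f.IsDirectionAngle τ) (hf : f.IsCurve) :
    f.IsLeftCCurve ↔ MonotoneOn τ (Icc f.a f.b) ∧ τ f.b - τ f.a ≤ π := by
  rw [IsLeftCCurve, hτ.isLeftCurve_iff hf, hτ.turning_eq hf]
  refine and_congr_right fun h => ?_
  rw [abs_of_nonneg (sub_nonneg.2 (h (left_mem_Icc.2 hf.1.le) (right_mem_Icc.2 hf.1.le) hf.1.le))]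

theorem isRightCCurve_iff (hτ : f.IsDirectionAngle τ) (hf : f.IsCurve) :
    f.IsRightCCurve ↔ AntitoneOn τ (Icc f.a f.b) ∧ τ f.a - τ f.b ≤ π := by
  rw [IsRightCCurve, hτ.isRightCurve_iff hf, hτ.turning_eq hf]
  refine and_congr_right fun h => ?_
  rw [abs_sub_comm, abs_of_nonneg
    (sub_nonneg.2 (h (left_mem_Icc.2 hf.1.le) (right_mem_Icc.2 hf.1.le) hf.1.le))]

end IsDirectionAngle

theorem IsCurve.exists_isDirectionAngle_start (hf : f.IsCurve) {x : ℝ}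
    (hx : f.dir f.a = Complex.exp (x * I)) : ∃ τ, f.IsDirectionAngle τ ∧ τ f.a = x := by
  obtain ⟨τ, hτ⟩ := hf.exists_isDirectionAngle
  obtain ⟨n, hn⟩ := exp_mul_I_eq_iff.1 (hx.symm.trans (hτ.dir_eq hf (left_mem_Icc.2 hf.1.le)))
  exact ⟨_, hτ.add_int n, hn.symm⟩

theorem IsCurve.vel_restrict (hf : f.IsCurve) (hac : f.a ≤ c) (hcd : c < d)
    (hdb : d ≤ f.b) (ht : t ∈ Icc c d) : (f.restrict c d).vel t = f.vel t :=
  vel_eq_of_hasDerivWithinAt (f := f.restrict c d) hcd ht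
    ((hf.hasDerivWithinAt ⟨hac.trans ht.1, ht.2.trans hdb⟩).mono (Icc_subset_Icc hac hdb))

theorem IsCurve.restrict (hf : f.IsCurve) (hac : f.a ≤ c) (hcd : c < d)
    (hdb : d ≤ f.b) : (f.restrict c d).IsCurve := by
  have hs : Icc c d ⊆ Icc f.a f.b := Icc_subset_Icc hac hdb
  have hs' : uIcc c d ⊆ uIcc f.a f.b := by rwa [uIcc_of_le hcd.le, uIcc_of_le hf.1.le]
  refine ⟨hcd, hf.2.1.mono hs, absolutelyContinuousOnInterval_congr (hf.2.2.1.mono hs') ?_,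
    fun t ht => ?_⟩
  · intro t ht
    change t ∈ uIcc c d at ht
    rw [uIcc_of_le hcd.le] at ht
    exact (hf.vel_restrict hac hcd hdb ht).symm
  · rw [hf.vel_restrict hac hcd hdb ht]
    exact hf.2.2.2 t (hs ht)

theorem IsDirectionAngle.restrict (hτ : f.IsDirectionAngle τ) (hf : f.IsCurve) (hac : f.a ≤ c)
    (hcd : c < d) (hdb : d ≤ f.b) : (f.restrict c d).IsDirectionAngle τ := by
  have hs : Icc c d ⊆ Icc f.a f.b := Icc_subset_Icc hac hdb
  have hs' : uIcc c d ⊆ uIcc f.a f.b := by rwa [uIcc_of_le hcd.le, uIcc_of_le hf.1.le]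
  refine ⟨hτ.1.mono hs', fun t ht => ?_⟩
  rw [hf.vel_restrict hac hcd hdb ht]
  exact hτ.2 t (hs ht)

theorem IsDirectionAngle.splitsRightLeft_iff (hτ : f.IsDirectionAngle τ) (hf : f.IsCurve) :
    f.SplitsRightLeft c ↔ c ∈ Ioo f.a f.b ∧
      (AntitoneOn τ (Icc f.a c) ∧ τ f.a - τ c ≤ π) ∧
      (MonotoneOn τ (Icc c f.b) ∧ τ f.b - τ c ≤ π) := by
  refine and_congr_right fun hc => ?_
  exact and_congr ((hτ.restrict hf le_rfl hc.1 hc.2.le).isRightCCurve_iff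
      (hf.restrict le_rfl hc.1 hc.2.le))
    ((hτ.restrict hf hc.1.le hc.2 le_rfl).isLeftCCurve_iff (hf.restrict hc.1.le hc.2 le_rfl))

theorem IsDirectionAngle.splitsLeftRight_iff (hτ : f.IsDirectionAngle τ) (hf : f.IsCurve) :
    f.SplitsLeftRight c ↔ c ∈ Ioo f.a f.b ∧
      (MonotoneOn τ (Icc f.a c) ∧ τ c - τ f.a ≤ π) ∧
      (AntitoneOn τ (Icc c f.b) ∧ τ c - τ f.b ≤ π) := by
  refine and_congr_right fun hc => ?_
  exact and_congr ((hτ.restrict hf le_rfl hc.1 hc.2.le).isLeftCCurve_iff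
      (hf.restrict le_rfl hc.1 hc.2.le))
    ((hτ.restrict hf hc.1.le hc.2 le_rfl).isRightCCurve_iff (hf.restrict hc.1.le hc.2 le_rfl))

end PlanePath

/-! ### The bending energy -/

/-- The primitive of `√sin` which vanishes at `0`; thus `y₁` and `y₂` are half its values at
`α - γ` and `β - γ`. -/
noncomputable def sqrtSinPrim (x : ℝ) : ℝ := ∫ τ in (0 : ℝ)..x, √(Real.sin τ)

theorem continuous_sqrt_sin : Continuous fun x => √(Real.sin x) := by fun_prop

theorem hasDerivAt_sqrtSinPrim (x : ℝ) : HasDerivAt sqrtSinPrim (√(Real.sin x)) x :=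
  (continuous_sqrt_sin.integral_hasStrictDerivAt 0 x).hasDerivAt

theorem contDiff_sqrtSinPrim : ContDiff ℝ 1 sqrtSinPrim := by
  rw [contDiff_one_iff_deriv]
  refine ⟨fun x => (hasDerivAt_sqrtSinPrim x).differentiableAt, ?_⟩
  rw [funext fun x => (hasDerivAt_sqrtSinPrim x).deriv]
  exact continuous_sqrt_sin

@[simp] theorem sqrtSinPrim_zero : sqrtSinPrim 0 = 0 := intervalIntegral.integral_same

theorem strictMonoOn_sqrtSinPrim : StrictMonoOn sqrtSinPrim (Icc 0 π) := by
  refine strictMonoOn_of_deriv_pos (convex_Icc _ _) contDiff_sqrtSinPrim.continuous.continuousOn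
    fun x hx => ?_
  rw [interior_Icc] at hx
  rw [(hasDerivAt_sqrtSinPrim x).deriv]
  exact Real.sqrt_pos.2 (Real.sin_pos_of_mem_Ioo hx)

theorem sqrtSinPrim_nonneg {x : ℝ} (h0 : 0 ≤ x) (hπ : x ≤ π) : 0 ≤ sqrtSinPrim x := by
  simpa only [sqrtSinPrim_zero] using
    strictMonoOn_sqrtSinPrim.monotoneOn ⟨le_rfl, Real.pi_pos.le⟩ ⟨h0, hπ⟩ h0

theorem sqrtSinPrim_pos {x : ℝ} (h0 : 0 < x) (hπ : x ≤ π) : 0 < sqrtSinPrim x := by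
  simpa only [sqrtSinPrim_zero] using
    strictMonoOn_sqrtSinPrim ⟨le_rfl, Real.pi_pos.le⟩ ⟨h0.le, hπ⟩ h0

theorem y₁_eq (α γ : ℝ) : y₁ α γ = 1 / 2 * sqrtSinPrim (α - γ) := rfl

theorem y₂_eq (β γ : ℝ) : y₂ β γ = 1 / 2 * sqrtSinPrim (β - γ) := rfl

theorem mul_exp_neg_eq (r x θ : ℝ) :
    (r : ℂ) * Complex.exp (x * I) * Complex.exp (-(θ * I)) =
      (r * Real.cos (x - θ) : ℝ) + (r * Real.sin (x - θ) : ℝ) * I := by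
  have hexp : (x : ℂ) * I + -(θ * I) = ((x - θ : ℝ) : ℂ) * I := by push_cast; ring
  rw [mul_assoc, ← Complex.exp_add, hexp, Complex.exp_mul_I]
  push_cast
  ring

namespace PlanePath

variable {f : PlanePath} {τ : ℝ → ℝ} {c p q t θ m : ℝ}

/-- The displacement of `f` between the parameters `p` and `q`, orthogonally to the direction
`θ`. -/
noncomputable def height (f : PlanePath) (θ p q : ℝ) : ℝ :=
  (f.toFun q * Complex.exp (-(θ * I))).im - (f.toFun p * Complex.exp (-(θ * I))).im

/-- The integrand `κ² |f'|` of the bending energy in terms of a direction angle. -/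
noncomputable def energyDensity (f : PlanePath) (τ : ℝ → ℝ) (t : ℝ) : ℝ :=
  deriv τ t ^ 2 / ‖f.vel t‖

/-- The density `(κ - m √sin (τ - θ))² |f'|`, which measures how far `f` is from an elastica. -/
noncomputable def deviation (f : PlanePath) (τ : ℝ → ℝ) (m θ t : ℝ) : ℝ :=
  (deriv τ t - m * (√(Real.sin (τ t - θ)) * ‖f.vel t‖)) ^ 2 / ‖f.vel t‖

theorem deviation_nonneg : 0 ≤ deviation f τ m θ t := by unfold deviation; positivity

theorem energyDensity_nonneg : 0 ≤ energyDensity f τ t := by unfold energyDensity; positivity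

theorem energyDensity_eq (hv : 0 < ‖f.vel t‖) (hs : 0 ≤ Real.sin (τ t - θ)) :
    energyDensity f τ t = deviation f τ m θ t +
      (2 * m * (√(Real.sin (τ t - θ)) * deriv τ t) -
        m ^ 2 * (Real.sin (τ t - θ) * ‖f.vel t‖)) := by
  unfold energyDensity deviation
  field_simp
  linear_combination -(m ^ 2 * ‖f.vel t‖ ^ 2) * Real.sq_sqrt hs

namespace IsDirectionAngle

theorem intervalIntegrable_sin (hτ : f.IsDirectionAngle τ) (hf : f.IsCurve)
    (hap : f.a ≤ p) (hpq : p ≤ q) (hqb : q ≤ f.b) (θ : ℝ) :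
    IntervalIntegrable (fun t => Real.sin (τ t - θ) * ‖f.vel t‖) volume p q := by
  have hs : Icc p q ⊆ Icc f.a f.b := Icc_subset_Icc hap hqb
  refine ContinuousOn.intervalIntegrable ?_
  rw [uIcc_of_le hpq]
  exact (Real.continuous_sin.comp_continuousOn
    (((hτ.continuousOn hf.1.le).mono hs).sub continuousOn_const)).mul
    (hf.continuousOn_vel.mono hs).norm

theorem integral_sin (hτ : f.IsDirectionAngle τ) (hf : f.IsCurve)
    (hap : f.a ≤ p) (hpq : p ≤ q) (hqb : q ≤ f.b) (θ : ℝ) :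
    ∫ t in p..q, Real.sin (τ t - θ) * ‖f.vel t‖ = f.height θ p q := by
  have hs : Icc p q ⊆ Icc f.a f.b := Icc_subset_Icc hap hqb
  refine intervalIntegral.integral_eq_sub_of_hasDerivAt_of_le
    (f := fun t => (f.toFun t * Complex.exp (-(θ * I))).im) hpq ?_ (fun t ht => ?_)
    (hτ.intervalIntegrable_sin hf hap hpq hqb θ)
  · exact Complex.continuous_im.comp_continuousOn
      ((hf.continuousOn_toFun.mono hs).mul continuousOn_const)
  · have ht' : t ∈ Ioo f.a f.b := Ioo_subset_Ioo hap hqb ht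
    refine (Complex.imCLM.hasFDerivAt.comp_hasDerivAt t
      ((hf.hasDerivAt ht').mul_const (Complex.exp (-(θ * I))))).congr_deriv ?_
    rw [hτ.2 t (Ioo_subset_Icc_self ht'), mul_exp_neg_eq]
    simp only [Complex.imCLM_apply, Complex.add_im, Complex.ofReal_im, Complex.mul_im,
      Complex.I_re, Complex.I_im, Complex.ofReal_re]
    rw [← hτ.2 t (Ioo_subset_Icc_self ht')]
    ring

theorem integral_sqrt_sin (hτ : f.IsDirectionAngle τ) (hf : f.IsCurve)
    (hap : f.a ≤ p) (hpq : p ≤ q) (hqb : q ≤ f.b) (θ : ℝ) :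
    IntervalIntegrable (fun t => √(Real.sin (τ t - θ)) * deriv τ t) volume p q ∧
    ∫ t in p..q, √(Real.sin (τ t - θ)) * deriv τ t =
      sqrtSinPrim (τ q - θ) - sqrtSinPrim (τ p - θ) := by
  have hs : uIcc p q ⊆ uIcc f.a f.b := by
    rw [uIcc_of_le hpq, uIcc_of_le hf.1.le]; exact Icc_subset_Icc hap hqb
  have hτ' := hτ.1.mono hs
  have hY := absolutelyContinuousOnInterval_contDiff_comp (g := fun x => sqrtSinPrim (x - θ))
    (contDiff_sqrtSinPrim.comp (contDiff_id.sub contDiff_const)) hτ'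
  constructor
  · exact hτ'.intervalIntegrable_deriv.continuousOn_mul
      (continuous_sqrt_sin.comp_continuousOn (hτ'.continuousOn.sub continuousOn_const))
  · rw [← hY.integral_deriv_eq_sub]
    refine intervalIntegral.integral_congr_ae ?_
    filter_upwards [ae_differentiableAt_of_absolutelyContinuousOnInterval hτ'] with t ht htpq
    have hderiv := (ht (uIoc_subset_uIcc htpq)).hasDerivAt
    exact (((hasDerivAt_sqrtSinPrim _).comp t (hderiv.sub_const θ)).deriv).symm

theorem integral_energyDensity (hτ : f.IsDirectionAngle τ) (hf : f.IsCurve)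
    (hap : f.a ≤ p) (hpq : p ≤ q) (hqb : q ≤ f.b)
    (hs : ∀ t ∈ Icc p q, 0 ≤ Real.sin (τ t - θ))
    (hi : IntervalIntegrable (energyDensity f τ) volume p q) (m : ℝ) :
    IntervalIntegrable (deviation f τ m θ) volume p q ∧
    ∫ t in p..q, energyDensity f τ t = (∫ t in p..q, deviation f τ m θ t) +
      (2 * m * (sqrtSinPrim (τ q - θ) - sqrtSinPrim (τ p - θ)) -
        m ^ 2 * f.height θ p q) := by
  obtain ⟨hsqrt, hsqrt_eq⟩ := hτ.integral_sqrt_sin hf hap hpq hqb θ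
  have hsin := hτ.intervalIntegrable_sin hf hap hpq hqb θ
  have hlin := (hsqrt.const_mul (2 * m)).sub (hsin.const_mul (m ^ 2))
  have heq : ∀ t ∈ uIcc p q, energyDensity f τ t = deviation f τ m θ t +
      (2 * m * (√(Real.sin (τ t - θ)) * deriv τ t) -
        m ^ 2 * (Real.sin (τ t - θ) * ‖f.vel t‖)) := by
    intro t ht
    rw [uIcc_of_le hpq] at ht
    exact energyDensity_eq (hf.norm_vel_pos ⟨hap.trans ht.1, ht.2.trans hqb⟩) (hs t ht)
  have hdev : IntervalIntegrable (deviation f τ m θ) volume p q :=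
    (hi.sub hlin).congr fun t ht => sub_eq_of_eq_add (heq t (uIoc_subset_uIcc ht))
  refine ⟨hdev, ?_⟩
  rw [intervalIntegral.integral_congr heq, intervalIntegral.integral_add hdev hlin,
    intervalIntegral.integral_sub (hsqrt.const_mul _) (hsin.const_mul _),
    intervalIntegral.integral_const_mul, intervalIntegral.integral_const_mul, hsqrt_eq,
    hτ.integral_sin hf hap hpq hqb]

theorem energy_eq_ofReal (hτ : f.IsDirectionAngle τ) (hf : f.IsCurve)
    (hi : IntervalIntegrable (energyDensity f τ) volume f.a f.b) :
    f.energy = ENNReal.ofReal (1 / 4 * ∫ t in f.a..f.b, energyDensity f τ t) := by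
  rw [hτ.energy_eq hf, ENNReal.ofReal_mul (by norm_num), intervalIntegral.integral_of_le hf.1.le,
    ← integral_Icc_eq_integral_Ioc, ofReal_integral_eq_lintegral_ofReal
      ((intervalIntegrable_iff_integrableOn_Icc_of_le hf.1.le).1 hi)
      (.of_forall fun _ => energyDensity_nonneg), ENNReal.ofReal_div_of_pos (by norm_num),
    ENNReal.ofReal_one, ENNReal.ofReal_ofNat]
  rfl

theorem intervalIntegrable_energyDensity (hτ : f.IsDirectionAngle τ) (hf : f.IsCurve)
    (hE : f.energy ≠ ⊤) : IntervalIntegrable (energyDensity f τ) volume f.a f.b := by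
  rw [intervalIntegrable_iff_integrableOn_Icc_of_le hf.1.le]
  have hmeas : AEMeasurable (energyDensity f τ) (volume.restrict (Icc f.a f.b)) :=
    ((measurable_deriv τ).aemeasurable.pow_const 2).div
      (hf.continuousOn_vel.norm.aemeasurable measurableSet_Icc)
  refine ⟨hmeas.aestronglyMeasurable, ?_⟩
  rw [hasFiniteIntegral_iff_ofReal (.of_forall fun _ => energyDensity_nonneg), lt_top_iff_ne_top]
  rw [hτ.energy_eq hf] at hE
  exact fun htop => hE ((congrArg _ htop).trans (ENNReal.mul_top (by norm_num)))

theorem integral_energyDensity_two (hτ : f.IsDirectionAngle τ) (hf : f.IsCurve)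
    (hc : c ∈ Icc f.a f.b) (hs : ∀ t ∈ Icc f.a f.b, 0 ≤ Real.sin (τ t - θ))
    (hi : IntervalIntegrable (energyDensity f τ) volume f.a f.b) (m : ℝ) :
    IntervalIntegrable (deviation f τ m θ) volume f.a c ∧
    IntervalIntegrable (deviation f τ (-m) θ) volume c f.b ∧
    ∫ t in f.a..f.b, energyDensity f τ t =
      ((∫ t in f.a..c, deviation f τ m θ t) + ∫ t in c..f.b, deviation f τ (-m) θ t) +
      (2 * m * (2 * sqrtSinPrim (τ c - θ) - sqrtSinPrim (τ f.a - θ) - sqrtSinPrim (τ f.b - θ)) -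
        m ^ 2 * f.height θ f.a f.b) := by
  have hi_left : IntervalIntegrable (energyDensity f τ) volume f.a c := hi.mono_set (by
    rw [uIcc_of_le hc.1, uIcc_of_le hf.1.le]; exact Icc_subset_Icc_right hc.2)
  have hi_right : IntervalIntegrable (energyDensity f τ) volume c f.b := hi.mono_set (by
    rw [uIcc_of_le hc.2, uIcc_of_le hf.1.le]; exact Icc_subset_Icc_left hc.1)
  obtain ⟨hdev_left, hleft⟩ := hτ.integral_energyDensity hf le_rfl hc.1 hc.2
    (fun t ht => hs t ⟨ht.1, ht.2.trans hc.2⟩) hi_left m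
  obtain ⟨hdev_right, hright⟩ := hτ.integral_energyDensity hf hc.1 hc.2 le_rfl
    (fun t ht => hs t ⟨hc.1.trans ht.1, ht.2⟩) hi_right (-m)
  refine ⟨hdev_left, hdev_right, ?_⟩
  rw [← intervalIntegral.integral_add_adjacent_intervals hi_left hi_right, hleft, hright]
  unfold height
  ring

end IsDirectionAngle

end PlanePath

/-! ### The objective function -/

section Objective

variable {α β γ : ℝ}

theorem hasDerivAt_G (hs : Real.sin γ < 0) (hS : 0 < y₁ α γ + y₂ β γ) :
    HasDerivAt (G α β) ((y₁ α γ + y₂ β γ) ^ 2 / Real.sin γ ^ 2 * sigma α β γ) γ := by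
  have hy (x : ℝ) := ((hasDerivAt_sqrtSinPrim (x - γ)).comp γ
    ((hasDerivAt_id γ).const_sub x)).const_mul (1 / 2 : ℝ)
  have hy₁ : HasDerivAt (y₁ α) (1 / 2 * (√(Real.sin (α - γ)) * -1)) γ := hy α
  have hy₂ : HasDerivAt (y₂ β) (1 / 2 * (√(Real.sin (β - γ)) * -1)) γ := hy β
  have hG_eq : G α β = (fun x => (-Real.sin x)⁻¹) * fun x => (y₁ α x + y₂ β x) ^ 2 := by
    funext x; simp only [G, one_div, Pi.mul_apply]
  rw [hG_eq]
  refine (((Real.hasDerivAt_sin γ).neg.fun_inv (by simpa using hs.ne)).mul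
    ((hy₁.add hy₂).fun_pow 2)).congr_deriv ?_
  simp only [Pi.neg_apply, Pi.add_apply, sigma]
  field_simp [hs.ne, hS.ne']
  push_cast
  ring

theorem bounds_of_mem_GammaSet (hγ : γ ∈ GammaSet α β) : α - π ≤ γ ∧ γ < 0 ∧ γ ≤ β := by
  unfold GammaSet at hγ
  split_ifs at hγ with hβ
  · exact ⟨hγ.1, hγ.2.trans_lt hβ, hγ.2⟩
  · exact ⟨hγ.1, hγ.2, hγ.2.le.trans (not_lt.1 hβ)⟩

theorem convex_GammaSet : Convex ℝ (GammaSet α β) := by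
  unfold GammaSet
  split_ifs
  exacts [convex_Icc _ _, convex_Ico _ _]

theorem y₁_add_y₂_pos (hγα : γ < α) (hαγ : α - γ ≤ π) (hγβ : γ ≤ β) (hβγ : β - γ ≤ π) :
    0 < y₁ α γ + y₂ β γ := by
  rw [y₁_eq, y₂_eq]
  linarith [sqrtSinPrim_pos (sub_pos.2 hγα) hαγ, sqrtSinPrim_nonneg (sub_nonneg.2 hγβ) hβγ]

theorem pos_of_mem_GammaSet (hα : α ∈ Ioo 0 π) (hβα : |β| ≤ α) (hγ : γ ∈ GammaSet α β) :
    Real.sin γ < 0 ∧ 0 < y₁ α γ + y₂ β γ := by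
  obtain ⟨hαγ, hγ0, hγβ⟩ := bounds_of_mem_GammaSet hγ
  have := abs_le.1 hβα
  exact ⟨Real.sin_neg_of_neg_of_neg_pi_lt hγ0 (by linarith [hα.1]),
    y₁_add_y₂_pos (by linarith [hα.1]) (by linarith) hγβ (by linarith)⟩

theorem continuousOn_G (hα : α ∈ Ioo 0 π) (hβα : |β| ≤ α) :
    ContinuousOn (G α β) (GammaSet α β) := fun _ hγ =>
  have hpos := pos_of_mem_GammaSet hα hβα hγ
  (hasDerivAt_G hpos.1 hpos.2).continuousAt.continuousWithinAt

theorem sigma_mul_nonneg (hα : α ∈ Ioo 0 π) (hβα : |β| ≤ α) (hγ : γ ∈ GammaSet α β)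
    (hmin : ∀ x ∈ GammaSet α β, G α β γ ≤ G α β x) {x : ℝ} (hx : x ∈ GammaSet α β) :
    0 ≤ sigma α β γ * (x - γ) := by
  obtain ⟨hs, hS⟩ := pos_of_mem_GammaSet hα hβα hγ
  have hlocal : IsLocalMinOn (G α β) (GammaSet α β) γ := IsMinOn.localize hmin
  have hderiv := hlocal.hasFDerivWithinAt_nonneg
    (hasDerivAt_G hs hS).hasFDerivAt.hasFDerivWithinAt
    (sub_mem_posTangentConeAt_of_segment_subset (convex_GammaSet.segment_subset hγ hx))
  have hpos : 0 < (y₁ α γ + y₂ β γ) ^ 2 / Real.sin γ ^ 2 :=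
    div_pos (pow_pos hS 2) (sq_pos_of_neg hs)
  refine nonneg_of_mul_nonneg_right (a := (y₁ α γ + y₂ β γ) ^ 2 / Real.sin γ ^ 2) ?_ hpos
  simpa [mul_comm, mul_left_comm, mul_assoc] using hderiv

theorem tendsto_G_nhdsLT_zero (hα : α ∈ Ioo 0 π) (hβ : 0 ≤ β) (hβα : β ≤ α) :
    Filter.Tendsto (G α β) (nhdsWithin 0 (Iio 0)) Filter.atTop := by
  have hsum_pos : 0 < y₁ α 0 + y₂ β 0 :=
    y₁_add_y₂_pos hα.1 (by linarith [hα.2]) hβ (by linarith [hα.2])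
  have hsum : Filter.Tendsto (fun γ => (y₁ α γ + y₂ β γ) ^ 2) (nhdsWithin 0 (Iio 0))
      (nhds ((y₁ α 0 + y₂ β 0) ^ 2)) := by
    have hcont : Continuous fun γ => (y₁ α γ + y₂ β γ) ^ 2 := by
      have := contDiff_sqrtSinPrim.continuous
      simp only [y₁_eq, y₂_eq]
      fun_prop
    exact hcont.continuousAt.continuousWithinAt
  have hsin : Filter.Tendsto (fun γ => -Real.sin γ) (nhdsWithin 0 (Iio 0))
      (nhdsWithin 0 (Ioi 0)) := by
    refine tendsto_nhdsWithin_iff.2 ⟨?_, ?_⟩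
    · have hcont : Continuous fun γ => -Real.sin γ := by fun_prop
      simpa using (hcont.tendsto 0).mono_left nhdsWithin_le_nhds
    · filter_upwards [Ioo_mem_nhdsLT (neg_lt_zero.2 Real.pi_pos)] with γ hγ
      exact neg_pos.2 (Real.sin_neg_of_neg_of_neg_pi_lt hγ.2 hγ.1)
  refine ((tendsto_inv_nhdsGT_zero.comp hsin).atTop_mul_pos (pow_pos hsum_pos 2) hsum).congr
    fun γ => ?_
  simp only [G, one_div, Function.comp_apply]

theorem exists_isMinOn_G (hα : α ∈ Ioo 0 π) (hβα : |β| ≤ α) (hβ : α - π < β) :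
    ∃ γ ∈ GammaSet α β, ∀ x ∈ GammaSet α β, G α β γ ≤ G α β x := by
  have hcont := continuousOn_G hα hβα
  by_cases hβ0 : β < 0
  · rw [show GammaSet α β = Icc (α - π) β from if_pos hβ0] at hcont ⊢
    exact isCompact_Icc.exists_isMinOn (nonempty_Icc.2 hβ.le) hcont
  · rw [show GammaSet α β = Ico (α - π) 0 from if_neg hβ0] at hcont ⊢
    have hαπ : α - π < 0 := sub_neg.2 hα.2
    obtain ⟨δ, hδ0, hδ⟩ := mem_nhdsLT_iff_exists_Ioo_subset.1 ((tendsto_G_nhdsLT_zero hα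
      (not_lt.1 hβ0) (abs_le.1 hβα).2).eventually_ge_atTop (G α β (α - π)))
    have hsub : Icc (α - π) (max δ (α - π)) ⊆ Ico (α - π) 0 :=
      fun x hx => ⟨hx.1, hx.2.trans_lt (max_lt hδ0 hαπ)⟩
    have hmem : α - π ∈ Icc (α - π) (max δ (α - π)) := ⟨le_rfl, le_max_right ..⟩
    obtain ⟨γ, hγ, hγmin⟩ := isCompact_Icc.exists_isMinOn ⟨_, hmem⟩ (hcont.mono hsub)
    refine ⟨γ, hsub hγ, fun x hx => ?_⟩
    obtain hxδ | hxδ := le_or_gt x (max δ (α - π))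
    · exact hγmin ⟨hx.1, hxδ⟩
    · exact (hγmin hmem).trans (hδ ⟨(le_max_left ..).trans_lt hxδ, hx.2⟩)

theorem exists_isLeast_G (hα : α ∈ Ioo 0 π) (hβα : |β| ≤ α) (hβ : α - π < β) :
    ∃ Gmin : ℝ, IsLeast (G α β '' GammaSet α β) Gmin := by
  obtain ⟨γ, hγ, hmin⟩ := exists_isMinOn_G hα hβα hβ
  exact ⟨G α β γ, mem_image_of_mem _ hγ, forall_mem_image.2 hmin⟩

end Objective

/-! ### Right-left curves -/

theorem im_one_mul_exp_neg (γ : ℝ) : ((1 : ℂ) * Complex.exp (-(γ * I))).im = -Real.sin γ := by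
  rw [one_mul, ← neg_mul, ← Complex.ofReal_neg, Complex.exp_ofReal_mul_I_im, Real.sin_neg]

namespace PlanePath

variable {f : PlanePath} {τ : ℝ → ℝ} {c p q t θ m α β γ : ℝ}

theorem height_eq_neg_sin (h0 : f.toFun f.a = 0) (h1 : f.toFun f.b = 1) (θ : ℝ) :
    f.height θ f.a f.b = -Real.sin θ := by
  rw [height, h0, h1, im_one_mul_exp_neg, zero_mul, Complex.zero_im, sub_zero]

theorem IsDirectionAngle.height_pos (hτ : f.IsDirectionAngle τ) (hf : f.IsCurve)
    (hs : ∀ t ∈ Icc f.a f.b, 0 ≤ Real.sin (τ t - θ))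
    (hpos : ∃ t ∈ Icc f.a f.b, 0 < Real.sin (τ t - θ)) : 0 < f.height θ f.a f.b := by
  rw [← hτ.integral_sin hf le_rfl hf.1.le le_rfl]
  refine intervalIntegral.integral_pos hf.1 ?_ (fun t ht => ?_) ?_
  · exact (Real.continuous_sin.comp_continuousOn
      ((hτ.continuousOn hf.1.le).sub continuousOn_const)).mul hf.continuousOn_vel.norm
  · exact mul_nonneg (hs t (Ioc_subset_Icc_self ht)) (norm_nonneg _)
  · obtain ⟨t, ht, h⟩ := hpos
    exact ⟨t, ht, mul_pos h (hf.norm_vel_pos ht)⟩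

theorem IsDirectionAngle.height_nonpos (hτ : f.IsDirectionAngle τ) (hf : f.IsCurve)
    (hs : ∀ t ∈ Icc f.a f.b, Real.sin (τ t - θ) ≤ 0) : f.height θ f.a f.b ≤ 0 := by
  rw [← hτ.integral_sin hf le_rfl hf.1.le le_rfl, ← neg_nonneg, ← intervalIntegral.integral_neg]
  exact intervalIntegral.integral_nonneg hf.1.le fun t ht =>
    neg_nonneg.2 (mul_nonpos_of_nonpos_of_nonneg (hs t ht) (norm_nonneg _))

/-- A curve from `0` to `1` whose direction angle `τ` decreases from `α` to `γ` on `[a, c]` and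
increases from `γ` to `β` on `[c, b]`. A right c-curve is the case `c = b`, `γ = β`. -/
structure IsRightLeft (f : PlanePath) (τ : ℝ → ℝ) (c α β γ : ℝ) : Prop where
  curve : f.IsCurve
  angle : f.IsDirectionAngle τ
  mem : c ∈ Ioc f.a f.b
  anti : AntitoneOn τ (Icc f.a c)
  mono : MonotoneOn τ (Icc c f.b)
  angle_start : τ f.a = α
  angle_mid : τ c = γ
  angle_finish : τ f.b = β
  lt : γ < α
  le₁ : α - γ ≤ π
  le₂ : β - γ ≤ π
  start : f.toFun f.a = 0
  finish : f.toFun f.b = 1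

namespace IsRightLeft

theorem le (h : IsRightLeft f τ c α β γ) : γ ≤ β := by
  rw [← h.angle_mid, ← h.angle_finish]
  exact h.mono ⟨le_rfl, h.mem.2⟩ ⟨h.mem.2, le_rfl⟩ h.mem.2

theorem angle_sub_mem (h : IsRightLeft f τ c α β γ) (ht : t ∈ Icc f.a f.b) :
    τ t - γ ∈ Icc 0 π := by
  rcases le_total t c with htc | hct
  · have hlower := h.anti ⟨ht.1, htc⟩ ⟨h.mem.1.le, le_rfl⟩ htc
    have hupper := h.anti ⟨le_rfl, h.mem.1.le⟩ ⟨ht.1, htc⟩ ht.1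
    rw [h.angle_mid] at hlower
    rw [h.angle_start] at hupper
    exact ⟨by linarith, by linarith [h.le₁]⟩
  · have hlower := h.mono ⟨le_rfl, h.mem.2⟩ ⟨hct, ht.2⟩ hct
    have hupper := h.mono ⟨hct, ht.2⟩ ⟨h.mem.2, le_rfl⟩ ht.2
    rw [h.angle_mid] at hlower
    rw [h.angle_finish] at hupper
    exact ⟨by linarith, by linarith [h.le₂]⟩

theorem sin_nonneg (h : IsRightLeft f τ c α β γ) (ht : t ∈ Icc f.a f.b) :
    0 ≤ Real.sin (τ t - γ) :=
  Real.sin_nonneg_of_mem_Icc (h.angle_sub_mem ht)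

theorem neg_sin_pos (h : IsRightLeft f τ c α β γ) : 0 < -Real.sin γ := by
  have hcont : ContinuousOn τ (Icc f.a c) :=
    (h.angle.continuousOn h.curve.1.le).mono (Icc_subset_Icc_right h.mem.2)
  have hmid : (α + γ) / 2 ∈ Icc (τ c) (τ f.a) := by
    rw [h.angle_start, h.angle_mid]; constructor <;> linarith [h.lt]
  obtain ⟨t, ht, hτt⟩ := intermediate_value_Icc' h.mem.1.le hcont hmid
  rw [← height_eq_neg_sin h.start h.finish]
  refine h.angle.height_pos h.curve (fun t ht => h.sin_nonneg ht)
    ⟨t, ⟨ht.1, ht.2.trans h.mem.2⟩, ?_⟩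
  rw [hτt]
  exact Real.sin_pos_of_pos_of_lt_pi (by linarith [h.lt]) (by linarith [h.le₁, Real.pi_pos])

theorem y₁_add_y₂_pos (h : IsRightLeft f τ c α β γ) : 0 < y₁ α γ + y₂ β γ :=
  ElasticSpline.y₁_add_y₂_pos h.lt h.le₁ h.le h.le₂

theorem lam_pos (h : IsRightLeft f τ c α β γ) : 0 < lam α β γ :=
  div_pos h.neg_sin_pos h.y₁_add_y₂_pos

theorem G_nonneg (h : IsRightLeft f τ c α β γ) : 0 ≤ G α β γ :=
  mul_nonneg (one_div_nonneg.2 h.neg_sin_pos.le) (sq_nonneg _)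

theorem energy_identity (h : IsRightLeft f τ c α β γ)
    (hi : IntervalIntegrable (energyDensity f τ) volume f.a f.b) :
    IntervalIntegrable (deviation f τ (-(2 / lam α β γ)) γ) volume f.a c ∧
    IntervalIntegrable (deviation f τ (2 / lam α β γ) γ) volume c f.b ∧
    f.energy = ENNReal.ofReal (G α β γ + 1 / 4 *
      ((∫ t in f.a..c, deviation f τ (-(2 / lam α β γ)) γ t) +
        ∫ t in c..f.b, deviation f τ (2 / lam α β γ) γ t)) := by
  obtain ⟨hdev_left, hdev_right, hint⟩ := h.angle.integral_energyDensity_two h.curve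
    ⟨h.mem.1.le, h.mem.2⟩ (fun t ht => h.sin_nonneg ht) hi (-(2 / lam α β γ))
  rw [neg_neg] at hdev_right hint
  refine ⟨hdev_left, hdev_right, ?_⟩
  rw [h.angle.energy_eq_ofReal h.curve hi, hint, h.angle_start, h.angle_mid, h.angle_finish,
    height_eq_neg_sin h.start h.finish, mul_add, add_comm]
  congr 2
  have hy₁ : sqrtSinPrim (α - γ) = 2 * y₁ α γ := by rw [y₁_eq]; ring
  have hy₂ : sqrtSinPrim (β - γ) = 2 * y₂ β γ := by rw [y₂_eq]; ring
  have hsin : Real.sin γ ≠ 0 := neg_ne_zero.1 h.neg_sin_pos.ne'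
  have hsum := h.y₁_add_y₂_pos.ne'
  rw [hy₁, hy₂, sub_self, sqrtSinPrim_zero, lam, G]
  field_simp
  ring

theorem ofReal_G_le_energy (h : IsRightLeft f τ c α β γ) :
    ENNReal.ofReal (G α β γ) ≤ f.energy := by
  by_cases hE : f.energy = ⊤
  · exact hE ▸ le_top
  obtain ⟨-, -, henergy⟩ :=
    h.energy_identity (h.angle.intervalIntegrable_energyDensity h.curve hE)
  rw [henergy]
  refine ENNReal.ofReal_le_ofReal (le_add_of_nonneg_right (mul_nonneg (by norm_num) ?_))
  exact add_nonneg (intervalIntegral.integral_nonneg h.mem.1.le fun _ _ => deviation_nonneg)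
    (intervalIntegral.integral_nonneg h.mem.2 fun _ _ => deviation_nonneg)

end IsRightLeft

theorem ae_deriv_eq_of_integral_deviation (hf : f.IsCurve) (hap : f.a ≤ p) (hpq : p ≤ q)
    (hqb : q ≤ f.b) (hi : IntervalIntegrable (deviation f τ m θ) volume p q)
    (h0 : ∫ t in p..q, deviation f τ m θ t = 0) :
    ∀ᵐ t, t ∈ Ioc p q → deriv τ t = m * (√(Real.sin (τ t - θ)) * ‖f.vel t‖) := by
  rw [intervalIntegral.integral_eq_zero_iff_of_le_of_nonneg_ae hpq
    (.of_forall fun _ => deviation_nonneg) hi] at h0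
  filter_upwards [(ae_restrict_iff' measurableSet_Ioc).1 h0] with t hzero ht
  have hv : ‖f.vel t‖ ≠ 0 := (hf.norm_vel_pos ⟨hap.trans ht.1.le, ht.2.trans hqb⟩).ne'
  have hsq := hzero ht
  simp only [deviation, Pi.zero_apply, div_eq_zero_iff, hv, or_false] at hsq
  exact sub_eq_zero.1 (sq_eq_zero_iff.1 hsq)

namespace IsRightLeft

theorem ae_deriv_eq (h : IsRightLeft f τ c α β γ) (hE : f.energy = ENNReal.ofReal (G α β γ)) :
    (∀ᵐ t, t ∈ Ioc f.a c → deriv τ t =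
      -(2 / lam α β γ) * (√(Real.sin (τ t - γ)) * ‖f.vel t‖)) ∧
    (∀ᵐ t, t ∈ Ioc c f.b → deriv τ t =
      2 / lam α β γ * (√(Real.sin (τ t - γ)) * ‖f.vel t‖)) := by
  obtain ⟨hdev_left, hdev_right, henergy⟩ := h.energy_identity
    (h.angle.intervalIntegrable_energyDensity h.curve (hE ▸ ENNReal.ofReal_ne_top))
  have hleft : 0 ≤ ∫ t in f.a..c, deviation f τ (-(2 / lam α β γ)) γ t :=
    intervalIntegral.integral_nonneg h.mem.1.le fun _ _ => deviation_nonneg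
  have hright : 0 ≤ ∫ t in c..f.b, deviation f τ (2 / lam α β γ) γ t :=
    intervalIntegral.integral_nonneg h.mem.2 fun _ _ => deviation_nonneg
  have hG := h.G_nonneg
  rw [hE, ENNReal.ofReal_eq_ofReal_iff hG (by positivity)] at henergy
  exact ⟨ae_deriv_eq_of_integral_deviation h.curve le_rfl h.mem.1.le h.mem.2 hdev_left
      (by linarith),
    ae_deriv_eq_of_integral_deviation h.curve h.mem.1.le h.mem.2 le_rfl hdev_right
      (by linarith)⟩

theorem energyDensity_eq_of_deriv_eq (h : IsRightLeft f τ c α β γ) (ht : t ∈ Icc f.a f.b)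
    (hderiv : deriv τ t = m * (√(Real.sin (τ t - γ)) * ‖f.vel t‖)) :
    energyDensity f τ t = m ^ 2 * (Real.sin (τ t - γ) * ‖f.vel t‖) := by
  have hv := (h.curve.norm_vel_pos ht).ne'
  rw [energyDensity, hderiv, mul_pow, mul_pow, Real.sq_sqrt (h.sin_nonneg ht)]
  field_simp

theorem intervalIntegrable_energyDensity_of_deriv_eq (h : IsRightLeft f τ c α β γ)
    (hleft : ∀ t ∈ Ioo f.a c, deriv τ t = -m * (√(Real.sin (τ t - γ)) * ‖f.vel t‖))
    (hright : ∀ t ∈ Ioo c f.b, deriv τ t = m * (√(Real.sin (τ t - γ)) * ‖f.vel t‖)) :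
    IntervalIntegrable (energyDensity f τ) volume f.a f.b := by
  refine ((h.angle.intervalIntegrable_sin h.curve le_rfl h.curve.1.le le_rfl γ).const_mul
    (m ^ 2)).congr_ae ?_
  rw [uIoc_of_le h.curve.1.le, Filter.EventuallyEq,
    ← Measure.restrict_congr_set (Ioo_ae_eq_Ioc (μ := volume)), ae_restrict_iff' measurableSet_Ioo]
  filter_upwards [compl_mem_ae_iff.2 (measure_singleton c)] with t htc ht
  obtain hlt | hlt := lt_or_gt_of_ne (show t ≠ c from htc)
  · rw [h.energyDensity_eq_of_deriv_eq (Ioo_subset_Icc_self ht) (hleft t ⟨ht.1, hlt⟩), neg_sq]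
  · rw [h.energyDensity_eq_of_deriv_eq (Ioo_subset_Icc_self ht) (hright t ⟨hlt, ht.2⟩)]

theorem energy_eq (h : IsRightLeft f τ c α β γ)
    (hleft : ∀ t ∈ Ioo f.a c, deriv τ t =
      -(2 / lam α β γ) * (√(Real.sin (τ t - γ)) * ‖f.vel t‖))
    (hright : ∀ t ∈ Ioo c f.b, deriv τ t =
      2 / lam α β γ * (√(Real.sin (τ t - γ)) * ‖f.vel t‖)) :
    f.energy = ENNReal.ofReal (G α β γ) := by
  obtain ⟨-, -, henergy⟩ :=
    h.energy_identity (h.intervalIntegrable_energyDensity_of_deriv_eq hleft hright)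
  have hzero {p q m : ℝ} (hpq : p ≤ q)
      (hderiv : ∀ t ∈ Ioo p q, deriv τ t = m * (√(Real.sin (τ t - γ)) * ‖f.vel t‖)) :
      ∫ t in p..q, deviation f τ m γ t = 0 := by
    rw [intervalIntegral.integral_of_le hpq, integral_Ioc_eq_integral_Ioo]
    refine setIntegral_eq_zero_of_forall_eq_zero fun t ht => ?_
    rw [deviation, hderiv t ht, sub_self, zero_pow two_ne_zero, zero_div]
  rw [henergy, hzero h.mem.1.le hleft, hzero h.mem.2 hright, add_zero, mul_zero, add_zero]

theorem mem_GammaSet (h : IsRightLeft f τ c α β γ) (hα : α ∈ Ioo 0 π) : γ ∈ GammaSet α β := by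
  have hγ0 : γ < 0 := by
    by_contra! hγ
    linarith [h.neg_sin_pos, Real.sin_nonneg_of_nonneg_of_le_pi hγ (h.lt.le.trans hα.2.le)]
  have hαγ : α - π ≤ γ := by linarith [h.le₁]
  unfold GammaSet
  split_ifs
  · exact ⟨hαγ, h.le⟩
  · exact ⟨hαγ, hγ0⟩

end IsRightLeft

/-! ### Classification of the s-curves from `u` to `v` -/

theorem Connects.data (h : f.Connects (uVec α) (vVec β)) :
    f.toFun f.a = 0 ∧ f.dir f.a = Complex.exp (α * I) ∧
      f.toFun f.b = 1 ∧ f.dir f.b = Complex.exp (β * I) :=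
  ⟨congrArg Prod.fst h.1, congrArg Prod.snd h.1, congrArg Prod.fst h.2, congrArg Prod.snd h.2⟩

theorem IsDirectionAngle.angle_finish_eq (hτ : f.IsDirectionAngle τ) (hf : f.IsCurve)
    (hdir : f.dir f.b = Complex.exp (β * I)) (hlt : τ f.b - β < 2 * π)
    (hgt : β - τ f.b < 2 * π) : τ f.b = β := by
  refine eq_of_exp_mul_I_eq ?_ hlt hgt
  rw [← hdir, hτ.dir_eq hf (right_mem_Icc.2 hf.1.le)]

theorem antitoneOn_Icc_union (hc : c ∈ Icc p q) (hleft : AntitoneOn τ (Icc p c))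
    (hright : AntitoneOn τ (Icc c q)) : AntitoneOn τ (Icc p q) := by
  rw [← Icc_union_Icc_eq_Icc hc.1 hc.2]
  exact hleft.union_right hright (isGreatest_Icc hc.1) (isLeast_Icc hc.2)

theorem SplitsRightLeft.exists_isRightLeft (hα : α ∈ Ioo 0 π) (hβα : |β| ≤ α)
    (hβ : α - π < β) (hf : f.IsCurve) (hconn : f.Connects (uVec α) (vVec β))
    (hs : f.SplitsRightLeft c) (hn : ¬ f.IsCCurve) :
    ∃ τ γ, IsRightLeft f τ c α β γ ∧ γ < β ∧ γ ∈ GammaSet α β := by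
  obtain ⟨hstart, hdir_start, hfinish, hdir_finish⟩ := hconn.data
  obtain ⟨τ, hτ, hτa⟩ := hf.exists_isDirectionAngle_start hdir_start
  obtain ⟨hc, ⟨hanti, hturn_left⟩, ⟨hmono, hturn_right⟩⟩ := (hτ.splitsRightLeft_iff hf).1 hs
  have hca : τ c ≤ τ f.a := hanti ⟨le_rfl, hc.1.le⟩ ⟨hc.1.le, le_rfl⟩ hc.1.le
  have hcb : τ c ≤ τ f.b := hmono ⟨le_rfl, hc.2.le⟩ ⟨hc.2.le, le_rfl⟩ hc.2.le
  have hβ' := abs_le.1 hβα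
  have hτb : τ f.b = β :=
    hτ.angle_finish_eq hf hdir_finish (by linarith) (by linarith [Real.pi_pos])
  have hlt : τ c < β := by
    refine lt_of_le_of_ne (hcb.trans_eq hτb) fun hτc => hn (Or.inr ?_)
    have hconst : EqOn (fun _ => β) τ (Icc c f.b) := fun t ht => le_antisymm
      (hτc ▸ hmono ⟨le_rfl, hc.2.le⟩ ht ht.1)
      ((hmono ht ⟨hc.2.le, le_rfl⟩ ht.2).trans_eq hτb)
    exact (hτ.isRightCCurve_iff hf).2 ⟨antitoneOn_Icc_union ⟨hc.1.le, hc.2.le⟩ hanti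
      (antitoneOn_const.congr hconst), by linarith [Real.pi_pos]⟩
  have hRL : IsRightLeft f τ c α β (τ c) :=
    ⟨hf, hτ, ⟨hc.1, hc.2.le⟩, hanti, hmono, hτa, rfl, hτb, by linarith, hτa ▸ hturn_left,
      hτb ▸ hturn_right, hstart, hfinish⟩
  exact ⟨τ, τ c, hRL, hlt, hRL.mem_GammaSet hα⟩

theorem IsDirectionAngle.not_eqOn_const (hα : α ∈ Ioo 0 π) (hτ : f.IsDirectionAngle τ)
    (hf : f.IsCurve) (hstart : f.toFun f.a = 0) (hfinish : f.toFun f.b = 1)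
    (h : ∀ t ∈ Icc f.a f.b, τ t = α) : False := by
  have hpos := hτ.height_pos hf (θ := 0)
  rw [height_eq_neg_sin hstart hfinish, Real.sin_zero, neg_zero] at hpos
  have hsin : ∀ t ∈ Icc f.a f.b, 0 < Real.sin (τ t - 0) := fun t ht => by
    rw [h t ht, sub_zero]; exact Real.sin_pos_of_mem_Ioo hα
  exact lt_irrefl _ (hpos (fun t ht => (hsin t ht).le)
    ⟨f.a, left_mem_Icc.2 hf.1.le, hsin _ (left_mem_Icc.2 hf.1.le)⟩)

theorem IsRightCCurve.exists_isRightLeft (hα : α ∈ Ioo 0 π) (hβα : |β| ≤ α)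
    (hβ : α - π < β) (hf : f.IsRightCCurve) (hconn : f.Connects (uVec α) (vVec β)) :
    ∃ τ, IsRightLeft f τ f.b α β β := by
  have hcurve : f.IsCurve := hf.1.1
  obtain ⟨hstart, hdir_start, hfinish, hdir_finish⟩ := hconn.data
  obtain ⟨τ, hτ, hτa⟩ := hcurve.exists_isDirectionAngle_start hdir_start
  obtain ⟨hanti, hturn⟩ := (hτ.isRightCCurve_iff hcurve).1 hf
  have hmem_a := left_mem_Icc.2 hcurve.1.le
  have hmem_b := right_mem_Icc.2 hcurve.1.le
  have hba : τ f.b ≤ τ f.a := hanti hmem_a hmem_b hcurve.1.le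
  have hβ' := abs_le.1 hβα
  have hτb : τ f.b = β :=
    hτ.angle_finish_eq hcurve hdir_finish (by linarith) (by linarith [Real.pi_pos])
  have hlt : β < α := by
    refine lt_of_le_of_ne hβ'.2 fun hβ_eq => hτ.not_eqOn_const hα hcurve hstart hfinish
      fun t ht => le_antisymm (hτa ▸ hanti hmem_a ht ht.1) ?_
    exact (hτb.trans hβ_eq) ▸ hanti ht hmem_b ht.2
  exact ⟨τ, hcurve, hτ, ⟨hcurve.1, le_rfl⟩, hanti, by simp, hτa, hτb, hτb, hlt, by linarith,
    by simp [Real.pi_pos.le], hstart, hfinish⟩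

theorem not_isLeftCCurve (hα : α ∈ Ioo 0 π) (hβα : |β| ≤ α) (hβ : α - π < β)
    (hconn : f.Connects (uVec α) (vVec β)) : ¬ f.IsLeftCCurve := by
  intro hf
  have hcurve : f.IsCurve := hf.1.1
  obtain ⟨hstart, hdir_start, hfinish, hdir_finish⟩ := hconn.data
  obtain ⟨τ, hτ, hτa⟩ := hcurve.exists_isDirectionAngle_start hdir_start
  obtain ⟨hmono, hturn⟩ := (hτ.isLeftCCurve_iff hcurve).1 hf
  have hmem_a := left_mem_Icc.2 hcurve.1.le
  have hmem_b := right_mem_Icc.2 hcurve.1.le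
  have hab : τ f.a ≤ τ f.b := hmono hmem_a hmem_b hcurve.1.le
  have hβ' := abs_le.1 hβα
  have hτb : τ f.b = β :=
    hτ.angle_finish_eq hcurve hdir_finish (by linarith) (by linarith [Real.pi_pos])
  have hβ_eq : β = α := le_antisymm hβ'.2 (by linarith)
  exact hτ.not_eqOn_const hα hcurve hstart hfinish fun t ht => le_antisymm
    ((hτb.trans hβ_eq) ▸ hmono ht hmem_b ht.2) (hτa ▸ hmono hmem_a ht ht.1)

theorem SplitsLeftRight.exists_isDirectionAngle (hβα : |β| ≤ α) (hβ : α - π < β)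
    (hf : f.IsCurve) (hconn : f.Connects (uVec α) (vVec β))
    (hs : f.SplitsLeftRight c) (hn : ¬ f.IsCCurve) :
    ∃ τ, f.IsDirectionAngle τ ∧ τ f.a = α ∧ τ f.b = β ∧ α < τ c ∧ τ c - β ≤ π ∧
      ∀ t ∈ Icc f.a f.b, τ t ∈ Icc β (τ c) := by
  obtain ⟨-, hdir_start, -, hdir_finish⟩ := hconn.data
  obtain ⟨τ, hτ, hτa⟩ := hf.exists_isDirectionAngle_start hdir_start
  obtain ⟨hc, ⟨hmono, hturn_left⟩, ⟨hanti, hturn_right⟩⟩ := (hτ.splitsLeftRight_iff hf).1 hs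
  have hac : τ f.a ≤ τ c := hmono ⟨le_rfl, hc.1.le⟩ ⟨hc.1.le, le_rfl⟩ hc.1.le
  have hbc : τ f.b ≤ τ c := hanti ⟨le_rfl, hc.2.le⟩ ⟨hc.2.le, le_rfl⟩ hc.2.le
  have hβ' := abs_le.1 hβα
  have hτb : τ f.b = β :=
    hτ.angle_finish_eq hf hdir_finish (by linarith) (by linarith [Real.pi_pos])
  refine ⟨τ, hτ, hτa, hτb, ?_, hτb ▸ hturn_right, fun t ht => ?_⟩
  · refine lt_of_le_of_ne (hτa ▸ hac) fun hτc => hn (Or.inr ?_)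
    have hconst : EqOn (fun _ => α) τ (Icc f.a c) := fun t ht => le_antisymm
      (hτa ▸ hmono ⟨le_rfl, hc.1.le⟩ ht ht.1) (hτc ▸ hmono ht ⟨hc.1.le, le_rfl⟩ ht.2)
    exact (hτ.isRightCCurve_iff hf).2 ⟨antitoneOn_Icc_union ⟨hc.1.le, hc.2.le⟩
      (antitoneOn_const.congr hconst) hanti, by linarith⟩
  · rcases le_total t c with htc | hct
    · exact ⟨by linarith [hmono ⟨le_rfl, hc.1.le⟩ ⟨ht.1, htc⟩ ht.1],
        hmono ⟨ht.1, htc⟩ ⟨hc.1.le, le_rfl⟩ htc⟩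
    · exact ⟨by linarith [hanti ⟨hct, ht.2⟩ ⟨hc.2.le, le_rfl⟩ ht.2],
        hanti ⟨le_rfl, hc.2.le⟩ ⟨hct, ht.2⟩ hct⟩

theorem IsDirectionAngle.lower_bound_neg (hα : α ∈ Ioo 0 π) (hτ : f.IsDirectionAngle τ)
    (hf : f.IsCurve) (hstart : f.toFun f.a = 0) (hfinish : f.toFun f.b = 1) (hτa : τ f.a = α)
    (hθβ : θ - β ≤ π) (hrange : ∀ t ∈ Icc f.a f.b, τ t ∈ Icc β θ) : β < 0 := by
  by_contra! hβ0
  have hsinθ : 0 ≤ Real.sin θ := by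
    rw [← neg_nonpos, ← height_eq_neg_sin hstart hfinish]
    exact hτ.height_nonpos hf fun t ht => Real.sin_nonpos_of_nonpos_of_neg_pi_le
      (by linarith [(hrange t ht).2]) (by linarith [(hrange t ht).1])
  have hαβ : β ≤ α := hτa ▸ (hrange _ (left_mem_Icc.2 hf.1.le)).1
  have hθπ : θ ≤ π := by
    by_contra! hθ
    have hsin := Real.sin_pos_of_mem_Ioo
      (show θ - π ∈ Ioo 0 π from ⟨by linarith, by linarith [hα.2]⟩)
    rw [Real.sin_sub_pi] at hsin
    linarith
  have hheight := hτ.height_pos hf (θ := 0)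
    (fun t ht => Real.sin_nonneg_of_nonneg_of_le_pi (by linarith [(hrange t ht).1])
      (by linarith [(hrange t ht).2]))
    ⟨f.a, left_mem_Icc.2 hf.1.le, by rw [hτa, sub_zero]; exact Real.sin_pos_of_mem_Ioo hα⟩
  rw [height_eq_neg_sin hstart hfinish, Real.sin_zero, neg_zero] at hheight
  exact lt_irrefl _ hheight

theorem IsDirectionAngle.ofReal_G_lt_energy (hτ : f.IsDirectionAngle τ) (hf : f.IsCurve)
    (hstart : f.toFun f.a = 0) (hfinish : f.toFun f.b = 1) (hτa : τ f.a = α) (hτb : τ f.b = β)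
    (hc : c ∈ Icc f.a f.b) (hβ : Real.sin β < 0) (hβα : β < α) (hατ : α < τ c)
    (hτβ : τ c - β ≤ π) (hrange : ∀ t ∈ Icc f.a f.b, τ t ∈ Icc β (τ c)) :
    ENNReal.ofReal (G α β β) < f.energy := by
  by_cases hE : f.energy = ⊤
  · exact hE ▸ ENNReal.ofReal_lt_top
  have hi := hτ.intervalIntegrable_energyDensity hf hE
  set Y := sqrtSinPrim (α - β) with hYdef
  set m := Y / -Real.sin β with hm
  obtain ⟨-, -, henergy⟩ := hτ.integral_energyDensity_two hf hc (θ := β)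
    (fun t ht => Real.sin_nonneg_of_nonneg_of_le_pi (by linarith [(hrange t ht).1])
      (by linarith [(hrange t ht).2])) hi m
  rw [hτa, hτb, height_eq_neg_sin hstart hfinish, sub_self, sqrtSinPrim_zero] at henergy
  have hleft : 0 ≤ ∫ t in f.a..c, deviation f τ m β t :=
    intervalIntegral.integral_nonneg hc.1 fun _ _ => deviation_nonneg
  have hright : 0 ≤ ∫ t in c..f.b, deviation f τ (-m) β t :=
    intervalIntegral.integral_nonneg hc.2 fun _ _ => deviation_nonneg
  have hY_lt : Y < sqrtSinPrim (τ c - β) :=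
    strictMonoOn_sqrtSinPrim ⟨by linarith, by linarith⟩ ⟨by linarith, by linarith⟩ (by linarith)
  have hm_pos : 0 < m := div_pos (sqrtSinPrim_pos (by linarith) (by linarith)) (neg_pos.2 hβ)
  have hG : G α β β = 1 / 4 * (2 * m * Y - m ^ 2 * -Real.sin β) := by
    rw [G, y₁_eq, y₂_eq, sub_self, sqrtSinPrim_zero, ← hYdef, hm]
    field_simp [hβ.ne]
    ring
  have hlt : G α β β < 1 / 4 * ∫ t in f.a..f.b, energyDensity f τ t := by
    rw [henergy, hG]
    linarith [mul_lt_mul_of_pos_left hY_lt hm_pos]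
  have hG_nonneg : 0 ≤ G α β β :=
    mul_nonneg (one_div_nonneg.2 (neg_nonneg.2 hβ.le)) (sq_nonneg _)
  rw [hτ.energy_eq_ofReal hf hi]
  exact (ENNReal.ofReal_lt_ofReal_iff (hG_nonneg.trans_lt hlt)).2 hlt

theorem SplitsLeftRight.lt_energy (hα : α ∈ Ioo 0 π) (hβα : |β| ≤ α)
    (hβ : α - π < β) (hf : f.IsCurve) (hconn : f.Connects (uVec α) (vVec β))
    (hs : f.SplitsLeftRight c) (hn : ¬ f.IsCCurve) :
    β < 0 ∧ ENNReal.ofReal (G α β β) < f.energy := by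
  obtain ⟨hstart, -, hfinish, -⟩ := hconn.data
  obtain ⟨τ, hτ, hτa, hτb, hατ, hτβ, hrange⟩ :=
    hs.exists_isDirectionAngle hβα hβ hf hconn hn
  have hneg := hτ.lower_bound_neg hα hf hstart hfinish hτa hτβ hrange
  exact ⟨hneg, hτ.ofReal_G_lt_energy hf hstart hfinish hτa hτb (Ioo_subset_Icc_self hs.1)
    (Real.sin_neg_of_neg_of_neg_pi_lt hneg (by linarith [hα.1])) (hneg.trans hα.1) hατ hτβ
    hrange⟩

end PlanePath

section InflectionClass

variable {f : PlanePath} {α β γ : ℝ}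

theorem exists_isRightLeft_of_mem_sClass (hα : α ∈ Ioo 0 π) (hβα : |β| ≤ α)
    (hβ : α - π < β) (hγ : γ ∈ GammaSet α β) (hf : f ∈ sClass α β γ) :
    ∃ τ c, IsRightLeft f τ c α β γ ∧ (γ < β ∨ γ = β ∧ c = f.b) := by
  unfold sClass at hf
  split_ifs at hf with hcase
  · obtain ⟨τ, hτ⟩ := hf.1.exists_isRightLeft hα hβα hβ hf.2
    exact ⟨τ, f.b, hcase.2.symm ▸ hτ, Or.inr ⟨hcase.2, rfl⟩⟩
  · obtain ⟨⟨hs, hconn⟩, hn, c, hsplit, hdir⟩ := hf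
    obtain ⟨τ, γ', h, hlt, hmem⟩ := hsplit.exists_isRightLeft hα hβα hβ hs.1 hconn hn
    obtain ⟨hαγ', hγ'0, -⟩ := bounds_of_mem_GammaSet hmem
    obtain ⟨hαγ, hγ0, -⟩ := bounds_of_mem_GammaSet hγ
    obtain rfl : γ' = γ := by
      refine eq_of_exp_mul_I_eq ?_ (by linarith [hα.1, Real.pi_pos])
        (by linarith [hα.1, Real.pi_pos])
      rw [← hdir, h.angle.dir_eq h.curve ⟨h.mem.1.le, h.mem.2⟩, h.angle_mid]
    exact ⟨τ, c, h, Or.inl hlt⟩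

theorem ofReal_le_energy_of_mem_sCurves {Gmin : ℝ} (hα : α ∈ Ioo 0 π) (hβα : |β| ≤ α)
    (hβ : α - π < β) (hG : ∀ γ ∈ GammaSet α β, Gmin ≤ G α β γ)
    (hf : f ∈ sCurves (uVec α) (vVec β)) : ENNReal.ofReal Gmin ≤ f.energy := by
  obtain ⟨⟨hcurve, hs⟩, hconn⟩ := hf
  by_cases hn : f.IsCCurve
  · obtain hleft | hright := hn
    · exact absurd hleft (not_isLeftCCurve hα hβα hβ hconn)
    · obtain ⟨τ, h⟩ := hright.exists_isRightLeft hα hβα hβ hconn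
      exact (ENNReal.ofReal_le_ofReal (hG β (h.mem_GammaSet hα))).trans h.ofReal_G_le_energy
  · obtain hcc | ⟨c, hrl | hlr⟩ := hs
    · exact absurd hcc hn
    · obtain ⟨τ, γ, h, -, hmem⟩ := hrl.exists_isRightLeft hα hβα hβ hcurve hconn hn
      exact (ENNReal.ofReal_le_ofReal (hG γ hmem)).trans h.ofReal_G_le_energy
    · obtain ⟨hneg, hlt⟩ := hlr.lt_energy hα hβα hβ hcurve hconn hn
      refine (ENNReal.ofReal_le_ofReal (hG β ?_)).trans hlt.le
      rw [GammaSet, if_pos hneg]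
      exact ⟨hβ.le, le_rfl⟩

end InflectionClass

/-! ### The rectangular elastica -/

section Elastica

variable {x y : ℝ}

/-- The velocity `E'` of the elastica. -/
noncomputable def elasticaVel (x : ℝ) : ℂ :=
  (Real.cos x : ℂ) + I * (Real.sin x ^ 2 / √(1 + Real.sin x ^ 2) : ℝ)

/-- The direction angle of the elastica `E` which vanishes at `0`. -/
noncomputable def elasticaAngle (x : ℝ) : ℝ := π / 2 - 2 * Real.arcsin (Real.cos x / √2)

theorem one_add_sin_sq_pos (x : ℝ) : 0 < 1 + Real.sin x ^ 2 := by positivity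

theorem sqrt_one_add_sin_sq_pos (x : ℝ) : 0 < √(1 + Real.sin x ^ 2) :=
  Real.sqrt_pos.2 (one_add_sin_sq_pos x)

theorem contDiff_sin_sq_div_sqrt :
    ContDiff ℝ 1 fun r => Real.sin r ^ 2 / √(1 + Real.sin r ^ 2) :=
  ContDiff.div (by fun_prop) (ContDiff.sqrt (by fun_prop) fun x => (one_add_sin_sq_pos x).ne')
    fun x => (sqrt_one_add_sin_sq_pos x).ne'

theorem hasDerivAt_xi (x : ℝ) : HasDerivAt xi (Real.sin x ^ 2 / √(1 + Real.sin x ^ 2)) x :=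
  (contDiff_sin_sq_div_sqrt.continuous.integral_hasStrictDerivAt 0 x).hasDerivAt

theorem hasDerivAt_elastica (x : ℝ) : HasDerivAt elastica (elasticaVel x) x :=
  (Real.hasDerivAt_sin x).ofReal_comp.add ((hasDerivAt_xi x).ofReal_comp.const_mul I)

@[simp] theorem xi_zero : xi 0 = 0 := intervalIntegral.integral_same

theorem xi_neg (x : ℝ) : xi (-x) = -xi x := by
  have hcomp := intervalIntegral.integral_comp_neg (a := 0) (b := x)
    (fun r => Real.sin r ^ 2 / √(1 + Real.sin r ^ 2))
  simp only [Real.sin_neg, neg_sq, neg_zero] at hcomp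
  rw [xi, intervalIntegral.integral_symm, ← hcomp, xi]

theorem xi_sub_pi (x : ℝ) : xi (x - π) = xi x - xi π := by
  have hcomp := intervalIntegral.integral_comp_sub_right (a := π) (b := x)
    (fun r => Real.sin r ^ 2 / √(1 + Real.sin r ^ 2)) π
  simp only [Real.sin_sub_pi, neg_sq, sub_self] at hcomp
  rw [xi, xi, xi, ← hcomp, intervalIntegral.integral_interval_sub_left
    (contDiff_sin_sq_div_sqrt.continuous.intervalIntegrable _ _)
    (contDiff_sin_sq_div_sqrt.continuous.intervalIntegrable _ _)]

@[simp] theorem elastica_zero : elastica 0 = 0 := by simp [elastica]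

theorem elastica_neg (x : ℝ) : elastica (-x) = -elastica x := by
  simp only [elastica, xi_neg, Real.sin_neg]
  push_cast
  ring

theorem elastica_sub_pi (x : ℝ) :
    elastica (x - π) = -(starRingEnd ℂ) (elastica x) - I * (xi π : ℂ) := by
  simp only [elastica, xi_sub_pi, Real.sin_sub_pi, map_add, map_mul, Complex.conj_ofReal,
    Complex.conj_I]
  push_cast
  ring

theorem contDiff_elasticaVel : ContDiff ℝ 1 elasticaVel :=
  (Complex.ofRealCLM.contDiff.comp Real.contDiff_cos).add
    (contDiff_const.mul (Complex.ofRealCLM.contDiff.comp contDiff_sin_sq_div_sqrt))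

theorem cos_div_sqrt_two_mem_Ioo (x : ℝ) : Real.cos x / √2 ∈ Ioo (-1) 1 := by
  have hsqrt : 0 < √(2 : ℝ) := by positivity
  rw [mem_Ioo, ← abs_lt, abs_div, abs_of_pos hsqrt, div_lt_one hsqrt]
  exact (Real.abs_cos_le_one x).trans_lt Real.one_lt_sqrt_two

theorem sin_arcsin_cos_div_sqrt_two (x : ℝ) :
    Real.sin (Real.arcsin (Real.cos x / √2)) = Real.cos x / √2 :=
  Real.sin_arcsin (cos_div_sqrt_two_mem_Ioo x).1.le (cos_div_sqrt_two_mem_Ioo x).2.le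

theorem sqrt_one_sub_cos_div_sqrt_two_sq (x : ℝ) :
    √(1 - (Real.cos x / √2) ^ 2) = √(1 + Real.sin x ^ 2) / √2 := by
  rw [← Real.sqrt_div (one_add_sin_sq_pos x).le, div_pow, Real.sq_sqrt zero_le_two,
    Real.cos_sq']
  congr 1
  ring

theorem sin_elasticaAngle (x : ℝ) : Real.sin (elasticaAngle x) = Real.sin x ^ 2 := by
  rw [elasticaAngle, Real.sin_pi_div_two_sub, Real.cos_two_mul, Real.cos_sq',
    sin_arcsin_cos_div_sqrt_two, div_pow, Real.sq_sqrt zero_le_two, Real.cos_sq']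
  ring

theorem cos_elasticaAngle (x : ℝ) :
    Real.cos (elasticaAngle x) = Real.cos x * √(1 + Real.sin x ^ 2) := by
  rw [elasticaAngle, Real.cos_pi_div_two_sub, Real.sin_two_mul, sin_arcsin_cos_div_sqrt_two,
    Real.cos_arcsin, sqrt_one_sub_cos_div_sqrt_two_sq]
  field_simp
  rw [Real.sq_sqrt zero_le_two, mul_comm]

theorem elasticaVel_eq (x : ℝ) : elasticaVel x =
    ((√(1 + Real.sin x ^ 2))⁻¹ : ℝ) * Complex.exp (elasticaAngle x * I) := by
  have hne : ((√(1 + Real.sin x ^ 2) : ℝ) : ℂ) ≠ 0 := mod_cast (sqrt_one_add_sin_sq_pos x).ne'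
  rw [Complex.exp_mul_I, ← Complex.ofReal_cos, ← Complex.ofReal_sin, sin_elasticaAngle,
    cos_elasticaAngle, elasticaVel, Complex.ofReal_mul, Complex.ofReal_div, Complex.ofReal_inv]
  field_simp

theorem norm_elasticaVel (x : ℝ) : ‖elasticaVel x‖ = (√(1 + Real.sin x ^ 2))⁻¹ := by
  rw [elasticaVel_eq, norm_mul, Complex.norm_exp_ofReal_mul_I, mul_one, Complex.norm_real,
    Real.norm_of_nonneg (inv_nonneg.2 (Real.sqrt_nonneg _))]

theorem elasticaVel_ne_zero (x : ℝ) : elasticaVel x ≠ 0 := by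
  rw [← norm_pos_iff, norm_elasticaVel]
  exact inv_pos.2 (sqrt_one_add_sin_sq_pos x)

theorem hasDerivAt_elasticaAngle (x : ℝ) :
    HasDerivAt elasticaAngle (2 * Real.sin x / √(1 + Real.sin x ^ 2)) x := by
  have hmem := cos_div_sqrt_two_mem_Ioo x
  have harcsin := (Real.hasDerivAt_arcsin hmem.1.ne' hmem.2.ne).comp x
    ((Real.hasDerivAt_cos x).div_const √2)
  refine ((harcsin.const_mul 2).const_sub (π / 2)).congr_deriv ?_
  have hne := (sqrt_one_add_sin_sq_pos x).ne'
  rw [sqrt_one_sub_cos_div_sqrt_two_sq]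
  field_simp

theorem contDiff_elasticaAngle : ContDiff ℝ 1 elasticaAngle := by
  rw [contDiff_one_iff_deriv, funext fun x => (hasDerivAt_elasticaAngle x).deriv]
  exact ⟨fun x => (hasDerivAt_elasticaAngle x).differentiableAt,
    Continuous.div (by fun_prop) (by fun_prop) fun x => (sqrt_one_add_sin_sq_pos x).ne'⟩

theorem elasticaAngle_neg (x : ℝ) : elasticaAngle (-x) = elasticaAngle x := by
  rw [elasticaAngle, elasticaAngle, Real.cos_neg]

theorem arcsin_inv_sqrt_two : Real.arcsin (1 / √2) = π / 4 := by
  rw [← Real.sqrt_div_self', ← Real.sin_pi_div_four, Real.arcsin_sin] <;>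
    linarith [Real.pi_pos]

@[simp] theorem elasticaAngle_zero : elasticaAngle 0 = 0 := by
  rw [elasticaAngle, Real.cos_zero, arcsin_inv_sqrt_two]
  ring

@[simp] theorem elasticaAngle_pi : elasticaAngle π = π := by
  rw [elasticaAngle, Real.cos_pi, neg_div, Real.arcsin_neg, arcsin_inv_sqrt_two]
  ring

theorem elasticaAngle_pi_sub (x : ℝ) : elasticaAngle (π - x) = π - elasticaAngle x := by
  rw [elasticaAngle, elasticaAngle, Real.cos_pi_sub, neg_div, Real.arcsin_neg]
  ring

theorem elasticaAngle_le_pi (x : ℝ) : elasticaAngle x ≤ π := by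
  rw [← elasticaAngle_pi, elasticaAngle, elasticaAngle, Real.cos_pi]
  gcongr
  exact Real.neg_one_le_cos x

theorem elasticaAngle_nonneg (x : ℝ) : 0 ≤ elasticaAngle x := by
  linarith [elasticaAngle_le_pi (π - x), elasticaAngle_pi_sub x]

theorem strictMonoOn_elasticaAngle : StrictMonoOn elasticaAngle (Icc 0 π) := by
  refine strictMonoOn_of_deriv_pos (convex_Icc _ _)
    contDiff_elasticaAngle.continuous.continuousOn fun x hx => ?_
  rw [interior_Icc] at hx
  rw [(hasDerivAt_elasticaAngle x).deriv]
  exact div_pos (mul_pos two_pos (Real.sin_pos_of_mem_Ioo hx)) (sqrt_one_add_sin_sq_pos x)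

/-- The parameter in `[0, π]` at which the elastica has the direction angle `y`. -/
noncomputable def elasticaParam (y : ℝ) : ℝ := Real.arccos (Real.cos (y / 2) - Real.sin (y / 2))

theorem elasticaParam_mem_Icc (y : ℝ) : elasticaParam y ∈ Icc 0 π :=
  ⟨Real.arccos_nonneg _, Real.arccos_le_pi _⟩

theorem continuous_elasticaParam : Continuous elasticaParam :=
  Real.continuous_arccos.comp (by fun_prop)

theorem cos_sub_sin_sq (y : ℝ) : (Real.cos (y / 2) - Real.sin (y / 2)) ^ 2 = 1 - Real.sin y := by
  have hsin := Real.sin_two_mul (y / 2)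
  rw [mul_div_cancel₀ y two_ne_zero] at hsin
  linear_combination Real.sin_sq_add_cos_sq (y / 2) + hsin

theorem cos_add_sin_sq (y : ℝ) : (Real.cos (y / 2) + Real.sin (y / 2)) ^ 2 = 1 + Real.sin y := by
  have hsin := Real.sin_two_mul (y / 2)
  rw [mul_div_cancel₀ y two_ne_zero] at hsin
  linear_combination Real.sin_sq_add_cos_sq (y / 2) - hsin

theorem cos_elasticaParam (hy : y ∈ Icc 0 π) :
    Real.cos (elasticaParam y) = Real.cos (y / 2) - Real.sin (y / 2) := by
  have hle : |Real.cos (y / 2) - Real.sin (y / 2)| ≤ 1 := by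
    rw [← sq_le_one_iff_abs_le_one, cos_sub_sin_sq]
    exact sub_le_self _ (Real.sin_nonneg_of_mem_Icc hy)
  exact Real.cos_arccos (abs_le.1 hle).1 (abs_le.1 hle).2

theorem sin_elasticaParam (hy : y ∈ Icc 0 π) :
    Real.sin (elasticaParam y) = √(Real.sin y) := by
  rw [← abs_of_nonneg (Real.sin_nonneg_of_mem_Icc (elasticaParam_mem_Icc y)),
    ← Real.sqrt_sq_eq_abs, Real.sin_sq, cos_elasticaParam hy, cos_sub_sin_sq, sub_sub_cancel]

theorem elasticaAngle_elasticaParam (hy : y ∈ Icc 0 π) : elasticaAngle (elasticaParam y) = y := by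
  have hsin : (Real.cos (y / 2) - Real.sin (y / 2)) / √2 = Real.sin (π / 4 - y / 2) := by
    rw [Real.sin_sub, Real.sin_pi_div_four, Real.cos_pi_div_four]
    field_simp
    rw [Real.sq_sqrt zero_le_two, mul_comm]
  rw [elasticaAngle, cos_elasticaParam hy, hsin, Real.arcsin_sin (by linarith [hy.1, hy.2])
    (by linarith [hy.1, hy.2, Real.pi_pos])]
  ring

@[simp] theorem elasticaParam_zero : elasticaParam 0 = 0 := by simp [elasticaParam]

@[simp] theorem elasticaParam_pi : elasticaParam π = π := by simp [elasticaParam]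

theorem strictMonoOn_elasticaParam : StrictMonoOn elasticaParam (Icc 0 π) := by
  intro x hx y hy hxy
  by_contra! hyx
  have hangle := strictMonoOn_elasticaAngle.monotoneOn (elasticaParam_mem_Icc y)
    (elasticaParam_mem_Icc x) hyx
  rw [elasticaAngle_elasticaParam hx, elasticaAngle_elasticaParam hy] at hangle
  exact hangle.not_gt hxy

theorem elasticaParam_lt_pi (hy : 0 ≤ y) (hyπ : y < π) : elasticaParam y < π := by
  simpa using strictMonoOn_elasticaParam ⟨hy, hyπ.le⟩ ⟨Real.pi_pos.le, le_rfl⟩ hyπ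

theorem elasticaParam_pos (hy : 0 < y) (hyπ : y ≤ π) : 0 < elasticaParam y := by
  simpa using strictMonoOn_elasticaParam ⟨le_rfl, Real.pi_pos.le⟩ ⟨hy.le, hyπ⟩ hy

theorem sqrt_one_add_sin (hy : y ∈ Icc 0 π) :
    √(1 + Real.sin y) = Real.cos (y / 2) + Real.sin (y / 2) := by
  rw [← cos_add_sin_sq, Real.sqrt_sq]
  exact add_nonneg
    (Real.cos_nonneg_of_mem_Icc ⟨by linarith [hy.1, Real.pi_pos], by linarith [hy.2]⟩)
    (Real.sin_nonneg_of_nonneg_of_le_pi (by linarith [hy.1]) (by linarith [hy.1, hy.2]))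

theorem hasDerivAt_elasticaParam (hy : y ∈ Ioo 0 π) :
    HasDerivAt elasticaParam (√(1 + Real.sin y) / (2 * √(Real.sin y))) y := by
  have hsin := Real.sin_pos_of_mem_Ioo hy
  have hlt : |Real.cos (y / 2) - Real.sin (y / 2)| < 1 := by
    rw [← sq_lt_one_iff_abs_lt_one, cos_sub_sin_sq]
    exact sub_lt_self _ hsin
  have hhalf := (hasDerivAt_id y).div_const 2
  refine ((Real.hasDerivAt_arccos (abs_lt.1 hlt).1.ne' (abs_lt.1 hlt).2.ne).comp y
    (hhalf.cos.sub hhalf.sin)).congr_deriv ?_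
  have hne := (Real.sqrt_pos.2 hsin).ne'
  simp only [id_eq]
  rw [cos_sub_sin_sq, sqrt_one_add_sin (Ioo_subset_Icc_self hy), sub_sub_cancel]
  field_simp
  ring

theorem xi_eq (hx : x ∈ Icc 0 π) : xi x = 1 / 2 * sqrtSinPrim (elasticaAngle x) := by
  have hderiv : ∀ t ∈ uIcc 0 x, HasDerivAt (fun t => 1 / 2 * sqrtSinPrim (elasticaAngle t))
      (Real.sin t ^ 2 / √(1 + Real.sin t ^ 2)) t := by
    intro t ht
    rw [uIcc_of_le hx.1] at ht
    refine (((hasDerivAt_sqrtSinPrim _).comp t (hasDerivAt_elasticaAngle t)).const_mul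
      (1 / 2 : ℝ)).congr_deriv ?_
    rw [sin_elasticaAngle, Real.sqrt_sq
      (Real.sin_nonneg_of_mem_Icc ⟨ht.1, ht.2.trans hx.2⟩)]
    ring
  have hint := intervalIntegral.integral_eq_sub_of_hasDerivAt hderiv
    (contDiff_sin_sq_div_sqrt.continuous.intervalIntegrable _ _)
  rwa [elasticaAngle_zero, sqrtSinPrim_zero, mul_zero, sub_zero] at hint

theorem xi_elasticaParam (hy : y ∈ Icc 0 π) : xi (elasticaParam y) = 1 / 2 * sqrtSinPrim y := by
  rw [xi_eq (elasticaParam_mem_Icc y), elasticaAngle_elasticaParam hy]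

end Elastica

/-! ### Equivalence of curves and real-linear maps -/

theorem eqOn_of_hasDerivAt_eq {E : Type*} [NormedAddCommGroup E] [NormedSpace ℝ E]
    {F H F' : ℝ → E} {p q r : ℝ} (hF : ContinuousOn F (Icc p q)) (hH : ContinuousOn H (Icc p q))
    (hF' : ∀ t ∈ Ioo p q, HasDerivAt F (F' t) t) (hH' : ∀ t ∈ Ioo p q, HasDerivAt H (F' t) t)
    (hr : r ∈ Icc p q) (hFH : F r = H r) : EqOn F H (Icc p q) := by
  rcases (hr.1.trans hr.2).eq_or_lt with rfl | hpq
  · intro t ht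
    rw [Icc_self, mem_singleton_iff] at ht hr
    rw [ht, ← hr, hFH]
  have hmid : (p + q) / 2 ∈ Ioo p q := ⟨by linarith, by linarith⟩
  have hsub : ∀ t ∈ Ioo p q, HasDerivAt (F - H) 0 t := fun t ht => by
    simpa only [sub_self] using (hF' t ht).sub (hH' t ht)
  have hconst_Ioo : EqOn (F - H) (fun _ => (F - H) ((p + q) / 2)) (Ioo p q) :=
    fun t ht => isOpen_Ioo.is_const_of_deriv_eq_zero isPreconnected_Ioo
      (fun x hx => (hsub x hx).differentiableAt.differentiableWithinAt)
      (fun x hx => (hsub x hx).deriv) ht hmid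
  have hconst : EqOn (F - H) (fun _ => (F - H) ((p + q) / 2)) (Icc p q) :=
    hconst_Ioo.of_subset_closure (hF.sub hH) continuousOn_const Ioo_subset_Icc_self
      (by rw [closure_Ioo hpq.ne])
  intro t ht
  have heq : (F - H) t = (F - H) r := (hconst ht).trans (hconst hr).symm
  rwa [Pi.sub_apply, Pi.sub_apply, hFH, sub_self, sub_eq_zero] at heq

theorem hasDerivAt_integral_of_continuousOn {F : ℝ → ℝ} {p q t : ℝ}
    (hF : ContinuousOn F (Icc p q)) (ht : t ∈ Ioo p q) :
    HasDerivAt (fun x => ∫ r in p..x, F r) (F t) t := by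
  refine intervalIntegral.integral_hasDerivAt_right ?_ ?_ (hF.continuousAt (Icc_mem_nhds ht.1 ht.2))
  · refine ContinuousOn.intervalIntegrable ?_
    rw [uIcc_of_le ht.1.le]
    exact hF.mono (Icc_subset_Icc_right ht.2.le)
  · exact (hF.mono Ioo_subset_Icc_self).stronglyMeasurableAtFilter isOpen_Ioo t ht

theorem continuousOn_integral_of_continuousOn {F : ℝ → ℝ} {p q : ℝ} (hpq : p ≤ q)
    (hF : ContinuousOn F (Icc p q)) : ContinuousOn (fun x => ∫ r in p..x, F r) (Icc p q) := by
  rw [← uIcc_of_le hpq] at hF ⊢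
  exact intervalIntegral.continuousOn_primitive_interval (hF.integrableOn_compact isCompact_uIcc)

namespace PlanePath

variable {f g : PlanePath} {s t : ℝ}

theorem Equiv.symm (h : f.Equiv g) : g.Equiv f :=
  ⟨h.1.symm, fun s hs t ht hst => (h.2 t ht s hs hst.symm).symm⟩

theorem IsCurve.continuousOn_arcLength (hf : f.IsCurve) :
    ContinuousOn f.arcLength (Icc f.a f.b) :=
  continuousOn_integral_of_continuousOn hf.1.le hf.continuousOn_vel.norm

theorem IsCurve.hasDerivAt_arcLength (hf : f.IsCurve) (ht : t ∈ Ioo f.a f.b) :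
    HasDerivAt f.arcLength ‖f.vel t‖ t :=
  hasDerivAt_integral_of_continuousOn hf.continuousOn_vel.norm ht

@[simp] theorem arcLength_start : f.arcLength f.a = 0 := by simp [arcLength]

theorem IsCurve.strictMonoOn_arcLength (hf : f.IsCurve) :
    StrictMonoOn f.arcLength (Icc f.a f.b) := by
  refine strictMonoOn_of_deriv_pos (convex_Icc _ _) hf.continuousOn_arcLength fun t ht => ?_
  rw [interior_Icc] at ht
  rw [(hf.hasDerivAt_arcLength ht).deriv]
  exact hf.norm_vel_pos (Ioo_subset_Icc_self ht)

theorem IsCurve.arcLength_eq_of_reparam (hf : f.IsCurve) (hg : g.IsCurve) {ψ ψ' : ℝ → ℝ}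
    (hψ : ContinuousOn ψ (Icc f.a f.b)) (hψ' : ∀ t ∈ Ioo f.a f.b, HasDerivAt ψ (ψ' t) t)
    (hmono : StrictMonoOn ψ (Icc f.a f.b)) (ha : ψ f.a = g.a) (hb : ψ f.b = g.b)
    (hfg : ∀ t ∈ Icc f.a f.b, f.toFun t = g.toFun (ψ t)) :
    EqOn f.arcLength (g.arcLength ∘ ψ) (Icc f.a f.b) := by
  have hIcc : MapsTo ψ (Icc f.a f.b) (Icc g.a g.b) := ha ▸ hb ▸ hmono.monotoneOn.mapsTo_Icc
  have hIoo : MapsTo ψ (Ioo f.a f.b) (Ioo g.a g.b) := ha ▸ hb ▸ hmono.mapsTo_Ioo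
  refine eqOn_of_hasDerivAt_eq hf.continuousOn_arcLength
    (hg.continuousOn_arcLength.comp hψ hIcc) (fun t ht => hf.hasDerivAt_arcLength ht)
    (fun t ht => ?_) (left_mem_Icc.2 hf.1.le) (by simp [ha])
  have hchain : HasDerivAt f.toFun (ψ' t • g.vel (ψ t)) t := by
    refine ((hg.hasDerivAt (hIoo ht)).scomp t (hψ' t ht)).congr_of_eventuallyEq ?_
    filter_upwards [Icc_mem_nhds ht.1 ht.2] with x hx using hfg x hx
  have hnonneg : 0 ≤ ψ' t := by
    rw [← ((hψ' t ht).hasDerivWithinAt (s := Icc f.a f.b)).derivWithin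
      (uniqueDiffOn_Icc hf.1 t (Ioo_subset_Icc_self ht))]
    exact hmono.monotoneOn.derivWithin_nonneg
  refine ((hg.hasDerivAt_arcLength (hIoo ht)).comp t (hψ' t ht)).congr_deriv ?_
  rw [(hf.hasDerivAt ht).unique hchain, norm_smul, Real.norm_of_nonneg hnonneg, mul_comm]

theorem Equiv.of_reparam (hf : f.IsCurve) (hg : g.IsCurve) {ψ ψ' : ℝ → ℝ}
    (hψ : ContinuousOn ψ (Icc f.a f.b)) (hψ' : ∀ t ∈ Ioo f.a f.b, HasDerivAt ψ (ψ' t) t)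
    (hmono : StrictMonoOn ψ (Icc f.a f.b)) (ha : ψ f.a = g.a) (hb : ψ f.b = g.b)
    (hfg : ∀ t ∈ Icc f.a f.b, f.toFun t = g.toFun (ψ t)) : f.Equiv g := by
  have harc := hf.arcLength_eq_of_reparam hg hψ hψ' hmono ha hb hfg
  have hIcc : MapsTo ψ (Icc f.a f.b) (Icc g.a g.b) := ha ▸ hb ▸ hmono.monotoneOn.mapsTo_Icc
  refine ⟨?_, fun s hs t ht hst => ?_⟩
  · rw [len, len, harc (right_mem_Icc.2 hf.1.le), Function.comp_apply, hb]
  · rw [hfg s hs, hg.strictMonoOn_arcLength.injOn (hIcc hs) ht ((harc hs).symm.trans hst)]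

theorem Equiv.of_shift (hf : f.IsCurve) (hg : g.IsCurve) {r : ℝ} (ha : f.a + r = g.a)
    (hb : f.b + r = g.b) (h : ∀ t ∈ Icc f.a f.b, f.toFun t = g.toFun (t + r)) : f.Equiv g :=
  Equiv.of_reparam hf hg (ψ := fun t => t + r) (ψ' := fun _ => 1) (by fun_prop)
    (fun t _ => (hasDerivAt_id t).add_const r)
    (fun _ _ _ _ hst => add_lt_add_left hst r) ha hb h

theorem Equiv.of_eqOn (hf : f.IsCurve) (hg : g.IsCurve) (ha : f.a = g.a) (hb : f.b = g.b)
    (h : EqOn f.toFun g.toFun (Icc f.a f.b)) : f.Equiv g :=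
  Equiv.of_shift hf hg (r := 0) (by rw [ha, add_zero]) (by rw [hb, add_zero]) fun t ht => by
    rw [add_zero, h ht]

theorem Equiv.of_point (hf : f.a = f.b) (hg : g.a = g.b) (h : f.toFun f.a = g.toFun g.a) :
    f.Equiv g := by
  refine ⟨by simp [len, arcLength, hf, hg], fun s hs t ht _ => ?_⟩
  rw [← hf, Icc_self, mem_singleton_iff] at hs
  rw [← hg, Icc_self, mem_singleton_iff] at ht
  rw [hs, ht, h]

theorem arcLength_of_affine {z w : ℂ}
    (h : ∀ t ∈ Icc f.a f.b, f.toFun t = z + ((t - f.a : ℝ) : ℂ) * w) (ht : t ∈ Icc f.a f.b) :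
    f.arcLength t = (t - f.a) * ‖w‖ := by
  rcases (ht.1.trans ht.2).eq_or_lt with hab | hab
  · rw [← hab, Icc_self, mem_singleton_iff] at ht
    simp [ht]
  have hvel : ∀ x ∈ Icc f.a f.b, f.vel x = w := fun x hx => by
    have haffine : HasDerivAt (fun t : ℝ => z + ((t - f.a : ℝ) : ℂ) * w) w x := by
      simpa using ((((hasDerivAt_id x).sub_const f.a).ofReal_comp).mul_const w).const_add z
    exact vel_eq_of_hasDerivWithinAt hab hx (haffine.hasDerivWithinAt.congr h (h x hx))
  rw [arcLength, intervalIntegral.integral_congr (g := fun _ => ‖w‖)]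
  · simp
  · intro x hx
    rw [uIcc_of_le ht.1] at hx
    simp only [hvel x ⟨hx.1, hx.2.trans ht.2⟩]

theorem Equiv.lineSeg_of_affine (hab : f.a ≤ f.b) {z w B : ℂ}
    (h : ∀ t ∈ Icc f.a f.b, f.toFun t = z + ((t - f.a : ℝ) : ℂ) * w)
    (hB : B = z + ((f.b - f.a : ℝ) : ℂ) * w) : f.Equiv (lineSeg z B) := by
  have hsub : B - z = ((f.b - f.a : ℝ) : ℂ) * w := by rw [hB, add_sub_cancel_left]
  have harc : ∀ t ∈ Icc (0 : ℝ) 1,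
      (lineSeg z B).arcLength t = t * ((f.b - f.a) * ‖w‖) := fun t ht => by
    rw [arcLength_of_affine (z := z) (w := B - z) (fun t _ => by simp [lineSeg]) ht, hsub,
      norm_mul, Complex.norm_real, Real.norm_of_nonneg (sub_nonneg.2 hab)]
    simp [lineSeg]
  refine ⟨?_, fun s hs t ht hst => ?_⟩
  · rw [len, len, arcLength_of_affine h (right_mem_Icc.2 hab)]
    exact ((harc 1 (right_mem_Icc.2 zero_le_one)).trans (one_mul _)).symm
  · rw [arcLength_of_affine h hs, harc t ht] at hst
    rw [h s hs]
    simp only [lineSeg, hsub]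
    rcases eq_or_ne w 0 with rfl | hw
    · simp
    · have hs_eq : s - f.a = t * (f.b - f.a) :=
        mul_right_cancel₀ (norm_ne_zero_iff.2 hw) (hst.trans (mul_assoc _ _ _).symm)
      rw [hs_eq, Complex.ofReal_mul, mul_assoc]

theorem IsCurve.of_hasDerivAt {w : ℝ → ℂ} (hab : f.a < f.b)
    (hderiv : ∀ t ∈ Icc f.a f.b, HasDerivAt f.toFun (w t) t)
    (hw : AbsolutelyContinuousOnInterval w f.a f.b) (hne : ∀ t ∈ Icc f.a f.b, w t ≠ 0) :
    f.IsCurve := by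
  have hvel : ∀ t ∈ Icc f.a f.b, f.vel t = w t := fun t ht =>
    vel_eq_of_hasDerivAt hab ht (hderiv t ht)
  refine ⟨hab, fun t ht => (hderiv t ht).differentiableAt.differentiableWithinAt, ?_,
    fun t ht => by rw [hvel t ht]; exact hne t ht⟩
  refine absolutelyContinuousOnInterval_congr hw fun t ht => ?_
  rw [uIcc_of_le hab.le] at ht
  exact (hvel t ht).symm

theorem IsCurve.map (hf : f.IsCurve) {T : ℂ → ℂ} (L : ℂ ≃L[ℝ] ℂ) (c : ℂ)
    (hT : ∀ z, T z = L z + c) : (f.map T).IsCurve := by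
  have hderiv : ∀ t ∈ Icc f.a f.b,
      HasDerivWithinAt (f.map T).toFun (L (f.vel t)) (Icc f.a f.b) t := fun t ht =>
    ((L.hasFDerivAt.comp_hasDerivWithinAt t (hf.hasDerivWithinAt ht)).add_const c).congr
      (fun x _ => hT _) (hT _)
  have hvel : ∀ t ∈ Icc f.a f.b, (f.map T).vel t = L (f.vel t) := fun t ht =>
    vel_eq_of_hasDerivWithinAt (f := f.map T) hf.1 ht (hderiv t ht)
  refine ⟨hf.1, fun t ht => (hderiv t ht).differentiableWithinAt, ?_, fun t ht => ?_⟩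
  · refine absolutelyContinuousOnInterval_congr
      (absolutelyContinuousOnInterval_contDiff_comp L.contDiff hf.2.2.1) fun t ht => ?_
    exact (hvel t (uIcc_of_le hf.1.le ▸ ht)).symm
  · rw [hvel t ht]
    simpa using hf.2.2.2 t ht

theorem IsCurve.map_mul_add (hf : f.IsCurve) {c₁ : ℂ} (hc : c₁ ≠ 0) (c₂ : ℂ) :
    (f.map fun z => c₁ * z + c₂).IsCurve :=
  hf.map (.smulLeft (Units.mk0 c₁ hc)) c₂ fun _ => rfl

theorem IsCurve.map_conj_mul_add (hf : f.IsCurve) {c₁ : ℂ} (hc : c₁ ≠ 0) (c₂ : ℂ) :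
    (f.map fun z => c₁ * (starRingEnd ℂ) z + c₂).IsCurve :=
  hf.map (Complex.conjCLE.trans (.smulLeft (Units.mk0 c₁ hc))) c₂ fun _ => rfl

end PlanePath

/-! ### Elastica with line segments inserted -/

section InsertedSegments

variable {x b : ℝ}

/-- The parameter of an elastica which rests at `-π` up to the time `-π`, at `0` during `[0, b]`,
and at `π` from the time `b + π` on. -/
noncomputable def pause (b x : ℝ) : ℝ := max (-π) (min x 0) + min π (max (x - b) 0)

section Pause

theorem pause_of_nonpos (hb : 0 ≤ b) (hx : x ≤ 0) : pause b x = max (-π) x := by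
  rw [pause, min_eq_left hx, max_eq_right (show x - b ≤ 0 by linarith), min_eq_right Real.pi_pos.le,
    add_zero]

theorem pause_of_nonneg (hx : 0 ≤ x) : pause b x = min π (max (x - b) 0) := by
  rw [pause, min_eq_right hx, max_eq_right (by linarith [Real.pi_pos]), zero_add]

theorem pause_of_mem_left (hb : 0 ≤ b) (hx : x ∈ Icc (-π) 0) : pause b x = x := by
  rw [pause_of_nonpos hb hx.2, max_eq_right hx.1]

theorem pause_of_mem_mid (hx : x ∈ Icc 0 b) : pause b x = 0 := by
  rw [pause_of_nonneg hx.1, max_eq_right (by linarith [hx.2]), min_eq_right Real.pi_pos.le]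

theorem pause_of_mem_right (hb : 0 ≤ b) (hx : x ∈ Icc b (b + π)) : pause b x = x - b := by
  rw [pause_of_nonneg (hb.trans hx.1), max_eq_left (by linarith [hx.1]),
    min_eq_right (by linarith [hx.2])]

theorem pause_of_le (hb : 0 ≤ b) (hx : x ≤ -π) : pause b x = -π := by
  rw [pause_of_nonpos hb (by linarith [Real.pi_pos]), max_eq_left hx]

theorem pause_of_ge (hb : 0 ≤ b) (hx : b + π ≤ x) : pause b x = π := by
  rw [pause_of_nonneg (by linarith [Real.pi_pos]), max_eq_left (by linarith [Real.pi_pos]),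
    min_eq_left (by linarith)]

theorem pause_mem_of_nonpos (hb : 0 ≤ b) (hx : x ≤ 0) : pause b x ∈ Icc (-π) 0 := by
  rw [pause_of_nonpos hb hx]
  exact ⟨le_max_left _ _, max_le (by linarith [Real.pi_pos]) hx⟩

theorem pause_mem_of_nonneg (hx : 0 ≤ x) : pause b x ∈ Icc 0 π := by
  rw [pause_of_nonneg hx]
  exact ⟨le_min Real.pi_pos.le (le_max_right _ _), min_le_left _ _⟩

theorem monotone_pause (b : ℝ) : Monotone (pause b) := fun x y hxy => by
  unfold pause
  gcongr

theorem lipschitzWith_pause (b : ℝ) : LipschitzWith 2 (pause b) := by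
  have hsub : LipschitzWith 1 fun x : ℝ => x - b :=
    LipschitzWith.of_dist_le_mul fun x y => by simp
  rw [← one_add_one_eq_two]
  exact ((LipschitzWith.id.min_const 0).const_max (-π)).add ((hsub.max_const 0).const_min π)

theorem absolutelyContinuousOnInterval_pause (b p q : ℝ) :
    AbsolutelyContinuousOnInterval (pause b) p q :=
  (lipschitzWith_pause b).lipschitzOnWith.absolutelyContinuousOnInterval

theorem exists_pause_eventuallyEq_sub (hb : 0 ≤ b) (hx : Real.sin (pause b x) ≠ 0) :
    ∃ r, pause b =ᶠ[nhds x] fun y => y - r := by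
  rcases lt_or_ge x 0 with hneg | hnonneg
  · have hleft : -π < x := by
      by_contra! h
      exact hx (by rw [pause_of_le hb h]; simp)
    refine ⟨0, ?_⟩
    filter_upwards [Icc_mem_nhds hleft hneg] with y hy
    rw [pause_of_mem_left hb hy, sub_zero]
  · have hmid : b < x := by
      by_contra! h
      exact hx (by rw [pause_of_mem_mid ⟨hnonneg, h⟩]; simp)
    have hright : x < b + π := by
      by_contra! h
      exact hx (by rw [pause_of_ge hb h]; simp)
    refine ⟨b, ?_⟩
    filter_upwards [Icc_mem_nhds hmid hright] with y hy
    rw [pause_of_mem_right hb hy]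

theorem hasDerivAt_zero_comp_of_lipschitzWith {F p : ℝ → ℝ} {K : NNReal}
    (hF : HasDerivAt F 0 (p x)) (hp : LipschitzWith K p) :
    HasDerivAt (fun y => F (p y)) 0 x := by
  rw [hasDerivAt_iff_isLittleO] at hF ⊢
  simp only [smul_zero, sub_zero] at hF ⊢
  refine (hF.comp_tendsto hp.continuous.continuousAt).trans_isBigO ?_
  refine Asymptotics.IsBigO.of_bound K (.of_forall fun y => ?_)
  simpa only [Function.comp_apply, dist_eq_norm] using hp.dist_le_mul y x

/-- `pause b` has corners exactly at the times where it starts or stops resting; there `sin` of its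
value vanishes, so `elasticaAngle` is stationary and the composition is still differentiable. -/
theorem hasDerivAt_elasticaAngle_pause (hb : 0 ≤ b) (x : ℝ) :
    HasDerivAt (fun x => elasticaAngle (pause b x))
      (2 * Real.sin (pause b x) / √(1 + Real.sin (pause b x) ^ 2)) x := by
  have hangle := hasDerivAt_elasticaAngle (pause b x)
  by_cases hsin : Real.sin (pause b x) = 0
  · rw [hsin, mul_zero, zero_div] at hangle ⊢
    exact hasDerivAt_zero_comp_of_lipschitzWith hangle (lipschitzWith_pause b)
  · obtain ⟨r, hr⟩ := exists_pause_eventuallyEq_sub hb hsin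
    have hpause : HasDerivAt (pause b) 1 x :=
      ((hasDerivAt_id x).sub_const r).congr_of_eventuallyEq hr
    exact (hangle.comp x hpause).congr_deriv (mul_one _)

theorem antitoneOn_elasticaAngle_pause (hb : 0 ≤ b) :
    AntitoneOn (fun x => elasticaAngle (pause b x)) (Iic 0) := fun x hx y hy hxy => by
  have hpx := pause_mem_of_nonpos hb hx
  have hpy := pause_mem_of_nonpos hb hy
  change elasticaAngle (pause b y) ≤ elasticaAngle (pause b x)
  rw [← elasticaAngle_neg, ← elasticaAngle_neg (pause b x)]
  exact strictMonoOn_elasticaAngle.monotoneOn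
    ⟨by linarith [hpy.2], by linarith [hpy.1]⟩ ⟨by linarith [hpx.2], by linarith [hpx.1]⟩
    (neg_le_neg (monotone_pause b hxy))

theorem monotoneOn_elasticaAngle_pause (b : ℝ) :
    MonotoneOn (fun x => elasticaAngle (pause b x)) (Ici 0) := fun _ hx _ hy hxy =>
  strictMonoOn_elasticaAngle.monotoneOn (pause_mem_of_nonneg hx) (pause_mem_of_nonneg hy)
    (monotone_pause b hxy)

theorem abs_sin_eq (x : ℝ) : |Real.sin x| = √(Real.sin (elasticaAngle x)) := by
  rw [sin_elasticaAngle, Real.sqrt_sq_eq_abs]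

end Pause

/-- The elastica `E`, prolonged by straight segments at the parameters `-π`, `0` and `π`. -/
noncomputable def pausedElastica (b x : ℝ) : ℂ := ∫ r in (0 : ℝ)..x, elasticaVel (pause b r)

section PausedElastica

theorem hasDerivAt_pausedElastica (b x : ℝ) :
    HasDerivAt (pausedElastica b) (elasticaVel (pause b x)) x :=
  ((contDiff_elasticaVel.continuous.comp
    (lipschitzWith_pause b).continuous).integral_hasStrictDerivAt 0 x).hasDerivAt

theorem continuous_elastica : Continuous elastica :=
  continuous_iff_continuousAt.2 fun x => (hasDerivAt_elastica x).continuousAt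

@[simp] theorem pausedElastica_zero (b : ℝ) : pausedElastica b 0 = 0 := by simp [pausedElastica]

theorem eqOn_pausedElastica {H : ℝ → ℂ} {p q r : ℝ} (hH : ContinuousOn H (Icc p q))
    (hH' : ∀ t ∈ Ioo p q, HasDerivAt H (elasticaVel (pause b t)) t) (hr : r ∈ Icc p q)
    (heq : pausedElastica b r = H r) : EqOn (pausedElastica b) H (Icc p q) :=
  eqOn_of_hasDerivAt_eq
    (fun x _ => (hasDerivAt_pausedElastica b x).continuousAt.continuousWithinAt) hH
    (fun t _ => hasDerivAt_pausedElastica b t) hH' hr heq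

theorem pausedElastica_left (hb : 0 ≤ b) (hx : x ∈ Icc (-π) 0) :
    pausedElastica b x = elastica x := by
  refine eqOn_pausedElastica continuous_elastica.continuousOn (fun t ht => ?_)
    (right_mem_Icc.2 (by linarith [Real.pi_pos])) (by simp) hx
  rw [pause_of_mem_left hb (Ioo_subset_Icc_self ht)]
  exact hasDerivAt_elastica t

theorem pausedElastica_mid (hx : x ∈ Icc 0 b) : pausedElastica b x = x := by
  refine eqOn_pausedElastica (H := fun x : ℝ => (x : ℂ)) Complex.continuous_ofReal.continuousOn
    (fun t ht => ?_) (left_mem_Icc.2 (hx.1.trans hx.2)) (by simp) hx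
  rw [pause_of_mem_mid (Ioo_subset_Icc_self ht)]
  simpa [elasticaVel] using (hasDerivAt_id t).ofReal_comp

theorem pausedElastica_right (hb : 0 ≤ b) (hx : x ∈ Icc b (b + π)) :
    pausedElastica b x = b + elastica (x - b) := by
  refine eqOn_pausedElastica (H := fun x : ℝ => b + elastica (x - b))
    (continuous_const.add (continuous_elastica.comp (by fun_prop))).continuousOn
    (fun t ht => ?_) (left_mem_Icc.2 (hx.1.trans hx.2))
    (by simp [pausedElastica_mid (right_mem_Icc.2 hb)]) hx
  rw [pause_of_mem_right hb (Ioo_subset_Icc_self ht)]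
  simpa using ((hasDerivAt_elastica (t - b)).scomp t ((hasDerivAt_id t).sub_const b)).const_add
    (b : ℂ)

theorem pausedElastica_le (hb : 0 ≤ b) (hx : x ≤ -π) :
    pausedElastica b x = elastica (-π) - ((x + π : ℝ) : ℂ) := by
  refine eqOn_pausedElastica (H := fun x : ℝ => elastica (-π) - ((x + π : ℝ) : ℂ))
    (by fun_prop) (fun t ht => ?_) (right_mem_Icc.2 hx)
    (by simp [pausedElastica_left hb (left_mem_Icc.2 (by linarith [Real.pi_pos]))])
    (left_mem_Icc.2 hx)
  rw [pause_of_le hb ht.2.le]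
  simpa [elasticaVel] using (((hasDerivAt_id t).add_const π).ofReal_comp).const_sub (elastica (-π))

theorem pausedElastica_ge (hb : 0 ≤ b) (hx : b + π ≤ x) :
    pausedElastica b x = b + elastica π - ((x - (b + π) : ℝ) : ℂ) := by
  refine eqOn_pausedElastica (H := fun x : ℝ => b + elastica π - ((x - (b + π) : ℝ) : ℂ))
    (by fun_prop) (fun t ht => ?_) (left_mem_Icc.2 hx)
    (by simp [pausedElastica_right hb (right_mem_Icc.2 (by linarith [Real.pi_pos]))])
    (right_mem_Icc.2 hx)
  rw [pause_of_ge hb ht.1.le]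
  simpa [elasticaVel] using
    (((hasDerivAt_id t).sub_const (b + π)).ofReal_comp).const_sub (b + elastica π)

end PausedElastica

/-- The path `x ↦ z + μ Z(x)`, where `Z` is the elastica with segments inserted. -/
noncomputable def pausedPath (z μ : ℂ) (b A B : ℝ) : PlanePath :=
  ⟨A, B, fun x => z + μ * pausedElastica b x⟩

section PausedPath

variable {z μ : ℂ} {A B : ℝ}

theorem hasDerivAt_pausedPath (z μ : ℂ) (b A B x : ℝ) :
    HasDerivAt (pausedPath z μ b A B).toFun (μ * elasticaVel (pause b x)) x :=
  ((hasDerivAt_pausedElastica b x).const_mul μ).const_add z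

theorem isCurve_pausedPath (hμ : μ ≠ 0) (hAB : A < B) : (pausedPath z μ b A B).IsCurve := by
  refine IsCurve.of_hasDerivAt (w := fun x => μ * elasticaVel (pause b x)) hAB
    (fun t _ => hasDerivAt_pausedPath z μ b A B t) ?_
    fun t _ => mul_ne_zero hμ (elasticaVel_ne_zero _)
  exact absolutelyContinuousOnInterval_contDiff_comp (g := fun x => μ * elasticaVel x)
    (contDiff_const.mul contDiff_elasticaVel) (absolutelyContinuousOnInterval_pause b A B)

theorem vel_pausedPath (hAB : A < B) (hx : x ∈ Icc A B) :
    (pausedPath z μ b A B).vel x = μ * elasticaVel (pause b x) :=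
  vel_eq_of_hasDerivAt (f := pausedPath z μ b A B) hAB hx (hasDerivAt_pausedPath z μ b A B x)

theorem isDirectionAngle_pausedPath {r γ : ℝ} (hr : 0 < r) (hAB : A < B) :
    (pausedPath z (r * Complex.exp (γ * I)) b A B).IsDirectionAngle
      fun x => γ + elasticaAngle (pause b x) := by
  refine ⟨absolutelyContinuousOnInterval_contDiff_comp (g := fun x => γ + elasticaAngle x)
    (contDiff_const.add contDiff_elasticaAngle)
    (absolutelyContinuousOnInterval_pause b A B), fun t ht => ?_⟩
  rw [vel_pausedPath hAB ht, norm_mul, norm_mul, Complex.norm_exp_ofReal_mul_I, mul_one,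
    norm_elasticaVel, elasticaVel_eq, Complex.norm_real, Real.norm_of_nonneg hr.le]
  push_cast
  rw [add_mul, Complex.exp_add]
  ring

end PausedPath

theorem isCurve_elasticaSeg {A B : ℝ} (hAB : A < B) : (elasticaSeg A B).IsCurve :=
  IsCurve.of_hasDerivAt (w := elasticaVel) hAB (fun t _ => hasDerivAt_elastica t)
    contDiff_elasticaVel.contDiffOn.absolutelyContinuousOnInterval
    fun t _ => elasticaVel_ne_zero t

theorem turning_elasticaSeg {A B : ℝ} (hAB : A < B) :
    (elasticaSeg A B).turning = elasticaAngle B - elasticaAngle A := by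
  refine IsDirectionAngle.turning_eq (f := elasticaSeg A B) (τ := elasticaAngle)
    ⟨contDiff_elasticaAngle.contDiffOn.absolutelyContinuousOnInterval, fun t ht => ?_⟩
    (isCurve_elasticaSeg hAB)
  rw [vel_eq_of_hasDerivAt (f := elasticaSeg A B) hAB ht (hasDerivAt_elastica t),
    norm_elasticaVel, elasticaVel_eq]

end InsertedSegments

section ModelCurve

variable {α β γ a b d : ℝ}

/-- The conditions on the lengths `a`, `b`, `d` of segments of directions `γ + π`, `γ`, `γ + π`
which can be inserted into an elastica whose direction runs from `α` over `γ` to `β`: an outer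
segment is possible only next to a u-turn. -/
structure ModelShape (α β γ a b d : ℝ) : Prop where
  lt : γ < α
  le₁ : α - γ ≤ π
  le : γ ≤ β
  le₂ : β - γ ≤ π
  sin_neg : Real.sin γ < 0
  a_nonneg : 0 ≤ a
  a_eq : a = 0 ∨ α - γ = π
  b_nonneg : 0 ≤ b
  d_nonneg : 0 ≤ d
  d_eq : d = 0 ∨ β - γ = π

/-- Admissible lengths for which the curve with these segments ends at `1`. -/
structure ModelParams (α β γ a b d : ℝ) : Prop extends ModelShape α β γ a b d where
  eq : lam α β γ * (b - a - d) = sigma α β γ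

/-- The similarity factor `λ e^{iγ}` between the elastica and the minimal curves. -/
noncomputable abbrev scale (α β γ : ℝ) : ℂ := lam α β γ * Complex.exp (γ * I)

/-- The curve of minimal energy with inflection direction `γ` and segments of lengths
`λ a`, `λ b`, `λ d`, where `λ = λ(γ)`. -/
noncomputable def model (α β γ a b d : ℝ) : PlanePath :=
  pausedPath (scale α β γ * (elastica (elasticaParam (α - γ)) - a)) (scale α β γ) b
    (-(elasticaParam (α - γ) + a)) (b + elasticaParam (β - γ) + d)

/-- The direction angle of `model`. -/
noncomputable def modelAngle (γ b x : ℝ) : ℝ := γ + elasticaAngle (pause b x)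

theorem lam_mul_y₁_add_y₂ (hpos : 0 < y₁ α γ + y₂ β γ) :
    lam α β γ * (y₁ α γ + y₂ β γ) = -Real.sin γ := by
  rw [lam, div_mul_cancel₀ _ hpos.ne']

theorem sigma_eq : sigma α β γ = Real.cos γ -
    lam α β γ * (√(Real.sin (α - γ)) + √(Real.sin (β - γ))) := by
  rw [sigma, lam]
  ring

namespace ModelShape

theorem y₁_add_y₂_pos (h : ModelShape α β γ a b d) : 0 < y₁ α γ + y₂ β γ :=
  ElasticSpline.y₁_add_y₂_pos h.lt h.le₁ h.le h.le₂

theorem lam_pos (h : ModelShape α β γ a b d) : 0 < lam α β γ :=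
  div_pos (neg_pos.2 h.sin_neg) h.y₁_add_y₂_pos

theorem sub_mem₁ (h : ModelShape α β γ a b d) : α - γ ∈ Icc 0 π :=
  ⟨sub_nonneg.2 h.lt.le, h.le₁⟩

theorem sub_mem₂ (h : ModelShape α β γ a b d) : β - γ ∈ Icc 0 π :=
  ⟨sub_nonneg.2 h.le, h.le₂⟩

theorem param_pos (h : ModelShape α β γ a b d) : 0 < elasticaParam (α - γ) :=
  elasticaParam_pos (sub_pos.2 h.lt) h.le₁

theorem left_neg (h : ModelShape α β γ a b d) : -(elasticaParam (α - γ) + a) < 0 := by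
  linarith [h.param_pos, h.a_nonneg]

theorem right_nonneg (h : ModelShape α β γ a b d) : 0 ≤ b + elasticaParam (β - γ) + d := by
  linarith [(elasticaParam_mem_Icc (β - γ)).1, h.b_nonneg, h.d_nonneg]

theorem left_lt_right (h : ModelShape α β γ a b d) :
    -(elasticaParam (α - γ) + a) < b + elasticaParam (β - γ) + d :=
  h.left_neg.trans_le h.right_nonneg

theorem scale_ne_zero (h : ModelShape α β γ a b d) : scale α β γ ≠ 0 :=
  mul_ne_zero (by exact_mod_cast h.lam_pos.ne') (Complex.exp_ne_zero _)

theorem isCurve (h : ModelShape α β γ a b d) : (model α β γ a b d).IsCurve :=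
  isCurve_pausedPath h.scale_ne_zero h.left_lt_right

theorem pause_start (h : ModelShape α β γ a b d) :
    pause b (-(elasticaParam (α - γ) + a)) = -elasticaParam (α - γ) := by
  obtain ⟨hnonneg, hle⟩ := elasticaParam_mem_Icc (α - γ)
  rcases h.a_eq with ha | hα
  · rw [ha, add_zero, pause_of_mem_left h.b_nonneg ⟨by linarith, by linarith⟩]
  · rw [hα, elasticaParam_pi, pause_of_le h.b_nonneg (by linarith [h.a_nonneg])]

theorem pause_finish (h : ModelShape α β γ a b d) :
    pause b (b + elasticaParam (β - γ) + d) = elasticaParam (β - γ) := by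
  obtain ⟨hnonneg, hle⟩ := elasticaParam_mem_Icc (β - γ)
  rcases h.d_eq with hd | hβ
  · rw [hd, add_zero, pause_of_mem_right h.b_nonneg ⟨by linarith, by linarith⟩,
      add_sub_cancel_left]
  · rw [hβ, elasticaParam_pi, pause_of_ge h.b_nonneg (by linarith [h.d_nonneg])]

theorem pausedElastica_start (h : ModelShape α β γ a b d) :
    pausedElastica b (-(elasticaParam (α - γ) + a)) = a - elastica (elasticaParam (α - γ)) := by
  obtain ⟨hnonneg, hle⟩ := elasticaParam_mem_Icc (α - γ)
  rcases h.a_eq with ha | hα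
  · rw [ha, add_zero, pausedElastica_left h.b_nonneg ⟨by linarith, by linarith⟩, elastica_neg,
      Complex.ofReal_zero, zero_sub]
  · rw [hα, elasticaParam_pi, pausedElastica_le h.b_nonneg (by linarith [h.a_nonneg]),
      elastica_neg]
    push_cast
    ring

theorem pausedElastica_finish (h : ModelShape α β γ a b d) :
    pausedElastica b (b + elasticaParam (β - γ) + d) =
      b - d + elastica (elasticaParam (β - γ)) := by
  obtain ⟨hnonneg, hle⟩ := elasticaParam_mem_Icc (β - γ)
  rcases h.d_eq with hd | hβ
  · rw [hd, add_zero, pausedElastica_right h.b_nonneg ⟨by linarith, by linarith⟩,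
      add_sub_cancel_left, Complex.ofReal_zero, sub_zero]
  · rw [hβ, elasticaParam_pi, pausedElastica_ge h.b_nonneg (by linarith [h.d_nonneg])]
    push_cast
    ring

theorem model_start (h : ModelShape α β γ a b d) :
    (model α β γ a b d).toFun (model α β γ a b d).a = 0 := by
  simp only [model, pausedPath, h.pausedElastica_start]
  ring

theorem model_finish (h : ModelShape α β γ a b d) :
    (model α β γ a b d).toFun (model α β γ a b d).b = scale α β γ *
      ((b - d + elastica (elasticaParam (β - γ))) - (a - elastica (elasticaParam (α - γ)))) := by
  simp only [model, pausedPath, h.pausedElastica_finish]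
  ring

end ModelShape

theorem elastica_elasticaParam {y : ℝ} (hy : y ∈ Icc 0 π) : elastica (elasticaParam y) =
    (√(Real.sin y) : ℂ) + I * ((1 / 2 * sqrtSinPrim y : ℝ) : ℂ) := by
  rw [elastica, sin_elasticaParam hy, xi_elasticaParam hy]

/-- After rotation by `-γ`, the imaginary part of the displacement is right by the choice of `λ`,
and the real part gives the equation for the lengths of the segments. -/
theorem displacement_eq_one_iff (hpos : 0 < y₁ α γ + y₂ β γ)
    (hα : α - γ ∈ Icc 0 π) (hβ : β - γ ∈ Icc 0 π) :
    scale α β γ * ((b - d + elastica (elasticaParam (β - γ))) -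
      (a - elastica (elasticaParam (α - γ)))) = 1 ↔ lam α β γ * (b - a - d) = sigma α β γ := by
  have him := lam_mul_y₁_add_y₂ hpos
  rw [y₁_eq, y₂_eq] at him
  rw [mul_right_comm, mul_eq_one_iff_eq_inv₀ (Complex.exp_ne_zero _), ← Complex.exp_neg,
    ← neg_mul, ← Complex.ofReal_neg, elastica_elasticaParam hα, elastica_elasticaParam hβ,
    Complex.ext_iff, Complex.exp_ofReal_mul_I_re, Complex.exp_ofReal_mul_I_im, Real.cos_neg,
    Real.sin_neg, sigma_eq]
  simp only [Complex.mul_re, Complex.mul_im, Complex.add_re, Complex.add_im, Complex.sub_re,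
    Complex.sub_im, Complex.ofReal_re, Complex.ofReal_im, Complex.I_re, Complex.I_im]
  exact ⟨fun h => by linarith [h.1], fun h => ⟨by linarith, by linarith⟩⟩

namespace ModelParams

theorem isRightLeft (h : ModelParams α β γ a b d) :
    IsRightLeft (model α β γ a b d) (modelAngle γ b) 0 α β γ where
  curve := h.isCurve
  angle := isDirectionAngle_pausedPath h.lam_pos h.left_lt_right
  mem := ⟨h.left_neg, h.right_nonneg⟩
  anti := ((antitoneOn_elasticaAngle_pause h.b_nonneg).const_add γ).mono Icc_subset_Iic_self
  mono := ((monotoneOn_elasticaAngle_pause b).const_add γ).mono Icc_subset_Ici_self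
  angle_start := by
    change modelAngle γ b (-(elasticaParam (α - γ) + a)) = α
    rw [modelAngle, h.pause_start, elasticaAngle_neg, elasticaAngle_elasticaParam h.sub_mem₁,
      add_sub_cancel]
  angle_mid := by
    rw [modelAngle, pause_of_mem_mid ⟨le_rfl, h.b_nonneg⟩, elasticaAngle_zero, add_zero]
  angle_finish := by
    change modelAngle γ b (b + elasticaParam (β - γ) + d) = β
    rw [modelAngle, h.pause_finish, elasticaAngle_elasticaParam h.sub_mem₂, add_sub_cancel]
  lt := h.lt
  le₁ := h.le₁
  le₂ := h.le₂
  start := h.model_start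
  finish := h.model_finish.trans
    ((displacement_eq_one_iff h.y₁_add_y₂_pos h.sub_mem₁ h.sub_mem₂).2 h.eq)

theorem norm_vel (h : ModelParams α β γ a b d) {x : ℝ}
    (hx : x ∈ Icc (-(elasticaParam (α - γ) + a)) (b + elasticaParam (β - γ) + d)) :
    ‖(model α β γ a b d).vel x‖ = lam α β γ * (√(1 + Real.sin (pause b x) ^ 2))⁻¹ := by
  rw [model, vel_pausedPath h.left_lt_right hx, norm_mul, norm_mul, Complex.norm_exp_ofReal_mul_I,
    mul_one, norm_elasticaVel, Complex.norm_real, Real.norm_of_nonneg h.lam_pos.le]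

theorem energy (h : ModelParams α β γ a b d) :
    (model α β γ a b d).energy = ENNReal.ofReal (G α β γ) := by
  have hlam := h.lam_pos.ne'
  have hderiv : ∀ x, deriv (modelAngle γ b) x =
      2 * Real.sin (pause b x) / √(1 + Real.sin (pause b x) ^ 2) := fun x =>
    ((hasDerivAt_elasticaAngle_pause h.b_nonneg x).const_add γ).deriv
  refine h.isRightLeft.energy_eq (fun t ht => ?_) (fun t ht => ?_)
  · have hpause := pause_mem_of_nonpos h.b_nonneg ht.2.le
    rw [hderiv, h.norm_vel ⟨ht.1.le, ht.2.le.trans h.right_nonneg⟩, modelAngle,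
      add_sub_cancel_left, ← abs_sin_eq,
      abs_of_nonpos (Real.sin_nonpos_of_nonpos_of_neg_pi_le hpause.2 hpause.1)]
    field_simp
  · have hpause := pause_mem_of_nonneg (b := b) ht.1.le
    rw [hderiv, h.norm_vel ⟨h.left_neg.le.trans ht.1.le, ht.2.le⟩, modelAngle,
      add_sub_cancel_left, ← abs_sin_eq, abs_of_nonneg (Real.sin_nonneg_of_mem_Icc hpause)]
    field_simp

end ModelParams

end ModelCurve

/-! ### Curves of minimal energy are elastica with segments inserted -/

theorem hasDerivAt_of_ae_deriv_eq {τ F : ℝ → ℝ} {p q t : ℝ}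
    (hτ : AbsolutelyContinuousOnInterval τ p q) (hF : ContinuousOn F (Icc p q))
    (hderiv : ∀ᵐ t, t ∈ Ioc p q → deriv τ t = F t) (ht : t ∈ Ioo p q) :
    HasDerivAt τ (F t) t := by
  refine ((hasDerivAt_integral_of_continuousOn hF ht).const_add (τ p)).congr_of_eventuallyEq ?_
  filter_upwards [Icc_mem_nhds ht.1 ht.2] with x hx
  have hsub : uIcc p x ⊆ uIcc p q := by
    rw [uIcc_of_le hx.1, uIcc_of_le (hx.1.trans hx.2)]
    exact Icc_subset_Icc_right hx.2
  have hint : ∫ t in p..x, deriv τ t = ∫ t in p..x, F t := by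
    refine intervalIntegral.integral_congr_ae ?_
    filter_upwards [hderiv] with y hy hypx
    rw [uIoc_of_le hx.1] at hypx
    exact hy ⟨hypx.1, hypx.2.trans hx.2⟩
  rw [← hint, (hτ.mono hsub).integral_deriv_eq_sub, add_sub_cancel]

section Truncation

variable {q ψ : ℝ → ℝ} {p m r lo hi : ℝ}

theorem eq_min_of_hasDerivAt (hq : ContinuousOn q (Icc m r)) (hψ : ContinuousOn ψ (Icc m r))
    (hq_mono : MonotoneOn q (Icc m r)) (hψ_mono : MonotoneOn ψ (Icc m r))
    (hhi : ∀ t ∈ Icc m r, q t ≤ hi)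
    (hderiv : ∀ t ∈ Ioo m r, q t < hi → HasDerivAt (fun t => q t - ψ t) 0 t) :
    ∀ t ∈ Icc m r, q t = min (q m + (ψ t - ψ m)) hi := by
  have hunsat : ∀ t ∈ Icc m r, q t < hi → q t = q m + (ψ t - ψ m) := fun t ht hlt => by
    have hsub : Icc m t ⊆ Icc m r := Icc_subset_Icc_right ht.2
    have hconst : q t - ψ t = q m - ψ m :=
      eqOn_of_hasDerivAt_eq (F := fun t => q t - ψ t) (H := fun _ => q m - ψ m) (F' := fun _ => 0)
        ((hq.sub hψ).mono hsub) continuousOn_const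
        (fun x hx => hderiv x ⟨hx.1, hx.2.trans_le ht.2⟩
          ((hq_mono (hsub (Ioo_subset_Icc_self hx)) ht hx.2.le).trans_lt hlt))
        (fun x _ => hasDerivAt_const x _) (left_mem_Icc.2 ht.1) rfl (right_mem_Icc.2 ht.1)
    linarith
  intro t ht
  rcases (hhi t ht).lt_or_eq with hlt | heq
  · rw [← hunsat t ht hlt, min_eq_left hlt.le]
  rw [heq, eq_comm, min_eq_right_iff]
  by_contra! hlt
  obtain ⟨v, hv, hvhi⟩ := exists_between hlt
  have hmt := hψ_mono (left_mem_Icc.2 (ht.1.trans ht.2)) ht ht.1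
  obtain ⟨x, hx, rfl⟩ := intermediate_value_Icc ht.1 (hq.mono (Icc_subset_Icc_right ht.2))
    (show v ∈ Icc (q m) (q t) from ⟨by linarith, heq ▸ hvhi.le⟩)
  have hxr : x ∈ Icc m r := ⟨hx.1, hx.2.trans ht.2⟩
  linarith [hunsat x hxr hvhi, hψ_mono hxr ht hx.2]

theorem eq_max_of_hasDerivAt (hq : ContinuousOn q (Icc p m)) (hψ : ContinuousOn ψ (Icc p m))
    (hq_mono : MonotoneOn q (Icc p m)) (hψ_mono : MonotoneOn ψ (Icc p m))
    (hlo : ∀ t ∈ Icc p m, lo ≤ q t)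
    (hderiv : ∀ t ∈ Ioo p m, lo < q t → HasDerivAt (fun t => q t - ψ t) 0 t) :
    ∀ t ∈ Icc p m, q t = max lo (q m + (ψ t - ψ m)) := by
  have hmaps : MapsTo (fun t : ℝ => -t) (Icc (-m) (-p)) (Icc p m) :=
    fun t ht => ⟨le_neg_of_le_neg ht.2, neg_le.1 ht.1⟩
  have hreflect {F : ℝ → ℝ} (hF : MonotoneOn F (Icc p m)) :
      MonotoneOn (fun t => -F (-t)) (Icc (-m) (-p)) := fun x hx y hy hxy =>
    neg_le_neg (hF (hmaps hy) (hmaps hx) (neg_le_neg hxy))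
  intro t ht
  have hmin := eq_min_of_hasDerivAt (q := fun t => -q (-t)) (ψ := fun t => -ψ (-t)) (hi := -lo)
    (hq.comp continuousOn_neg hmaps).neg (hψ.comp continuousOn_neg hmaps).neg
    (hreflect hq_mono) (hreflect hψ_mono) (fun x hx => neg_le_neg (hlo _ (hmaps hx)))
    (fun x hx hlt => ?_) (-t) ⟨neg_le_neg ht.2, neg_le_neg ht.1⟩
  · simp only [neg_neg] at hmin
    rw [← neg_inj, hmin, ← min_neg_neg, min_comm]
    congr 1
    ring
  · have hx' : HasDerivAt (fun t => q t - ψ t) 0 (-x) :=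
      hderiv (-x) ⟨lt_neg_of_lt_neg hx.2, neg_lt.1 hx.1⟩ (neg_lt_neg_iff.1 hlt)
    refine ((hx'.comp x (hasDerivAt_neg x)).neg.congr_deriv (by ring)).congr_of_eventuallyEq
      (.of_forall fun y => ?_)
    simp only [Function.comp_apply, Pi.neg_apply]
    ring

theorem exists_eq_truncation (hpr : p ≤ r) (hq : ContinuousOn q (Icc p r))
    (hψ : ContinuousOn ψ (Icc p r)) (hq_mono : MonotoneOn q (Icc p r))
    (hψ_mono : MonotoneOn ψ (Icc p r)) (hlt : q p < q r)
    (hlo : ∀ t ∈ Icc p r, lo ≤ q t) (hhi : ∀ t ∈ Icc p r, q t ≤ hi)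
    (hderiv : ∀ t ∈ Ioo p r, lo < q t → q t < hi → HasDerivAt (fun t => q t - ψ t) 0 t) :
    ∃ x₀, ∀ t ∈ Icc p r, q t = max lo (min (ψ t - x₀) hi) := by
  obtain ⟨m, hm, hqm⟩ := intermediate_value_Icc hpr hq
    (show (q p + q r) / 2 ∈ Icc (q p) (q r) by constructor <;> linarith)
  have hlo_m : lo < q m := by linarith [hlo p (left_mem_Icc.2 hpr)]
  have hhi_m : q m < hi := by linarith [hhi r (right_mem_Icc.2 hpr)]
  have hshift : ∀ t, ψ t - (ψ m - q m) = q m + (ψ t - ψ m) := fun t => by ring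
  refine ⟨ψ m - q m, fun t ht => ?_⟩
  rw [hshift]
  rcases le_total m t with hmt | htm
  · have hsub : Icc m r ⊆ Icc p r := Icc_subset_Icc_left hm.1
    rw [← eq_min_of_hasDerivAt (hq.mono hsub) (hψ.mono hsub) (hq_mono.mono hsub)
      (hψ_mono.mono hsub) (fun x hx => hhi x (hsub hx))
      (fun x hx => hderiv x ⟨hm.1.trans_lt hx.1, hx.2⟩
        (hlo_m.trans_le (hq_mono hm (hsub (Ioo_subset_Icc_self hx)) hx.1.le))) t ⟨hmt, ht.2⟩,
      max_eq_right (hlo t ht)]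
  · have hsub : Icc p m ⊆ Icc p r := Icc_subset_Icc_right hm.2
    rw [min_eq_left (by linarith [hψ_mono ht hm htm]),
      ← eq_max_of_hasDerivAt (hq.mono hsub) (hψ.mono hsub) (hq_mono.mono hsub)
      (hψ_mono.mono hsub) (fun x hx => hlo x (hsub hx))
      (fun x hx hlt => hderiv x ⟨hx.1, hx.2.trans_le hm.2⟩ hlt
        ((hq_mono (hsub (Ioo_subset_Icc_self hx)) hm hx.2.le).trans_lt hhi_m)) t ⟨ht.1, htm⟩]

theorem le_of_eq_truncation_of_pos {y : ℝ} (hp : 0 < p) (h : p = max 0 (min y hi)) :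
    p ≤ y ∧ (p = y ∨ p = hi) := by
  have hmin : p = min y hi := by
    rcases max_choice 0 (min y hi) with hzero | hmin
    · exact absurd (h.trans hzero) hp.ne'
    · exact h.trans hmin
  refine ⟨hmin ▸ min_le_left _ _, ?_⟩
  rcases min_choice y hi with hy | hhi
  · exact .inl (hmin.trans hy)
  · exact .inr (hmin.trans hhi)

end Truncation

section MinimalEnergy

variable {f : PlanePath} {τ : ℝ → ℝ} {c α β γ t x₁ x₂ : ℝ}

/-- The rate at which the parameter of the elastica changes along a curve of minimal energy with
direction angle `τ`, wherever it changes. -/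
noncomputable def elasticSpeed (f : PlanePath) (τ : ℝ → ℝ) (α β γ t : ℝ) : ℝ :=
  √(1 + Real.sin (τ t - γ)) * ‖f.vel t‖ / lam α β γ

/-- The parametrisation of `f` in which the parameter of the elastica has speed `1`, wherever it
changes. -/
noncomputable def elasticTime (f : PlanePath) (τ : ℝ → ℝ) (α β γ t : ℝ) : ℝ :=
  ∫ r in f.a..t, elasticSpeed f τ α β γ r

/-- In elastic time, the parameter of the elastica decreases from `π` to `0` up to the time `x₁`
and increases from `0` to `π` from the time `x₂` on; it is truncated at `π`. -/
structure IsElasticTiming (f : PlanePath) (τ : ℝ → ℝ) (c α β γ x₁ x₂ : ℝ) : Prop where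
  left : ∀ t ∈ Icc f.a c,
    elasticaParam (τ t - γ) = max 0 (min (x₁ - elasticTime f τ α β γ t) π)
  right : ∀ t ∈ Icc c f.b,
    elasticaParam (τ t - γ) = max 0 (min (elasticTime f τ α β γ t - x₂) π)
  right_eq : γ = β → x₂ = elasticTime f τ α β γ f.b

@[simp] theorem elasticTime_start : elasticTime f τ α β γ f.a = 0 := by simp [elasticTime]

theorem mem_Ioo_of_elasticaParam {y : ℝ} (hy : y ∈ Icc 0 π) (hpos : 0 < elasticaParam y)
    (hlt : elasticaParam y < π) : y ∈ Ioo 0 π := by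
  refine ⟨lt_of_le_of_ne hy.1 ?_, lt_of_le_of_ne hy.2 ?_⟩
  · rintro rfl
    exact hpos.ne' elasticaParam_zero
  · rintro rfl
    exact hlt.ne elasticaParam_pi

theorem eq_pi_of_elasticaParam_eq_pi {y : ℝ} (hy : 0 ≤ y) (hyπ : y ≤ π)
    (h : elasticaParam y = π) : y = π := by
  by_contra hne
  exact (elasticaParam_lt_pi hy (lt_of_le_of_ne hyπ hne)).ne h

namespace PlanePath.IsRightLeft

theorem Icc_left_subset (h : IsRightLeft f τ c α β γ) : Icc f.a c ⊆ Icc f.a f.b :=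
  Icc_subset_Icc_right h.mem.2

theorem Icc_right_subset (h : IsRightLeft f τ c α β γ) : Icc c f.b ⊆ Icc f.a f.b :=
  Icc_subset_Icc_left h.mem.1.le

theorem continuousOn_angle_sub (h : IsRightLeft f τ c α β γ) :
    ContinuousOn (fun t => τ t - γ) (Icc f.a f.b) :=
  (h.angle.continuousOn h.curve.1.le).sub continuousOn_const

theorem continuousOn_elasticSpeed (h : IsRightLeft f τ c α β γ) :
    ContinuousOn (elasticSpeed f τ α β γ) (Icc f.a f.b) :=
  (((continuous_const.add Real.continuous_sin).comp_continuousOn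
    h.continuousOn_angle_sub).sqrt.mul h.curve.continuousOn_vel.norm).div_const _

theorem elasticSpeed_pos (h : IsRightLeft f τ c α β γ) (ht : t ∈ Icc f.a f.b) :
    0 < elasticSpeed f τ α β γ t := by
  have hsin := h.sin_nonneg ht
  exact div_pos (mul_pos (by positivity) (h.curve.norm_vel_pos ht)) h.lam_pos

theorem hasDerivAt_elasticTime (h : IsRightLeft f τ c α β γ) (ht : t ∈ Ioo f.a f.b) :
    HasDerivAt (elasticTime f τ α β γ) (elasticSpeed f τ α β γ t) t :=
  hasDerivAt_integral_of_continuousOn h.continuousOn_elasticSpeed ht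

theorem continuousOn_elasticTime (h : IsRightLeft f τ c α β γ) :
    ContinuousOn (elasticTime f τ α β γ) (Icc f.a f.b) :=
  continuousOn_integral_of_continuousOn h.curve.1.le h.continuousOn_elasticSpeed

theorem strictMonoOn_elasticTime (h : IsRightLeft f τ c α β γ) :
    StrictMonoOn (elasticTime f τ α β γ) (Icc f.a f.b) := by
  refine strictMonoOn_of_deriv_pos (convex_Icc _ _) h.continuousOn_elasticTime fun t ht => ?_
  rw [interior_Icc] at ht
  rw [(h.hasDerivAt_elasticTime ht).deriv]
  exact h.elasticSpeed_pos (Ioo_subset_Icc_self ht)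

theorem continuousOn_elasticaParam (h : IsRightLeft f τ c α β γ) :
    ContinuousOn (fun t => elasticaParam (τ t - γ)) (Icc f.a f.b) :=
  continuous_elasticaParam.comp_continuousOn h.continuousOn_angle_sub

theorem antitoneOn_elasticaParam (h : IsRightLeft f τ c α β γ) :
    AntitoneOn (fun t => elasticaParam (τ t - γ)) (Icc f.a c) := fun _ hx _ hy hxy =>
  strictMonoOn_elasticaParam.monotoneOn (h.angle_sub_mem (h.Icc_left_subset hy))
    (h.angle_sub_mem (h.Icc_left_subset hx)) (sub_le_sub_right (h.anti hx hy hxy) γ)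

theorem monotoneOn_elasticaParam (h : IsRightLeft f τ c α β γ) :
    MonotoneOn (fun t => elasticaParam (τ t - γ)) (Icc c f.b) := fun _ hx _ hy hxy =>
  strictMonoOn_elasticaParam.monotoneOn (h.angle_sub_mem (h.Icc_right_subset hx))
    (h.angle_sub_mem (h.Icc_right_subset hy)) (sub_le_sub_right (h.mono hx hy hxy) γ)

theorem hasDerivAt_angle (h : IsRightLeft f τ c α β γ) {p q m : ℝ} (hpq : p ≤ q)
    (hsub : Icc p q ⊆ Icc f.a f.b)
    (hderiv : ∀ᵐ t, t ∈ Ioc p q → deriv τ t = m * (√(Real.sin (τ t - γ)) * ‖f.vel t‖))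
    (ht : t ∈ Ioo p q) : HasDerivAt τ (m * (√(Real.sin (τ t - γ)) * ‖f.vel t‖)) t := by
  refine hasDerivAt_of_ae_deriv_eq (F := fun t => m * (√(Real.sin (τ t - γ)) * ‖f.vel t‖))
    (h.angle.1.mono (by rwa [uIcc_of_le hpq, uIcc_of_le h.curve.1.le])) ?_ hderiv ht
  exact (continuousOn_const.mul ((continuous_sqrt_sin.comp_continuousOn
    h.continuousOn_angle_sub).mul h.curve.continuousOn_vel.norm)).mono hsub

theorem hasDerivAt_elasticaParam_angle {ε : ℝ} (hmem : τ t - γ ∈ Ioo 0 π)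
    (hτ : HasDerivAt τ (ε * (2 / lam α β γ) * (√(Real.sin (τ t - γ)) * ‖f.vel t‖)) t) :
    HasDerivAt (fun t => elasticaParam (τ t - γ)) (ε * elasticSpeed f τ α β γ t) t := by
  have hsqrt := (Real.sqrt_pos.2 (Real.sin_pos_of_mem_Ioo hmem)).ne'
  refine ((hasDerivAt_elasticaParam hmem).comp t (hτ.sub_const γ)).congr_deriv ?_
  rw [elasticSpeed]
  field_simp

theorem exists_left_timing (h : IsRightLeft f τ c α β γ)
    (hE : f.energy = ENNReal.ofReal (G α β γ)) :
    ∃ x₁, ∀ t ∈ Icc f.a c,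
      elasticaParam (τ t - γ) = max 0 (min (x₁ - elasticTime f τ α β γ t) π) := by
  have hsub := h.Icc_left_subset
  obtain ⟨x₁, hx₁⟩ := exists_eq_truncation (q := fun t => -elasticaParam (τ t - γ))
    (ψ := elasticTime f τ α β γ) (lo := -π) (hi := 0) h.mem.1.le
    (h.continuousOn_elasticaParam.mono hsub).neg (h.continuousOn_elasticTime.mono hsub)
    h.antitoneOn_elasticaParam.neg (h.strictMonoOn_elasticTime.monotoneOn.mono hsub)
    (by simpa [h.angle_start, h.angle_mid] using elasticaParam_pos (sub_pos.2 h.lt) h.le₁)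
    (fun t _ => neg_le_neg (elasticaParam_mem_Icc _).2)
    (fun t _ => neg_nonpos.2 (elasticaParam_mem_Icc _).1) fun t ht hlo hhi => by
      have ht' : t ∈ Ioo f.a f.b := ⟨ht.1, ht.2.trans_le h.mem.2⟩
      have hτ := h.hasDerivAt_angle h.mem.1.le hsub (h.ae_deriv_eq hE).1 ht
      rw [neg_eq_neg_one_mul] at hτ
      refine ((hasDerivAt_elasticaParam_angle (mem_Ioo_of_elasticaParam
        (h.angle_sub_mem (Ioo_subset_Icc_self ht')) (neg_lt_zero.1 hhi) (neg_lt_neg_iff.1 hlo))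
        hτ).neg.sub (h.hasDerivAt_elasticTime ht')).congr_deriv ?_
      ring
  refine ⟨x₁, fun t ht => ?_⟩
  rw [← neg_inj, hx₁ t ht, ← min_neg_neg, ← max_neg_neg, neg_sub, neg_zero, max_min_distrib_left,
    max_eq_right (neg_nonpos.2 Real.pi_pos.le), min_comm, max_comm (-π)]

theorem exists_right_timing (h : IsRightLeft f τ c α β γ) (hγβ : γ < β)
    (hE : f.energy = ENNReal.ofReal (G α β γ)) :
    ∃ x₂, ∀ t ∈ Icc c f.b,
      elasticaParam (τ t - γ) = max 0 (min (elasticTime f τ α β γ t - x₂) π) := by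
  have hsub := h.Icc_right_subset
  refine exists_eq_truncation h.mem.2 (h.continuousOn_elasticaParam.mono hsub)
    (h.continuousOn_elasticTime.mono hsub) h.monotoneOn_elasticaParam
    (h.strictMonoOn_elasticTime.monotoneOn.mono hsub)
    (by simpa [h.angle_mid, h.angle_finish] using elasticaParam_pos (sub_pos.2 hγβ) h.le₂)
    (fun t _ => (elasticaParam_mem_Icc _).1) (fun t _ => (elasticaParam_mem_Icc _).2)
    fun t ht hlo hhi => ?_
  have ht' : t ∈ Ioo f.a f.b := ⟨h.mem.1.trans ht.1, ht.2⟩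
  have hτ := h.hasDerivAt_angle h.mem.2 hsub (h.ae_deriv_eq hE).2 ht
  rw [← one_mul (2 / lam α β γ)] at hτ
  refine ((hasDerivAt_elasticaParam_angle (mem_Ioo_of_elasticaParam
    (h.angle_sub_mem (Ioo_subset_Icc_self ht')) hlo hhi) hτ).sub
    (h.hasDerivAt_elasticTime ht')).congr_deriv ?_
  ring

theorem exists_isElasticTiming (h : IsRightLeft f τ c α β γ)
    (hcase : γ < β ∨ γ = β ∧ c = f.b) (hE : f.energy = ENNReal.ofReal (G α β γ)) :
    ∃ x₁ x₂, IsElasticTiming f τ c α β γ x₁ x₂ := by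
  obtain ⟨x₁, hleft⟩ := h.exists_left_timing hE
  rcases hcase with hγβ | ⟨-, rfl⟩
  · obtain ⟨x₂, hright⟩ := h.exists_right_timing hγβ hE
    exact ⟨x₁, x₂, hleft, hright, fun heq => absurd heq hγβ.ne⟩
  · refine ⟨x₁, elasticTime f τ α β γ f.b, hleft, fun t ht => ?_, fun _ => rfl⟩
    rw [Icc_self, mem_singleton_iff] at ht
    simp [ht, h.angle_mid, Real.pi_pos.le]

theorem vel_eq_smul (h : IsRightLeft f τ c α β γ) (ht : t ∈ Icc f.a f.b) {y : ℝ}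
    (hy : elasticaAngle y = τ t - γ) : f.vel t =
      elasticSpeed f τ α β γ t • (scale α β γ * elasticaVel y) := by
  have hsin := h.sin_nonneg ht
  have hsqrt : ((√(1 + Real.sin (τ t - γ)) : ℝ) : ℂ) ≠ 0 :=
    mod_cast (Real.sqrt_pos.2 (by linarith)).ne'
  have hlam : (lam α β γ : ℂ) ≠ 0 := mod_cast h.lam_pos.ne'
  have hexp : Complex.exp (τ t * I) =
      Complex.exp (γ * I) * Complex.exp (((τ t - γ : ℝ) : ℂ) * I) := by
    rw [← Complex.exp_add, ← add_mul, ← Complex.ofReal_add, add_sub_cancel]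
  rw [elasticaVel_eq, ← sin_elasticaAngle, hy, Complex.real_smul, elasticSpeed, Complex.ofReal_div,
    Complex.ofReal_mul, Complex.ofReal_inv]
  conv_lhs => rw [h.angle.2 t ht, hexp]
  field_simp

end PlanePath.IsRightLeft

namespace IsElasticTiming

theorem le_elasticTime (ht : IsElasticTiming f τ c α β γ x₁ x₂) (h : IsRightLeft f τ c α β γ) :
    x₁ ≤ elasticTime f τ α β γ c := by
  have hc := ht.left c (right_mem_Icc.2 h.mem.1.le)
  rw [h.angle_mid, sub_self, elasticaParam_zero] at hc
  by_contra! hlt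
  exact hc.not_lt (lt_max_of_lt_right (lt_min (sub_pos.2 hlt) Real.pi_pos))

theorem elasticTime_le (ht : IsElasticTiming f τ c α β γ x₁ x₂) (h : IsRightLeft f τ c α β γ) :
    elasticTime f τ α β γ c ≤ x₂ := by
  have hc := ht.right c (left_mem_Icc.2 h.mem.2)
  rw [h.angle_mid, sub_self, elasticaParam_zero] at hc
  by_contra! hlt
  exact hc.not_lt (lt_max_of_lt_right (lt_min (sub_pos.2 hlt) Real.pi_pos))

theorem elasticaAngle_pause (hx : IsElasticTiming f τ c α β γ x₁ x₂)
    (h : IsRightLeft f τ c α β γ) (ht : t ∈ Icc f.a f.b) :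
    elasticaAngle (pause (x₂ - x₁) (elasticTime f τ α β γ t - x₁)) = τ t - γ := by
  have hc : c ∈ Icc f.a f.b := ⟨h.mem.1.le, h.mem.2⟩
  have hle := hx.le_elasticTime h
  have hge := hx.elasticTime_le h
  have hmono := h.strictMonoOn_elasticTime.monotoneOn
  rcases le_total t c with htc | hct
  · have hbefore := hmono ht hc htc
    have hpause : pause (x₂ - x₁) (elasticTime f τ α β γ t - x₁) =
        -elasticaParam (τ t - γ) := by
      rw [hx.left t ⟨ht.1, htc⟩, pause, max_eq_right (a := _ - (x₂ - x₁)) (by linarith),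
        min_eq_right Real.pi_pos.le, add_zero, max_min_distrib_left,
        max_eq_right (neg_nonpos.2 Real.pi_pos.le), ← min_neg_neg, ← max_neg_neg, neg_sub, neg_zero,
        min_comm, max_comm]
    rw [hpause, elasticaAngle_neg, elasticaAngle_elasticaParam (h.angle_sub_mem ht)]
  · have hafter := hmono hc ht hct
    have hpause : pause (x₂ - x₁) (elasticTime f τ α β γ t - x₁) = elasticaParam (τ t - γ) := by
      rw [hx.right t ⟨hct, ht.2⟩, pause_of_nonneg (by linarith), sub_sub_sub_cancel_right,
        max_min_distrib_left, max_eq_right Real.pi_pos.le, min_comm, max_comm]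
    rw [hpause, elasticaAngle_elasticaParam (h.angle_sub_mem ht)]

theorem modelShape (hx : IsElasticTiming f τ c α β γ x₁ x₂) (h : IsRightLeft f τ c α β γ) :
    ModelShape α β γ (x₁ - elasticaParam (α - γ)) (x₂ - x₁)
      (elasticTime f τ α β γ f.b - x₂ - elasticaParam (β - γ)) := by
  have hstart := hx.left f.a (left_mem_Icc.2 h.mem.1.le)
  have hfinish := hx.right f.b (right_mem_Icc.2 h.mem.2)
  rw [h.angle_start, elasticTime_start, sub_zero] at hstart
  rw [h.angle_finish] at hfinish
  obtain ⟨hle_left, heq_left⟩ :=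
    le_of_eq_truncation_of_pos (elasticaParam_pos (sub_pos.2 h.lt) h.le₁) hstart
  have hright : 0 ≤ elasticTime f τ α β γ f.b - x₂ - elasticaParam (β - γ) ∧
      (elasticTime f τ α β γ f.b - x₂ - elasticaParam (β - γ) = 0 ∨ β - γ = π) := by
    rcases h.le.lt_or_eq with hlt | rfl
    · obtain ⟨hle, heq⟩ :=
        le_of_eq_truncation_of_pos (elasticaParam_pos (sub_pos.2 hlt) h.le₂) hfinish
      exact ⟨sub_nonneg.2 hle, heq.imp (fun heq => sub_eq_zero.2 heq.symm)
        (eq_pi_of_elasticaParam_eq_pi (sub_nonneg.2 h.le) h.le₂)⟩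
    · simp [hx.right_eq rfl]
  exact ⟨h.lt, h.le₁, h.le, h.le₂, neg_pos.1 h.neg_sin_pos, sub_nonneg.2 hle_left,
    heq_left.imp (fun heq => sub_eq_zero.2 heq.symm)
      (eq_pi_of_elasticaParam_eq_pi (sub_nonneg.2 h.lt.le) h.le₁),
    sub_nonneg.2 ((hx.le_elasticTime h).trans (hx.elasticTime_le h)), hright.1, hright.2⟩

theorem eqOn_model (hx : IsElasticTiming f τ c α β γ x₁ x₂) (h : IsRightLeft f τ c α β γ) :
    EqOn f.toFun (fun t => (model α β γ (x₁ - elasticaParam (α - γ)) (x₂ - x₁)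
      (elasticTime f τ α β γ f.b - x₂ - elasticaParam (β - γ))).toFun
        (elasticTime f τ α β γ t - x₁)) (Icc f.a f.b) := by
  refine eqOn_of_hasDerivAt_eq (F' := f.vel) h.curve.continuousOn_toFun ?_
    (fun t ht => h.curve.hasDerivAt ht) (fun t ht => ?_) (left_mem_Icc.2 h.curve.1.le) ?_
  · refine Continuous.comp_continuousOn ?_ (h.continuousOn_elasticTime.sub continuousOn_const)
    exact continuous_iff_continuousAt.2 fun x => (hasDerivAt_pausedPath _ _ _ _ _ x).continuousAt
  · have ht' := Ioo_subset_Icc_self ht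
    rw [h.vel_eq_smul ht' (hx.elasticaAngle_pause h ht')]
    exact (hasDerivAt_pausedPath _ _ _ _ _ _).scomp t ((h.hasDerivAt_elasticTime ht).sub_const x₁)
  · rw [h.start, elasticTime_start, ← (hx.modelShape h).model_start]
    congr 1
    change -(elasticaParam (α - γ) + (x₁ - elasticaParam (α - γ))) = _
    ring

end IsElasticTiming

theorem ModelParams.of_model_finish {a b d : ℝ} (h : ModelShape α β γ a b d)
    (hfinish : (model α β γ a b d).toFun (model α β γ a b d).b = 1) : ModelParams α β γ a b d :=
  ⟨h, (displacement_eq_one_iff h.y₁_add_y₂_pos h.sub_mem₁ h.sub_mem₂).1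
    (h.model_finish.symm.trans hfinish)⟩

theorem PlanePath.IsRightLeft.exists_equiv_model (h : IsRightLeft f τ c α β γ)
    (hcase : γ < β ∨ γ = β ∧ c = f.b) (hE : f.energy = ENNReal.ofReal (G α β γ)) :
    ∃ a b d, ModelParams α β γ a b d ∧ f.Equiv (model α β γ a b d) := by
  obtain ⟨x₁, x₂, hx⟩ := h.exists_isElasticTiming hcase hE
  have hshape := hx.modelShape h
  have heq := hx.eqOn_model h
  set ψ := elasticTime f τ α β γ with hψ
  have hψa : ψ f.a - x₁ = -(elasticaParam (α - γ) + (x₁ - elasticaParam (α - γ))) := by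
    rw [hψ, elasticTime_start]
    ring
  have hψb : ψ f.b - x₁ =
      x₂ - x₁ + elasticaParam (β - γ) + (ψ f.b - x₂ - elasticaParam (β - γ)) := by
    ring
  have hparams := ModelParams.of_model_finish hshape (by
    rw [← h.finish, heq (right_mem_Icc.2 h.curve.1.le)]
    exact congrArg _ hψb.symm)
  exact ⟨_, _, _, hparams, Equiv.of_reparam h.curve hparams.isCurve
    (h.continuousOn_elasticTime.sub continuousOn_const)
    (fun t ht => (h.hasDerivAt_elasticTime ht).sub_const x₁)
    (fun x hx y hy hxy => sub_lt_sub_right (h.strictMonoOn_elasticTime hx hy hxy) x₁)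
    hψa hψb heq⟩

end MinimalEnergy

/-! ### Pieces of elastica with line segments inserted -/

section Pieces

variable {z μ e : ℂ} {x a b d t A B C : ℝ}

theorem PlanePath.Equiv.refl_of_isCurve {f : PlanePath} (hf : f.IsCurve) : f.Equiv f :=
  Equiv.of_eqOn hf hf rfl rfl fun _ _ => rfl

theorem pausedElastica_add (hb : 0 ≤ b) (ha : 0 ≤ a) (hx : 0 ≤ x) :
    pausedElastica (b + a) (x + a) = pausedElastica b x + a := by
  refine eqOn_of_hasDerivAt_eq (F := fun x => pausedElastica (b + a) (x + a))
    (H := fun x => pausedElastica b x + a)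
    (fun t _ => ((hasDerivAt_pausedElastica (b + a) (t + a)).comp_add_const
      t a).continuousAt.continuousWithinAt)
    (fun t _ => ((hasDerivAt_pausedElastica b t).add_const
      (a : ℂ)).continuousAt.continuousWithinAt)
    (fun t ht => ?_) (fun t _ => (hasDerivAt_pausedElastica b t).add_const (a : ℂ))
    (left_mem_Icc.2 hx) ?_ (right_mem_Icc.2 hx)
  · have hpause : pause (b + a) (t + a) = pause b t := by
      rw [pause_of_nonneg (by linarith [ht.1]), pause_of_nonneg ht.1.le, add_sub_add_right_eq_sub]
    exact hpause ▸ (hasDerivAt_pausedElastica (b + a) (t + a)).comp_add_const t a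
  · simp only [zero_add, pausedElastica_zero]
    exact pausedElastica_mid ⟨ha, by linarith⟩

theorem pausedElastica_add_of_le (hb : 0 ≤ b) (ha : 0 ≤ a) (hx : x ≤ b) :
    pausedElastica (b + a) x = pausedElastica b x := by
  rcases le_total 0 x with hnonneg | hnonpos
  · rw [pausedElastica_mid ⟨hnonneg, hx⟩, pausedElastica_mid ⟨hnonneg, by linarith⟩]
  · rcases le_total (-π) x with hleft | hleft
    · rw [pausedElastica_left hb ⟨hleft, hnonpos⟩,
        pausedElastica_left (by linarith) ⟨hleft, hnonpos⟩]
    · rw [pausedElastica_le hb hleft, pausedElastica_le (by linarith) hleft]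

theorem pausedElastica_zero_left (hx : x ∈ Icc (-π) π) : pausedElastica 0 x = elastica x := by
  rcases le_total x 0 with hnonpos | hnonneg
  · exact pausedElastica_left le_rfl ⟨hx.1, hnonpos⟩
  · rw [pausedElastica_right le_rfl ⟨hnonneg, by linarith [hx.2]⟩, Complex.ofReal_zero, zero_add,
      sub_zero]

theorem map_mul_add_pausedPath (c₁ c₂ : ℂ) :
    (pausedPath z μ b A B).map (fun w => c₁ * w + c₂) =
      pausedPath (c₁ * z + c₂) (c₁ * μ) b A B := by
  simp only [map, pausedPath, PlanePath.mk.injEq, true_and]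
  funext t
  ring

theorem map_add_pausedPath (c : ℂ) :
    (pausedPath z μ b A B).map (fun w => w + c) = pausedPath (z + c) μ b A B := by
  simpa only [one_mul] using map_mul_add_pausedPath (z := z) (μ := μ) (b := b) (A := A) (B := B) 1 c

section Equivalences

theorem pausedPath_add_equiv (hμ : μ ≠ 0) (hb : 0 ≤ b) (ha : 0 ≤ a) (hA : 0 ≤ A) (hAB : A < B) :
    (pausedPath z μ (b + a) (A + a) (B + a)).Equiv (pausedPath (z + μ * a) μ b A B) :=
  (Equiv.of_shift (isCurve_pausedPath hμ hAB)
    (isCurve_pausedPath hμ (add_lt_add_of_lt_of_le hAB le_rfl)) rfl rfl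
    fun t ht => by
      simp only [pausedPath, pausedElastica_add hb ha (hA.trans ht.1)]
      ring).symm

theorem pausedPath_add_equiv_of_le (hμ : μ ≠ 0) (hb : 0 ≤ b) (ha : 0 ≤ a) (hAB : A < B)
    (hB : B ≤ b) : (pausedPath z μ (b + a) A B).Equiv (pausedPath z μ b A B) :=
  Equiv.of_eqOn (isCurve_pausedPath hμ hAB) (isCurve_pausedPath hμ hAB) rfl rfl fun t ht => by
    simp only [pausedPath, pausedElastica_add_of_le hb ha (ht.2.trans hB)]

theorem pausedPath_left_equiv (hμ : μ ≠ 0) (hb : 0 ≤ b) (ht : t ∈ Ioc 0 π) :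
    (pausedPath z μ b (-t) 0).Equiv ((elasticaSeg (-t) 0).map fun w => μ * w + z) := by
  have hneg : -t < 0 := by linarith [ht.1]
  refine Equiv.of_eqOn (isCurve_pausedPath hμ hneg)
    ((isCurve_elasticaSeg hneg).map_mul_add hμ z) rfl rfl fun x hx => ?_
  simp only [pausedPath, map, elasticaSeg,
    pausedElastica_left hb ⟨(neg_le_neg ht.2).trans hx.1, hx.2⟩, add_comm]

theorem pausedPath_right_equiv (hμ : μ ≠ 0) (hb : 0 ≤ b) (ht : t ∈ Ioc 0 π) :
    (pausedPath z μ b b (b + t)).Equiv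
      ((elasticaSeg 0 t).map fun w => μ * w + (z + μ * b)) := by
  refine Equiv.of_shift (r := -b) (isCurve_pausedPath hμ (by linarith [ht.1]))
    ((isCurve_elasticaSeg ht.1).map_mul_add hμ _) (add_neg_cancel b) (add_neg_cancel_comm b t)
    fun x hx => ?_
  have hx_right : x ∈ Icc b (b + π) := ⟨hx.1, hx.2.trans (add_le_add le_rfl ht.2)⟩
  simp only [pausedPath, map, elasticaSeg, pausedElastica_right hb hx_right, sub_eq_add_neg]
  ring

theorem pausedPath_equiv_lineSeg (hAB : A ≤ B)
    (h : ∀ x ∈ Icc A B, pausedElastica b x = pausedElastica b A + ((x - A : ℝ) : ℂ) * e) :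
    (pausedPath z μ b A B).Equiv
      (lineSeg (z + μ * pausedElastica b A) (z + μ * pausedElastica b B)) := by
  have haffine : ∀ x ∈ Icc A B, z + μ * pausedElastica b x =
      z + μ * pausedElastica b A + ((x - A : ℝ) : ℂ) * (μ * e) := fun x hx => by
    rw [h x hx]
    ring
  exact Equiv.lineSeg_of_affine hAB haffine (haffine B (right_mem_Icc.2 hAB))

theorem pausedPath_equiv_lineSeg_left (hb : 0 ≤ b) (hAB : A ≤ B) (hB : B ≤ -π) :
    (pausedPath z μ b A B).Equiv
      (lineSeg (z + μ * pausedElastica b A) (z + μ * pausedElastica b B)) :=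
  pausedPath_equiv_lineSeg (e := -1) hAB fun x hx => by
    rw [pausedElastica_le hb (hx.2.trans hB), pausedElastica_le hb (hAB.trans hB)]
    push_cast
    ring

theorem pausedPath_equiv_lineSeg_mid (hA : 0 ≤ A) (hAB : A ≤ B) (hB : B ≤ b) :
    (pausedPath z μ b A B).Equiv
      (lineSeg (z + μ * pausedElastica b A) (z + μ * pausedElastica b B)) :=
  pausedPath_equiv_lineSeg (e := 1) hAB fun x hx => by
    rw [pausedElastica_mid ⟨hA.trans hx.1, hx.2.trans hB⟩, pausedElastica_mid ⟨hA, hAB.trans hB⟩]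
    push_cast
    ring

theorem pausedPath_equiv_lineSeg_right (hb : 0 ≤ b) (hA : b + π ≤ A) (hAB : A ≤ B) :
    (pausedPath z μ b A B).Equiv
      (lineSeg (z + μ * pausedElastica b A) (z + μ * pausedElastica b B)) :=
  pausedPath_equiv_lineSeg (e := -1) hAB fun x hx => by
    rw [pausedElastica_ge hb (hA.trans hx.1), pausedElastica_ge hb hA]
    push_cast
    ring

end Equivalences

section Turning

theorem isDirectionAngle_pausedPath_arg (hμ : μ ≠ 0) (hAB : A < B) :
    (pausedPath z μ b A B).IsDirectionAngle
      fun x => Complex.arg μ + elasticaAngle (pause b x) := by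
  simpa only [Complex.norm_mul_exp_arg_mul_I] using
    isDirectionAngle_pausedPath (z := z) (b := b) (γ := Complex.arg μ) (norm_pos_iff.2 hμ) hAB

theorem norm_mul_dir_pausedPath (hμ : μ ≠ 0) (hAB : A < B) (hx : x ∈ Icc A B) :
    (‖μ‖ : ℂ) * (pausedPath z μ b A B).dir x =
      μ * Complex.exp (elasticaAngle (pause b x) * I) := by
  rw [(isDirectionAngle_pausedPath_arg hμ hAB).dir_eq (isCurve_pausedPath hμ hAB) hx,
    Complex.ofReal_add, add_mul, Complex.exp_add, ← mul_assoc, Complex.norm_mul_exp_arg_mul_I]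

theorem turning_pausedPath (hμ : μ ≠ 0) (hAB : A < B) : (pausedPath z μ b A B).turning =
    elasticaAngle (pause b B) - elasticaAngle (pause b A) :=
  ((isDirectionAngle_pausedPath_arg hμ hAB).turning_eq (isCurve_pausedPath hμ hAB)).trans
    (add_sub_add_left_eq_sub _ _ _)

theorem pause_zero (hb : 0 ≤ b) : pause b 0 = 0 := pause_of_mem_mid ⟨le_rfl, hb⟩

theorem pause_self (hb : 0 ≤ b) : pause b b = 0 := pause_of_mem_mid ⟨hb, le_rfl⟩

theorem isRightCCurve_pausedPath (hμ : μ ≠ 0) (hb : 0 ≤ b) (hA : A < 0) :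
    (pausedPath z μ b A 0).IsRightCCurve := by
  refine ((isDirectionAngle_pausedPath_arg hμ hA).isRightCCurve_iff (isCurve_pausedPath hμ hA)).2
    ⟨((antitoneOn_elasticaAngle_pause hb).const_add _).mono Icc_subset_Iic_self, ?_⟩
  simp only [pausedPath, pause_zero hb, elasticaAngle_zero, add_zero, add_sub_cancel_left]
  exact elasticaAngle_le_pi _

theorem isLeftCCurve_pausedPath (hμ : μ ≠ 0) (hb : 0 ≤ b) (hB : b < B) :
    (pausedPath z μ b b B).IsLeftCCurve := by
  refine ((isDirectionAngle_pausedPath_arg hμ hB).isLeftCCurve_iff (isCurve_pausedPath hμ hB)).2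
    ⟨((monotoneOn_elasticaAngle_pause b).const_add _).mono
      fun x hx => hb.trans hx.1, ?_⟩
  simp only [pausedPath, pause_self hb, elasticaAngle_zero, add_zero, add_sub_cancel_left]
  exact elasticaAngle_le_pi _

theorem abs_turning_pausedPath_left (hμ : μ ≠ 0) (hb : 0 ≤ b) (ht : t ∈ Ioc 0 π) :
    |(pausedPath z μ b (-t) 0).turning| = elasticaAngle t := by
  rw [turning_pausedPath hμ (neg_lt_zero.2 ht.1), pause_zero hb,
    pause_of_mem_left hb ⟨neg_le_neg ht.2, neg_nonpos.2 ht.1.le⟩, elasticaAngle_neg,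
    elasticaAngle_zero, zero_sub, abs_neg, abs_of_nonneg (elasticaAngle_nonneg t)]

theorem abs_turning_pausedPath_right (hμ : μ ≠ 0) (hb : 0 ≤ b) (ht : t ∈ Ioc 0 π) :
    |(pausedPath z μ b b (b + t)).turning| = elasticaAngle t := by
  rw [turning_pausedPath hμ (lt_add_of_pos_right b ht.1), pause_self hb,
    pause_of_mem_right hb ⟨le_add_of_nonneg_right ht.1.le, add_le_add le_rfl ht.2⟩,
    add_sub_cancel_left, elasticaAngle_zero, sub_zero,
    abs_of_nonneg (elasticaAngle_nonneg t)]

end Turning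

section Forms

theorem similar_pausedPath_left (hμ : μ ≠ 0) (hb : 0 ≤ b) (ht : t ∈ Ioc 0 π) :
    (pausedPath z μ b (-t) 0).Similar (elasticaSeg (π - t) π) := by
  refine ⟨-μ, z - μ * (I * xi π), neg_ne_zero.2 hμ, Or.inr ?_⟩
  refine Equiv.of_shift (r := π) (isCurve_pausedPath hμ (neg_lt_zero.2 ht.1))
    ((isCurve_elasticaSeg (sub_lt_self π ht.1)).map_conj_mul_add (neg_ne_zero.2 hμ) _)
    (neg_add_eq_sub t π) (zero_add π) fun x hx => ?_
  have hreflect := elastica_sub_pi (x + π)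
  rw [add_sub_cancel_right] at hreflect
  simp only [pausedPath, map, elasticaSeg,
    pausedElastica_left hb ⟨(neg_le_neg ht.2).trans hx.1, hx.2⟩, hreflect]
  ring

theorem similar_pausedPath_right (hμ : μ ≠ 0) (hb : 0 ≤ b) (ht : t ∈ Ioc 0 π) :
    (pausedPath z μ b b (b + t)).Similar (elasticaSeg 0 t) :=
  ⟨μ, z + μ * b, hμ, Or.inl (pausedPath_right_equiv hμ hb ht)⟩

theorem isOptimalRight_pausedPath (hμ : μ ≠ 0) (hb : 0 ≤ b) (ht : t ∈ Ioc 0 π) :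
    IsOptimalRight ((pausedPath z μ b (-t) 0).tangentAt (-t))
      ((pausedPath z μ b (-t) 0).tangentLineAt 0) (pausedPath z μ b (-t) 0) := by
  refine ⟨⟨isRightCCurve_pausedPath hμ hb (neg_lt_zero.2 ht.1), rfl, rfl⟩, π - t,
    ⟨sub_nonneg.2 ht.2, sub_lt_self π ht.1⟩, ?_, similar_pausedPath_left hμ hb ht⟩
  rw [abs_turning_pausedPath_left hμ hb ht, turning_elasticaSeg (sub_lt_self π ht.1),
    elasticaAngle_pi_sub, elasticaAngle_pi, sub_sub_cancel]

theorem isOptimalLeft_pausedPath (hμ : μ ≠ 0) (hb : 0 ≤ b) (ht : t ∈ Ioc 0 π) :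
    IsOptimalLeft ((pausedPath z μ b b (b + t)).tangentLineAt b)
      ((pausedPath z μ b b (b + t)).tangentAt (b + t)) (pausedPath z μ b b (b + t)) := by
  refine ⟨⟨isLeftCCurve_pausedPath hμ hb (lt_add_of_pos_right b ht.1), rfl, rfl⟩, t, ht, ?_,
    similar_pausedPath_right hμ hb ht⟩
  rw [abs_turning_pausedPath_right hμ hb ht, turning_elasticaSeg ht.1, elasticaAngle_zero,
    sub_zero]

theorem hasPieces_pausedPath_nil : (pausedPath z μ b A A).HasPieces [] := rfl

theorem hasPieces_pausedPath_cons {f : PlanePath} {fs : List PlanePath} (hAB : A ≤ B)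
    (hBC : B ≤ C) (hf : (pausedPath z μ b A B).Equiv f)
    (hfs : (pausedPath z μ b B C).HasPieces fs) : (pausedPath z μ b A C).HasPieces (f :: fs) :=
  ⟨B, ⟨hAB, hBC⟩, hf, hfs⟩

theorem isJoin_pausedPath {r l : PlanePath} (hμ : μ ≠ 0) (hb : 0 ≤ b) (hA : A < 0) (hB : b < B)
    (hr : (pausedPath z μ b A 0).Equiv r) (hl : (pausedPath z μ b b B).Equiv l) :
    (pausedPath z μ b A B).IsJoin
      [r, lineSeg (z + μ * pausedElastica b 0) (z + μ * pausedElastica b b), l] :=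
  ⟨isCurve_pausedPath hμ (hA.trans_le (hb.trans hB.le)),
    hasPieces_pausedPath_cons hA.le (hb.trans hB.le) hr <|
    hasPieces_pausedPath_cons hb hB.le (pausedPath_equiv_lineSeg_mid le_rfl hb le_rfl) <|
    hasPieces_pausedPath_cons hB.le le_rfl hl hasPieces_pausedPath_nil⟩

theorem isJoin_pausedPath_zero (hμ : μ ≠ 0) (hA : A < 0) (hB : 0 < B) :
    (pausedPath z μ 0 A B).IsJoin [pausedPath z μ 0 A 0, pausedPath z μ 0 0 B] :=
  ⟨isCurve_pausedPath hμ (hA.trans hB),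
    hasPieces_pausedPath_cons hA.le hB.le (.refl_of_isCurve (isCurve_pausedPath hμ hA)) <|
    hasPieces_pausedPath_cons hB.le le_rfl (.refl_of_isCurve (isCurve_pausedPath hμ hB))
      hasPieces_pausedPath_nil⟩

theorem isFirstForm_pausedPath (hμ : μ ≠ 0) (hA : -π < A) (hAB : A < B) (hB : B < π) :
    IsFirstForm A B (pausedPath z μ 0 A B) := by
  refine ⟨hA, hAB, hB, μ, z, hμ, Equiv.of_eqOn (isCurve_pausedPath hμ hAB)
    ((isCurve_elasticaSeg hAB).map_mul_add hμ z) rfl rfl fun x hx => ?_⟩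
  simp only [pausedPath, map, elasticaSeg,
    pausedElastica_zero_left ⟨hA.le.trans hx.1, hx.2.trans hB.le⟩, add_comm]

theorem isSecondForm_pausedPath (hμ : μ ≠ 0) (hb : 0 ≤ b) (ht : t ∈ Ioc 0 π) :
    IsSecondForm b t (pausedPath z μ b (-π) (b + t)) := by
  have hπ : -π < 0 := neg_lt_zero.2 Real.pi_pos
  have hbt : b < b + t := lt_add_of_pos_right b ht.1
  have hleft := pausedPath_left_equiv (z := 0) one_ne_zero hb (right_mem_Ioc.2 Real.pi_pos)
  have hright := pausedPath_right_equiv (z := 0) one_ne_zero hb ht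
  have hjoin := isJoin_pausedPath (z := 0) one_ne_zero hb hπ hbt hleft hright
  simp only [one_mul, add_zero, pausedElastica_zero, pausedElastica_mid ⟨hb, le_refl b⟩,
    add_comm _ (b : ℂ)] at hjoin
  refine ⟨hb, Ioc_subset_Icc_self ht, _, hjoin, μ, z, hμ, ?_⟩
  rw [map_mul_add_pausedPath, mul_zero, mul_one, zero_add]
  exact .refl_of_isCurve (isCurve_pausedPath hμ (by linarith))

end Forms

section Elongation

theorem isUTurn_pausedPath_left (hμ : μ ≠ 0) (hb : 0 ≤ b) : (pausedPath z μ b (-π) 0).IsUTurn := by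
  refine ⟨Or.inr (isRightCCurve_pausedPath hμ hb (neg_lt_zero.2 Real.pi_pos)), ?_⟩
  rw [abs_turning_pausedPath_left hμ hb (right_mem_Ioc.2 Real.pi_pos), elasticaAngle_pi]

theorem isUTurn_pausedPath_right (hμ : μ ≠ 0) (hb : 0 ≤ b) :
    (pausedPath z μ b b (b + π)).IsUTurn := by
  refine ⟨Or.inl (isLeftCCurve_pausedPath hμ hb (lt_add_of_pos_right b Real.pi_pos)), ?_⟩
  rw [abs_turning_pausedPath_right hμ hb (right_mem_Ioc.2 Real.pi_pos), elasticaAngle_pi]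

theorem mul_dir_pausedPath_neg_pi (hμ : μ ≠ 0) (hb : 0 ≤ b) (hB : 0 < B) :
    ((‖μ‖ * a : ℝ) : ℂ) * (pausedPath z μ b (-π) B).dir (-π) = -(μ * a) := by
  have hlt : -π < B := (neg_lt_zero.2 Real.pi_pos).trans hB
  rw [Complex.ofReal_mul, mul_right_comm, norm_mul_dir_pausedPath hμ hlt (left_mem_Icc.2 hlt.le),
    pause_of_le hb le_rfl, elasticaAngle_neg, elasticaAngle_pi, Complex.exp_pi_mul_I]
  ring

theorem mul_dir_pausedPath_self (hμ : μ ≠ 0) (hb : 0 ≤ b) (hA : A < b) (hB : b < B) :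
    ((‖μ‖ * d : ℝ) : ℂ) * (pausedPath z μ b A B).dir b = μ * d := by
  rw [Complex.ofReal_mul, mul_right_comm, norm_mul_dir_pausedPath hμ (hA.trans hB) ⟨hA.le, hB.le⟩,
    pause_self hb, elasticaAngle_zero, Complex.ofReal_zero, zero_mul, Complex.exp_zero, mul_one]

/-- The direction at `-π` is opposite to the one at `0`, so the first inserted segment runs
backwards. -/
theorem isElongation_left (hμ : μ ≠ 0) (hb : 0 ≤ b) (ha : 0 < a) (hB : 0 < B) :
    (pausedPath z μ b (-π) B).IsElongation
      (pausedPath (z - μ * a) μ (b + a) (-(π + a)) (B + a)) := by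
  have hπ : -π < 0 := neg_lt_zero.2 Real.pi_pos
  refine ⟨-π, 0, ‖μ‖ * a, le_rfl, hπ, hB.le, mul_pos (norm_pos_iff.2 hμ) ha,
    isUTurn_pausedPath_left hμ hb, ?_⟩
  rw [mul_dir_pausedPath_neg_pi hμ hb hB]
  refine ⟨isCurve_pausedPath hμ (by linarith),
    hasPieces_pausedPath_cons le_rfl (by linarith) ?point <|
    hasPieces_pausedPath_cons (by linarith) (by linarith) ?first_segment <|
    hasPieces_pausedPath_cons hπ.le (by linarith) ?uTurn <|
    hasPieces_pausedPath_cons ha.le (by linarith) ?second_segment <|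
    hasPieces_pausedPath_cons (by linarith) le_rfl ?rest hasPieces_pausedPath_nil⟩
  case point =>
    refine Equiv.of_point rfl rfl ?_
    simp only [PlanePath.restrict, pausedPath, pausedElastica_le (add_nonneg hb ha.le)
      (show -(π + a) ≤ -π by linarith), pausedElastica_le hb le_rfl]
    push_cast
    ring
  case first_segment =>
    convert pausedPath_equiv_lineSeg_left (z := z - μ * a) (μ := μ) (add_nonneg hb ha.le)
      (show -(π + a) ≤ -π by linarith) le_rfl using 2
    · simp only [pausedPath, pausedElastica_le (add_nonneg hb ha.le)
        (show -(π + a) ≤ -π by linarith), pausedElastica_le hb le_rfl]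
      push_cast
      ring
    · simp only [pausedPath, pausedElastica_le (add_nonneg hb ha.le) le_rfl,
        pausedElastica_le hb le_rfl]
      ring
  case uTurn =>
    have h := pausedPath_add_equiv_of_le (z := z - μ * a) hμ hb ha.le hπ hb
    rwa [sub_eq_add_neg, ← map_add_pausedPath (b := b), ← sub_eq_add_neg] at h
  case second_segment =>
    convert pausedPath_equiv_lineSeg_mid (z := z - μ * a) (μ := μ) le_rfl ha.le
      (le_add_of_nonneg_left hb) using 2
    · simp only [pausedPath, pausedElastica_zero]
      ring
    · simp only [pausedPath, pausedElastica_zero,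
        pausedElastica_mid ⟨ha.le, le_add_of_nonneg_left hb⟩]
      ring
  case rest =>
    have h := pausedPath_add_equiv (z := z - μ * a) hμ hb ha.le le_rfl hB
    rwa [zero_add, sub_add_cancel] at h

theorem isElongation_right (hμ : μ ≠ 0) (hb : 0 ≤ b) (hd : 0 < d) (hA : A < b) :
    (pausedPath z μ b A (b + π)).IsElongation
      (pausedPath z μ (b + d) A (b + d + π + d)) := by
  have hπ := Real.pi_pos
  refine ⟨b, b + π, ‖μ‖ * d, hA.le, by linarith, le_rfl, mul_pos (norm_pos_iff.2 hμ) hd,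
    isUTurn_pausedPath_right hμ hb, ?_⟩
  rw [mul_dir_pausedPath_self hμ hb hA (lt_add_of_pos_right b hπ)]
  refine ⟨isCurve_pausedPath hμ (by linarith),
    hasPieces_pausedPath_cons hA.le (by linarith) ?rest <|
    hasPieces_pausedPath_cons (B := b + d) (by linarith) (by linarith) ?first_segment <|
    hasPieces_pausedPath_cons (B := b + d + π) (by linarith) (by linarith) ?uTurn <|
    hasPieces_pausedPath_cons (by linarith) le_rfl ?second_segment <|
    hasPieces_pausedPath_cons le_rfl le_rfl ?point hasPieces_pausedPath_nil⟩
  case rest => exact pausedPath_add_equiv_of_le hμ hb hd.le hA le_rfl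
  case first_segment =>
    convert pausedPath_equiv_lineSeg_mid (z := z) (μ := μ) hb (le_add_of_nonneg_right hd.le)
      (le_refl (b + d)) using 2
    · simp only [pausedPath, pausedElastica_mid ⟨hb, le_rfl⟩,
        pausedElastica_mid ⟨hb, le_add_of_nonneg_right hd.le⟩]
    · simp only [pausedPath, pausedElastica_mid ⟨hb, le_rfl⟩,
        pausedElastica_mid ⟨add_nonneg hb hd.le, le_rfl⟩]
      push_cast
      ring
  case uTurn =>
    have h := pausedPath_add_equiv (z := z) hμ hb hd.le hb (show b < b + π by linarith)
    rwa [← map_add_pausedPath, add_right_comm] at h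
  case second_segment =>
    convert pausedPath_equiv_lineSeg_right (z := z) (μ := μ) (add_nonneg hb hd.le) le_rfl
      (le_add_of_nonneg_right hd.le) using 2
    · simp only [pausedPath, pausedElastica_ge hb le_rfl,
        pausedElastica_ge (add_nonneg hb hd.le) le_rfl]
      push_cast
      ring
    · simp only [pausedPath, pausedElastica_ge hb le_rfl,
        pausedElastica_ge (add_nonneg hb hd.le) (show b + d + π ≤ b + d + π + d by linarith)]
      push_cast
      ring
  case point =>
    refine Equiv.of_point rfl rfl ?_
    simp only [PlanePath.restrict, pausedPath, pausedElastica_ge hb le_rfl,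
      pausedElastica_ge (add_nonneg hb hd.le) (show b + d + π ≤ b + d + π + d by linarith)]
    push_cast
    ring

end Elongation

end Pieces

section MinimalModel

variable {f : PlanePath} {τ : ℝ → ℝ} {c t α β γ a b b' d : ℝ}

/-! ### The minimal curves in `s_γ(u, v)` -/

namespace PlanePath

namespace IsRightLeft

theorem connects (h : IsRightLeft f τ c α β γ) : f.Connects (uVec α) (vVec β) := by
  constructor
  · rw [tangentAt, h.start, h.angle.dir_eq h.curve (left_mem_Icc.2 h.curve.1.le), h.angle_start,
      uVec]
  · rw [tangentAt, h.finish, h.angle.dir_eq h.curve (right_mem_Icc.2 h.curve.1.le),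
      h.angle_finish, vVec]

theorem splitsRightLeft (h : IsRightLeft f τ c α β γ) (hlt : γ < β) : f.SplitsRightLeft c := by
  have hcb : c ≠ f.b := fun hcb => hlt.ne (by rw [← h.angle_mid, hcb, h.angle_finish])
  rw [h.angle.splitsRightLeft_iff h.curve, h.angle_start, h.angle_mid, h.angle_finish]
  exact ⟨⟨h.mem.1, h.mem.2.lt_of_ne hcb⟩, ⟨h.anti, h.le₁⟩, h.mono, h.le₂⟩

theorem not_isCCurve (h : IsRightLeft f τ c α β γ) (hlt : γ < β) : ¬ f.IsCCurve := by
  have hc : c ∈ Icc f.a f.b := Ioc_subset_Icc_self h.mem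
  rintro (hleft | hright)
  · have hmono := ((h.angle.isLeftCCurve_iff h.curve).1 hleft).1
      (left_mem_Icc.2 h.curve.1.le) hc hc.1
    rw [h.angle_start, h.angle_mid] at hmono
    exact h.lt.not_ge hmono
  · have hanti := ((h.angle.isRightCCurve_iff h.curve).1 hright).1 hc
      (right_mem_Icc.2 h.curve.1.le) hc.2
    rw [h.angle_finish, h.angle_mid] at hanti
    exact hlt.not_ge hanti

theorem mem_sClass (h : IsRightLeft f τ c α β γ) (hlt : γ < β) : f ∈ sClass α β γ := by
  have hsplit := h.splitsRightLeft hlt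
  rw [sClass, if_neg fun hγ => hlt.ne hγ.2]
  refine ⟨⟨⟨h.curve, Or.inr ⟨c, Or.inl hsplit⟩⟩, h.connects⟩, h.not_isCCurve hlt, c, hsplit, ?_⟩
  rw [h.angle.dir_eq h.curve (Ioc_subset_Icc_self h.mem), h.angle_mid]

end IsRightLeft

theorem tangentLineAt_eq (hdir : f.dir t = Complex.exp (γ * I)) :
    f.tangentLineAt t = {z | (z * Complex.exp (-(γ * I))).im =
      (f.toFun t * Complex.exp (-(γ * I))).im} := by
  ext z
  simp only [tangentLineAt, mem_ofPred_eq, hdir, Complex.exp_neg]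
  constructor
  · rintro ⟨r, rfl⟩
    rw [add_mul, mul_inv_cancel_right₀ (Complex.exp_ne_zero _), Complex.add_im,
      Complex.ofReal_im, add_zero]
  · intro hz
    have hreal : ((((z - f.toFun t) * (Complex.exp (γ * I))⁻¹).re : ℝ) : ℂ) =
        (z - f.toFun t) * (Complex.exp (γ * I))⁻¹ := by
      refine Complex.ext (Complex.ofReal_re _) ?_
      rw [Complex.ofReal_im, sub_mul, Complex.sub_im, hz, sub_self]
    refine ⟨((z - f.toFun t) * (Complex.exp (γ * I))⁻¹).re, ?_⟩
    rw [hreal, inv_mul_cancel_right₀ (Complex.exp_ne_zero _), add_sub_cancel]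

end PlanePath

theorem sClass_subset_sCurves : sClass α β γ ⊆ sCurves (uVec α) (vVec β) := by
  unfold sClass
  split_ifs
  · exact fun f hf => ⟨⟨hf.1.1.1, Or.inl (Or.inr hf.1)⟩, hf.2⟩
  · exact fun f hf => hf.1

/-- The point at which the right c-curve of the minimal curve ends on `ℓ_γ`. -/
noncomputable def inflectionPoint (α β γ : ℝ) : ℂ :=
  scale α β γ * elastica (elasticaParam (α - γ))

theorem model_zero_zero : model α β γ 0 b 0 = pausedPath (inflectionPoint α β γ) (scale α β γ) b
    (-elasticaParam (α - γ)) (b + elasticaParam (β - γ)) := by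
  simp only [model, inflectionPoint, Complex.ofReal_zero, sub_zero, add_zero]

theorem dir_pausedPath_scale {z : ℂ} {A B x : ℝ} (hlam : 0 < lam α β γ) (hx : x ∈ Icc A B)
    (hAB : A < B) : (pausedPath z (scale α β γ) b A B).dir x =
      Complex.exp (modelAngle γ b x * I) :=
  (isDirectionAngle_pausedPath hlam hAB).dir_eq (isCurve_pausedPath
    (mul_ne_zero (by exact_mod_cast hlam.ne') (Complex.exp_ne_zero _)) hAB) hx

theorem tangentLineAt_pausedPath_scale {A B x : ℝ} (hlam : 0 < lam α β γ) (hα : α - γ ∈ Icc 0 π)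
    (hx : x ∈ Icc A B) (hAB : A < B) (hxb : x ∈ Icc 0 b) :
    (pausedPath (inflectionPoint α β γ) (scale α β γ) b A B).tangentLineAt x =
      inflectionLine α β γ := by
  have hdir : (pausedPath (inflectionPoint α β γ) (scale α β γ) b A B).dir x =
      Complex.exp (γ * I) := by
    rw [dir_pausedPath_scale hlam hx hAB, modelAngle, pause_of_mem_mid hxb, elasticaAngle_zero,
      add_zero]
  have hpoint : (inflectionPoint α β γ + scale α β γ * x) * Complex.exp (-(γ * I)) =
      lam α β γ * (elastica (elasticaParam (α - γ)) + x) := by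
    rw [inflectionPoint, ← mul_add, mul_right_comm, Complex.exp_neg,
      mul_inv_cancel_right₀ (Complex.exp_ne_zero _)]
  have him : ((pausedPath (inflectionPoint α β γ) (scale α β γ) b A B).toFun x *
      Complex.exp (-(γ * I))).im = -Real.sin γ * (y₁ α γ / (y₁ α γ + y₂ β γ)) := by
    simp only [pausedPath, pausedElastica_mid hxb, hpoint, Complex.im_ofReal_mul, Complex.add_im,
      Complex.ofReal_im, elastica_elasticaParam hα, Complex.I_mul_im, Complex.ofReal_re, ← y₁_eq,
      lam]
    ring
  rw [tangentLineAt_eq hdir, him, inflectionLine]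

namespace ModelParams

theorem param_mem_right (h : ModelParams α β γ a b d) (hlt : γ < β) :
    elasticaParam (β - γ) ∈ Ioc 0 π :=
  ⟨elasticaParam_pos (sub_pos.2 hlt) h.le₂, (elasticaParam_mem_Icc _).2⟩

theorem param_mem_left (h : ModelParams α β γ a b d) : elasticaParam (α - γ) ∈ Ioc 0 π :=
  ⟨h.param_pos, (elasticaParam_mem_Icc _).2⟩

theorem isOptimalRight (h : ModelParams α β γ 0 b 0) :
    IsOptimalRight (uVec α) (inflectionLine α β γ)
      (pausedPath (inflectionPoint α β γ) (scale α β γ) b (-elasticaParam (α - γ)) 0) := by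
  have hneg : -elasticaParam (α - γ) < 0 := neg_lt_zero.2 h.param_pos
  have hpath := isOptimalRight_pausedPath (z := inflectionPoint α β γ) h.scale_ne_zero h.b_nonneg
    h.param_mem_left
  have hstart := h.isRightLeft.start
  have hangle := h.isRightLeft.angle_start
  rw [model_zero_zero] at hstart hangle
  rwa [tangentLineAt_pausedPath_scale h.lam_pos h.sub_mem₁ (right_mem_Icc.2 hneg.le) hneg
    (left_mem_Icc.2 h.b_nonneg), tangentAt, dir_pausedPath_scale h.lam_pos
    (left_mem_Icc.2 hneg.le) hneg, show modelAngle γ b (-elasticaParam (α - γ)) = α from hangle,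
    show (pausedPath (inflectionPoint α β γ) (scale α β γ) b (-elasticaParam (α - γ)) 0).toFun
      (-elasticaParam (α - γ)) = 0 from hstart] at hpath

theorem isOptimalLeft (h : ModelParams α β γ 0 b 0) (hlt : γ < β) :
    IsOptimalLeft (inflectionLine α β γ) (vVec β)
      (pausedPath (inflectionPoint α β γ) (scale α β γ) b b (b + elasticaParam (β - γ))) := by
  have hlt' : b < b + elasticaParam (β - γ) := lt_add_of_pos_right b (h.param_mem_right hlt).1
  have hpath := isOptimalLeft_pausedPath (z := inflectionPoint α β γ) h.scale_ne_zero h.b_nonneg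
    (h.param_mem_right hlt)
  have hfinish := h.isRightLeft.finish
  have hangle := h.isRightLeft.angle_finish
  rw [model_zero_zero] at hfinish hangle
  rwa [tangentLineAt_pausedPath_scale h.lam_pos h.sub_mem₁ (left_mem_Icc.2 hlt'.le) hlt'
    (right_mem_Icc.2 h.b_nonneg), tangentAt, dir_pausedPath_scale h.lam_pos
    (right_mem_Icc.2 hlt'.le) hlt',
    show modelAngle γ b (b + elasticaParam (β - γ)) = β from hangle,
    show (pausedPath (inflectionPoint α β γ) (scale α β γ) b b (b + elasticaParam (β - γ))).toFun
      (b + elasticaParam (β - γ)) = 1 from hfinish] at hpath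

theorem isJoin (h : ModelParams α β γ 0 b 0) (hlt : γ < β) :
    (model α β γ 0 b 0).IsJoin
      [pausedPath (inflectionPoint α β γ) (scale α β γ) b (-elasticaParam (α - γ)) 0,
        lineSeg (inflectionPoint α β γ + scale α β γ * pausedElastica b 0)
          (inflectionPoint α β γ + scale α β γ * pausedElastica b b),
        pausedPath (inflectionPoint α β γ) (scale α β γ) b b (b + elasticaParam (β - γ))] := by
  have hneg : -elasticaParam (α - γ) < 0 := neg_lt_zero.2 h.param_pos
  have hlt' : b < b + elasticaParam (β - γ) := lt_add_of_pos_right b (h.param_mem_right hlt).1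
  rw [model_zero_zero]
  exact isJoin_pausedPath h.scale_ne_zero h.b_nonneg hneg hlt'
    (.refl_of_isCurve (isCurve_pausedPath h.scale_ne_zero hneg))
    (.refl_of_isCurve (isCurve_pausedPath h.scale_ne_zero hlt'))

theorem isJoin_zero (h : ModelParams α β γ 0 0 0) (hlt : γ < β) :
    (model α β γ 0 0 0).IsJoin
      [pausedPath (inflectionPoint α β γ) (scale α β γ) 0 (-elasticaParam (α - γ)) 0,
        pausedPath (inflectionPoint α β γ) (scale α β γ) 0 0 (0 + elasticaParam (β - γ))] := by
  rw [model_zero_zero]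
  exact isJoin_pausedPath_zero h.scale_ne_zero (neg_lt_zero.2 h.param_pos)
    ((h.param_mem_right hlt).1.trans_eq (zero_add _).symm)

theorem isFirstForm (h : ModelParams α β γ 0 0 0) (hα : α - γ < π) (hβ : β - γ < π) :
    IsFirstForm (-elasticaParam (α - γ)) (elasticaParam (β - γ)) (model α β γ 0 0 0) := by
  rw [model_zero_zero, zero_add]
  exact isFirstForm_pausedPath h.scale_ne_zero (neg_lt_neg (elasticaParam_lt_pi h.sub_mem₁.1 hα))
    ((neg_lt_zero.2 h.param_pos).trans_le (elasticaParam_mem_Icc _).1)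
    (elasticaParam_lt_pi h.sub_mem₂.1 hβ)

theorem isSecondForm (h : ModelParams α β γ 0 b 0) (hα : α - γ = π) (hlt : γ < β) :
    IsSecondForm b (elasticaParam (β - γ)) (model α β γ 0 b 0) := by
  rw [model_zero_zero, hα, elasticaParam_pi]
  exact isSecondForm_pausedPath h.scale_ne_zero h.b_nonneg (h.param_mem_right hlt)

theorem elongatesTo_left (h : ModelParams α β γ 0 b 0) (hα : α - γ = π) (hlt : γ < β)
    (ha : 0 ≤ a) : (model α β γ 0 b 0).ElongatesTo (model α β γ a (b + a) 0) := by
  rcases ha.eq_or_lt with rfl | hpos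
  · rw [add_zero]
    exact Relation.ReflTransGen.refl
  have hβ := add_pos_of_nonneg_of_pos h.b_nonneg (h.param_mem_right hlt).1
  have helong := isElongation_left (z := scale α β γ * elastica π) h.scale_ne_zero h.b_nonneg
    hpos hβ
  refine Relation.ReflTransGen.single ⟨h.isCurve, ?_, Or.inr ?_⟩
  · exact isCurve_pausedPath h.scale_ne_zero
      (by linarith [(elasticaParam_mem_Icc (α - γ)).1])
  · simpa only [model, hα, elasticaParam_pi, Complex.ofReal_zero, sub_zero, add_zero, mul_sub,
      add_right_comm] using helong

theorem elongatesTo_right (h : ModelParams α β γ a b 0) (hβ : d = 0 ∨ β - γ = π) (hd : 0 ≤ d) :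
    (model α β γ a b 0).ElongatesTo (model α β γ a (b + d) d) := by
  rcases hd.eq_or_lt with rfl | hpos
  · rw [add_zero]
    exact Relation.ReflTransGen.refl
  replace hβ := hβ.resolve_left hpos.ne'
  have helong := isElongation_right
    (z := scale α β γ * (elastica (elasticaParam (α - γ)) - a)) h.scale_ne_zero h.b_nonneg hpos
    (h.left_neg.trans_le h.b_nonneg)
  refine Relation.ReflTransGen.single ⟨h.isCurve, ?_, Or.inr ?_⟩
  · exact isCurve_pausedPath h.scale_ne_zero (by linarith [h.left_lt_right])
  · simpa only [model, hβ, elasticaParam_pi, add_zero] using helong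

/-- The equation for the lengths makes the middle segment exceed the one of `model α β γ 0 b 0`
by exactly the lengths of the outer ones. -/
theorem elongatesTo (h₀ : ModelParams α β γ 0 b 0) (hlt : γ < β) (hα : α - γ = π)
    (h : ModelParams α β γ a b' d) (hf : f.IsCurve) (he : f.Equiv (model α β γ a b' d)) :
    (model α β γ 0 b 0).ElongatesTo f := by
  obtain rfl : b' = b + a + d := by
    linarith [mul_left_cancel₀ h.lam_pos.ne' (h₀.eq.trans h.eq.symm)]
  have hleft : ModelParams α β γ a (b + a) 0 :=
    { h₀ with
      a_nonneg := h.a_nonneg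
      a_eq := Or.inr hα
      b_nonneg := add_nonneg h₀.b_nonneg h.a_nonneg
      eq := by rw [← h₀.eq]; ring }
  exact ((h₀.elongatesTo_left hα hlt h.a_nonneg).trans
    (hleft.elongatesTo_right h.d_eq h.d_nonneg)).tail ⟨h.isCurve, hf, Or.inl he.symm⟩

end ModelParams

end MinimalModel

/-! ### Minimal curves -/

section Minimal

variable {f : PlanePath} {x α β γ : ℝ}

theorem turning_elasticaSeg_elasticaParam (hx₀ : 0 < x) (hxπ : x ≤ π) :
    (elasticaSeg 0 (elasticaParam x)).turning = x := by
  rw [turning_elasticaSeg (elasticaParam_pos hx₀ hxπ), elasticaAngle_zero, sub_zero,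
    elasticaAngle_elasticaParam ⟨hx₀.le, hxπ⟩]

theorem left_mem_GammaSet (hα : α < π) (hβ : α - π < β) : α - π ∈ GammaSet α β := by
  unfold GammaSet
  split_ifs
  · exact ⟨le_rfl, hβ.le⟩
  · exact ⟨le_rfl, sub_neg.2 hα⟩

theorem right_mem_GammaSet (hβ : α - π < β) (hβ₀ : β < 0) : β ∈ GammaSet α β := by
  rw [GammaSet, if_pos hβ₀]
  exact ⟨hβ.le, le_rfl⟩

theorem mem_GammaSet_of_mem_Ioo (hγ : γ ∈ Ioo (α - π) (min β 0)) : γ ∈ GammaSet α β := by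
  unfold GammaSet
  split_ifs
  · exact ⟨hγ.1.le, (hγ.2.trans_le (min_le_left _ _)).le⟩
  · exact ⟨hγ.1.le, hγ.2.trans_le (min_le_right _ _)⟩

theorem sigma_left_nonneg (hα : α ∈ Ioo 0 π) (hβα : |β| ≤ α) (hβ : α - π < β)
    (hmin : ∀ x ∈ GammaSet α β, G α β (α - π) ≤ G α β x) : 0 ≤ sigma α β (α - π) := by
  obtain ⟨x, hx⟩ := exists_between (lt_min hβ (sub_neg.2 hα.2))
  exact nonneg_of_mul_nonneg_left (sigma_mul_nonneg hα hβα (left_mem_GammaSet hα.2 hβ) hmin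
    (mem_GammaSet_of_mem_Ioo hx)) (sub_pos.2 hx.1)

theorem sigma_interior_eq_zero (hα : α ∈ Ioo 0 π) (hβα : |β| ≤ α) (hβ : α - π < β)
    (hγ : γ ∈ Ioo (α - π) (min β 0)) (hmin : ∀ x ∈ GammaSet α β, G α β γ ≤ G α β x) :
    sigma α β γ = 0 := by
  obtain ⟨x, hx⟩ := exists_between hγ.2
  have hfirst {x : ℝ} (hx : x ∈ GammaSet α β) : 0 ≤ sigma α β γ * (x - γ) :=
    sigma_mul_nonneg hα hβα (mem_GammaSet_of_mem_Ioo hγ) hmin hx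
  exact le_antisymm
    (nonpos_of_mul_nonneg_left (hfirst (left_mem_GammaSet hα.2 hβ)) (sub_neg.2 hγ.1))
    (nonneg_of_mul_nonneg_left (hfirst (mem_GammaSet_of_mem_Ioo ⟨hγ.1.trans hx.1, hx.2⟩))
      (sub_pos.2 hx.1))

theorem sigma_right_nonpos (hα : α ∈ Ioo 0 π) (hβα : |β| ≤ α) (hβ : α - π < β) (hβ₀ : β < 0)
    (hmin : ∀ x ∈ GammaSet α β, G α β β ≤ G α β x) : sigma α β β ≤ 0 :=
  nonpos_of_mul_nonneg_left (sigma_mul_nonneg hα hβα (right_mem_GammaSet hβ hβ₀) hmin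
    (left_mem_GammaSet hα.2 hβ)) (sub_neg.2 hβ)

theorem G_nonneg (hα : α ∈ Ioo 0 π) (hβα : |β| ≤ α) (hγ : γ ∈ GammaSet α β) : 0 ≤ G α β γ := by
  unfold G
  have hsin : 0 < -Real.sin γ := neg_pos.2 (pos_of_mem_GammaSet hα hβα hγ).1
  positivity

theorem modelParams_of_mem_GammaSet (hα : α ∈ Ioo 0 π) (hβα : |β| ≤ α) (hγ : γ ∈ GammaSet α β)
    (hσ : 0 ≤ sigma α β γ) : ModelParams α β γ 0 (sigma α β γ / lam α β γ) 0 := by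
  obtain ⟨hleft, hneg, hright⟩ := bounds_of_mem_GammaSet hγ
  obtain ⟨hsin, hy⟩ := pos_of_mem_GammaSet hα hβα hγ
  have hlam : 0 < lam α β γ := div_pos (neg_pos.2 hsin) hy
  exact
    { lt := by linarith [hα.1]
      le₁ := by linarith
      le := hright
      le₂ := by linarith [(abs_le.1 hβα).2]
      sin_neg := hsin
      a_nonneg := le_rfl
      a_eq := Or.inl rfl
      b_nonneg := div_nonneg hσ hlam.le
      d_nonneg := le_rfl
      d_eq := Or.inl rfl
      eq := by rw [sub_zero, sub_zero, mul_div_cancel₀ _ hlam.ne'] }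

theorem lt_energy_of_mem_sCurvesLR (hα : α ∈ Ioo 0 π) (hβα : |β| ≤ α) (hβ : α - π < β)
    (hf : f ∈ sCurvesLR (uVec α) (vVec β)) : β < 0 ∧ ENNReal.ofReal (G α β β) < f.energy := by
  obtain ⟨hs, hn, c, hc⟩ := hf
  exact hc.lt_energy hα hβα hβ hs.1.1 hs.2 hn

theorem ofReal_G_le_energy_of_mem_sClass (hα : α ∈ Ioo 0 π) (hβα : |β| ≤ α) (hβ : α - π < β)
    (hγ : γ ∈ GammaSet α β) (hf : f ∈ sClass α β γ) : ENNReal.ofReal (G α β γ) ≤ f.energy := by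
  obtain ⟨τ, c, h, -⟩ := exists_isRightLeft_of_mem_sClass hα hβα hβ hγ hf
  exact h.ofReal_G_le_energy

theorem equiv_model_of_turning_lt (hα : α ∈ Ioo 0 π) (hβα : |β| ≤ α) (hβ : α - π < β)
    (hγ : γ ∈ GammaSet α β) (hlt : α - π < γ) (hσ : sigma α β γ = 0) (hf : f ∈ sClass α β γ)
    (hE : f.energy = ENNReal.ofReal (G α β γ)) : f.Equiv (model α β γ 0 0 0) := by
  obtain ⟨τ, c, h, hcase⟩ := exists_isRightLeft_of_mem_sClass hα hβα hβ hγ hf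
  obtain ⟨a, b, d, hM, he⟩ := h.exists_equiv_model hcase hE
  obtain rfl := hM.a_eq.resolve_right (by linarith)
  obtain rfl := hM.d_eq.resolve_right (by linarith [(abs_le.1 hβα).2])
  have hb := hM.eq
  rw [hσ, sub_zero, sub_zero] at hb
  rwa [(mul_eq_zero.1 hb).resolve_left hM.lam_pos.ne'] at he

theorem minimal_left (hα : α ∈ Ioo 0 π) (hβα : |β| ≤ α) (hβ : α - π < β)
    (hmin : ∀ x ∈ GammaSet α β, G α β (α - π) ≤ G α β x) :
    0 ≤ sigma α β (α - π) ∧ ∃ fγ r l : PlanePath,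
      IsOptimalRight (uVec α) (inflectionLine α β (α - π)) r ∧
      IsOptimalLeft (inflectionLine α β (α - π)) (vVec β) l ∧
      fγ.IsJoin [r, lineSeg r.finish l.start, l] ∧
      (∃ t₂ ∈ Icc 0 π, (elasticaSeg 0 t₂).turning = β - (α - π) ∧
        IsSecondForm (sigma α β (α - π) / lam α β (α - π)) t₂ fγ) ∧
      fγ ∈ sClass α β (α - π) ∧ fγ.energy = ENNReal.ofReal (G α β (α - π)) ∧
      ∀ f ∈ sClass α β (α - π), f.energy = ENNReal.ofReal (G α β (α - π)) →
        fγ.ElongatesTo f := by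
  have hσ := sigma_left_nonneg hα hβα hβ hmin
  have hmem := left_mem_GammaSet hα.2 hβ
  have hM := modelParams_of_mem_GammaSet hα hβα hmem hσ
  have hπ : α - (α - π) = π := sub_sub_cancel _ _
  refine ⟨hσ, _, _, _, hM.isOptimalRight, hM.isOptimalLeft hβ, hM.isJoin hβ,
    ⟨_, elasticaParam_mem_Icc _, turning_elasticaSeg_elasticaParam (sub_pos.2 hβ) hM.le₂,
      hM.isSecondForm hπ hβ⟩, hM.isRightLeft.mem_sClass hβ, hM.energy, fun f hf hE => ?_⟩
  obtain ⟨τ, c, h, hcase⟩ := exists_isRightLeft_of_mem_sClass hα hβα hβ hmem hf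
  obtain ⟨a, b, d, hM', he⟩ := h.exists_equiv_model hcase hE
  exact hM.elongatesTo hβ hπ hM' h.curve he

theorem minimal_interior (hα : α ∈ Ioo 0 π) (hβα : |β| ≤ α) (hβ : α - π < β)
    (hγ : γ ∈ Ioo (α - π) (min β 0)) (hmin : ∀ x ∈ GammaSet α β, G α β γ ≤ G α β x) :
    sigma α β γ = 0 ∧ ∃ fγ r l : PlanePath,
      IsOptimalRight (uVec α) (inflectionLine α β γ) r ∧
      IsOptimalLeft (inflectionLine α β γ) (vVec β) l ∧
      fγ.IsJoin [r, l] ∧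
      (∃ t₁ ∈ Icc 0 π, ∃ t₂ ∈ Icc 0 π, (elasticaSeg 0 t₁).turning = α - γ ∧
        (elasticaSeg 0 t₂).turning = β - γ ∧ IsFirstForm (-t₁) t₂ fγ) ∧
      fγ ∈ sClass α β γ ∧ fγ.energy = ENNReal.ofReal (G α β γ) ∧
      ∀ f ∈ sClass α β γ, f.energy = ENNReal.ofReal (G α β γ) → f.Equiv fγ := by
  have hσ := sigma_interior_eq_zero hα hβα hβ hγ hmin
  have hmem := mem_GammaSet_of_mem_Ioo hγ
  have hM := modelParams_of_mem_GammaSet hα hβα hmem hσ.ge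
  rw [hσ, zero_div] at hM
  have hlt : γ < β := hγ.2.trans_le (min_le_left _ _)
  have hαπ : α - γ < π := sub_lt_comm.1 hγ.1
  exact ⟨hσ, _, _, _, hM.isOptimalRight, hM.isOptimalLeft hlt, hM.isJoin_zero hlt,
    ⟨_, elasticaParam_mem_Icc _, _, elasticaParam_mem_Icc _,
      turning_elasticaSeg_elasticaParam (sub_pos.2 hM.lt) hM.le₁,
      turning_elasticaSeg_elasticaParam (sub_pos.2 hlt) hM.le₂,
      hM.isFirstForm hαπ ((sub_le_sub_right (le_of_abs_le hβα) γ).trans_lt hαπ)⟩,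
    hM.isRightLeft.mem_sClass hlt, hM.energy,
    fun f hf hE => equiv_model_of_turning_lt hα hβα hβ hmem hγ.1 hσ hf hE⟩

theorem minimal_right (hα : α ∈ Ioo 0 π) (hβα : |β| ≤ α) (hβ : α - π < β) (hβ₀ : β < 0)
    (hσ : 0 ≤ sigma α β β) (hmin : ∀ x ∈ GammaSet α β, G α β β ≤ G α β x) :
    sigma α β β = 0 ∧ ∃ fβ : PlanePath,
      IsOptimalRight (uVec α) (inflectionLine α β β) fβ ∧
      (∃ t₁ ∈ Icc 0 π, (elasticaSeg 0 t₁).turning = α - β ∧ IsFirstForm (-t₁) 0 fβ) ∧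
      fβ ∈ sClass α β β ∧ fβ.energy = ENNReal.ofReal (G α β β) ∧
      ∀ f ∈ sClass α β β, f.energy = ENNReal.ofReal (G α β β) → f.Equiv fβ := by
  replace hσ := le_antisymm (sigma_right_nonpos hα hβα hβ hβ₀ hmin) hσ
  have hmem := right_mem_GammaSet hβ hβ₀
  have hM := modelParams_of_mem_GammaSet hα hβα hmem hσ.ge
  rw [hσ, zero_div] at hM
  have ht : elasticaParam (β - β) = 0 := by rw [sub_self, elasticaParam_zero]
  have hmodel : pausedPath (inflectionPoint α β β) (scale α β β) 0 (-elasticaParam (α - β)) 0 =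
      model α β β 0 0 0 := by
    rw [model_zero_zero, ht, add_zero]
  have hform := hM.isFirstForm (sub_lt_comm.1 hβ) (by rw [sub_self]; exact Real.pi_pos)
  have hcurve := isRightCCurve_pausedPath (z := inflectionPoint α β β) hM.scale_ne_zero
    le_rfl (neg_lt_zero.2 hM.param_pos)
  rw [ht] at hform
  refine ⟨hσ, model α β β 0 0 0, hmodel ▸ hM.isOptimalRight,
    ⟨_, elasticaParam_mem_Icc _, turning_elasticaSeg_elasticaParam (sub_pos.2 hM.lt) hM.le₁,
      hform⟩, ?_, hM.energy,
    fun f hf hE => equiv_model_of_turning_lt hα hβα hβ hmem hβ hσ hf hE⟩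
  rw [sClass, if_pos ⟨hβ₀, rfl⟩]
  exact ⟨hmodel ▸ hcurve, hM.isRightLeft.connects⟩

theorem exists_mem_sClass_energy_eq (hα : α ∈ Ioo 0 π) (hβα : |β| ≤ α) (hβ : α - π < β)
    (hσ : β < 0 → 0 ≤ sigma α β β) (hγ : γ ∈ GammaSet α β)
    (hmin : ∀ x ∈ GammaSet α β, G α β γ ≤ G α β x) :
    ∃ f ∈ sClass α β γ, f.energy = ENNReal.ofReal (G α β γ) := by
  obtain ⟨hleft, hneg, hright⟩ := bounds_of_mem_GammaSet hγ
  rcases hleft.eq_or_lt with rfl | hleft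
  · obtain ⟨-, f, -, -, -, -, -, -, hf, hE, -⟩ := minimal_left hα hβα hβ hmin
    exact ⟨f, hf, hE⟩
  rcases hright.eq_or_lt with rfl | hright
  · obtain ⟨-, f, -, -, hf, hE, -⟩ := minimal_right hα hβα hβ hneg (hσ hneg) hmin
    exact ⟨f, hf, hE⟩
  · obtain ⟨-, f, -, -, -, -, -, -, hf, hE, -⟩ :=
      minimal_interior hα hβα hβ ⟨hleft, lt_min hright hneg⟩ hmin
    exact ⟨f, hf, hE⟩

theorem isLeast_energy_sCurves (hα : α ∈ Ioo 0 π) (hβα : |β| ≤ α) (hβ : α - π < β)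
    (hσ : β < 0 → 0 ≤ sigma α β β) (hγ : γ ∈ GammaSet α β)
    (hmin : ∀ x ∈ GammaSet α β, G α β γ ≤ G α β x) :
    IsLeast (energy '' sCurves (uVec α) (vVec β)) (ENNReal.ofReal (G α β γ)) := by
  obtain ⟨f, hf, hE⟩ := exists_mem_sClass_energy_eq hα hβα hβ hσ hγ hmin
  refine ⟨⟨f, sClass_subset_sCurves hf, hE⟩, ?_⟩
  rintro _ ⟨g, hg, rfl⟩
  exact ofReal_le_energy_of_mem_sCurves hα hβα hβ hmin hg

end Minimal

end ElasticSpline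

theorem corollary5p12 (α β : ℝ) (hα : α ∈ Set.Ioo 0 Real.pi) (hβα : |β| ≤ α)
    (hβ : α - Real.pi < β) (hσ : β < 0 → 0 ≤ sigma α β β) :
    ∃ Gmin : ℝ, IsLeast (G α β '' GammaSet α β) Gmin ∧
      -- (i)
      (β < 0 → ∀ f ∈ sCurvesLR (uVec α) (vVec β), ENNReal.ofReal Gmin < f.energy) ∧
      -- (ii)
      (∀ γ ∈ GammaSet α β, Gmin < G α β γ →
        ∀ f ∈ sClass α β γ, ENNReal.ofReal Gmin < f.energy) ∧
      -- (iii)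
      (G α β (α - Real.pi) = Gmin →
        0 ≤ sigma α β (α - Real.pi) ∧
        ∃ fγ r l : PlanePath,
          IsOptimalRight (uVec α) (inflectionLine α β (α - Real.pi)) r ∧
          IsOptimalLeft (inflectionLine α β (α - Real.pi)) (vVec β) l ∧
          fγ.IsJoin [r, PlanePath.lineSeg r.finish l.start, l] ∧
          (∃ t₂ ∈ Set.Icc 0 Real.pi, (elasticaSeg 0 t₂).turning = β - (α - Real.pi) ∧
            IsSecondForm (sigma α β (α - Real.pi) / lam α β (α - Real.pi)) t₂ fγ) ∧
          fγ ∈ sClass α β (α - Real.pi) ∧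
          fγ.energy = ENNReal.ofReal Gmin ∧
          ∀ f ∈ sClass α β (α - Real.pi), f.energy = ENNReal.ofReal Gmin →
            fγ.ElongatesTo f) ∧
      -- (iv)
      (∀ γ ∈ Set.Ioo (α - Real.pi) (min β 0), G α β γ = Gmin →
        sigma α β γ = 0 ∧
        ∃ fγ r l : PlanePath,
          IsOptimalRight (uVec α) (inflectionLine α β γ) r ∧
          IsOptimalLeft (inflectionLine α β γ) (vVec β) l ∧
          fγ.IsJoin [r, l] ∧
          (∃ t₁ ∈ Set.Icc 0 Real.pi, ∃ t₂ ∈ Set.Icc 0 Real.pi,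
            (elasticaSeg 0 t₁).turning = α - γ ∧ (elasticaSeg 0 t₂).turning = β - γ ∧
            IsFirstForm (-t₁) t₂ fγ) ∧
          fγ ∈ sClass α β γ ∧
          fγ.energy = ENNReal.ofReal Gmin ∧
          ∀ f ∈ sClass α β γ, f.energy = ENNReal.ofReal Gmin → f.Equiv fγ) ∧
      -- (v)
      (β < 0 → G α β β = Gmin →
        sigma α β β = 0 ∧
        ∃ fβ : PlanePath,
          IsOptimalRight (uVec α) (inflectionLine α β β) fβ ∧
          (∃ t₁ ∈ Set.Icc 0 Real.pi, (elasticaSeg 0 t₁).turning = α - β ∧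
            IsFirstForm (-t₁) 0 fβ) ∧
          fβ ∈ sClass α β β ∧
          fβ.energy = ENNReal.ofReal Gmin ∧
          ∀ f ∈ sClass α β β, f.energy = ENNReal.ofReal Gmin → f.Equiv fβ) ∧
      -- (vi)
      IsLeast (PlanePath.energy '' sCurves (uVec α) (vVec β)) (ENNReal.ofReal Gmin) := by
  obtain ⟨_, hG⟩ := exists_isLeast_G hα hβα hβ
  refine ⟨_, hG, ?_⟩
  obtain ⟨⟨γ₀, hγ₀, rfl⟩, hlower⟩ := hG
  have hmin : ∀ γ ∈ GammaSet α β, G α β γ₀ ≤ G α β γ := fun γ hγ => hlower (mem_image_of_mem _ hγ)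
  refine ⟨fun hβ₀ f hf => ?_, fun γ hγ hlt f hf => ?_, fun heq => ?_, fun γ hγ heq => ?_,
    fun hβ₀ heq => ?_, isLeast_energy_sCurves hα hβα hβ hσ hγ₀ hmin⟩
  · exact (ENNReal.ofReal_le_ofReal (hmin β (right_mem_GammaSet hβ hβ₀))).trans_lt
      (lt_energy_of_mem_sCurvesLR hα hβα hβ hf).2
  · exact ((ENNReal.ofReal_lt_ofReal_iff_of_nonneg (G_nonneg hα hβα hγ₀)).2 hlt).trans_le
      (ofReal_G_le_energy_of_mem_sClass hα hβα hβ hγ hf)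
  · rw [← heq] at hmin ⊢
    exact minimal_left hα hβα hβ hmin
  · rw [← heq] at hmin ⊢
    exact minimal_interior hα hβα hβ hγ hmin
  · rw [← heq] at hmin ⊢
    exact minimal_right hα hβα hβ hβ₀ (hσ hβ₀) hmin
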